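/- Work in homotopy type theory: intensional Martin-Löf type theory with a cumulative hierarchy of universes, function extensionality, univalence, propositional truncation $\|A\|$ (we write $\exists(x:A).B(x)$ for $\|\Sigma(x:A).B(x)\|$), and the quotient inductive-inductive type of Brouwer trees. The latter consists of a set $\mathsf{Brw}$ and a relation $\le$ on it, valued in propositions, generated simultaneously as follows, where $x<y$ stands for $\mathsf{succ}\,x\le y$, and a sequence $f:\mathbb N\to\mathsf{Brw}$ is increasing if $f(k)<f(k+1)$ for all $k$. The constructors of $\mathsf{Brw}$ are $\mathsf{zero}$; $\mathsf{succ}\,x$ for $x:\mathsf{Brw}$; $\mathsf{limit}\,f$ for increasing $f$; and an equality $\mathsf{limit}\,f=\mathsf{limit}\,g$ for all increasing $f,g$ with $\forall k.\exists n.\,f(k)\le g(n)$ and $\forall k.\exists n.\,g(k)\le f(n)$. The constructors of $\le$ are: $\mathsf{zero}\le x$; transitivity; $x\le y\to\mathsf{succ}\,x\le\mathsf{succ}\,y$; $x\le f(k)\to x\le\mathsf{limit}\,f$; and $(\forall k.\,f(k)\le x)\to\mathsf{limit}\,f\le x$. Let $\omega=\mathsf{limit}\,\iota$, where $\iota:\mathbb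 N\to\mathsf{Brw}$ sends $n$ to $\mathsf{succ}^n\,\mathsf{zero}$. Addition is defined by $x+\mathsf{zero}=x$, $x+\mathsf{succ}\,y=\mathsf{succ}(x+y)$, $x+\mathsf{limit}\,f=\mathsf{limit}(\lambda k.\,x+f(k))$, and $\omega\cdot 2$ is obtained from $x\cdot\mathsf{zero}=\mathsf{zero}$ and $x\cdot\mathsf{succ}\,y=x\cdot y+x$. Write $\mathsf{Dec}(P)$ for $P\uplus\neg P$, and let $\mathsf{LPO}$ (the limited principle of omniscience) be the type $$\forall(s:\mathbb N\to\{\mathsf{ff},\mathsf{tt}\}).\ (\forall n.\,s_n=\mathsf{ff})\uplus(\exists n.\,s_n=\mathsf{tt}).$$ Theorem. The following types are logically equivalent, i.e. between any two of them there are (derivable, closed) functions in both directions: 1. $\mathsf{LPO}$; 2. $\forall(x,y:\mathsf{Brw}).\,\mathsf{Dec}(x\le y)$; 3. $\forall(x,y:\mathsf{Brw}).\,\mathsf{Dec}(x<y)$; 4. $\forall(x:\mathsf{Brw}).\,\mathsf{Dec}(\omega<x)$; 5. $\forall(x,y:\mathsf{Brw}).\,\mathsf{Dec}(x=y)$; 6.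 $\forall(x:\mathsf{Brw}).\,\mathsf{Dec}(x=\omega\cdot 2)$. -/

import Mathlib

/-!
The result is a theorem of constructive mathematics: classically all six statements are simply
true. It is therefore stated about *derivability in homotopy type theory*. This file defines the
formal system: Martin-Löf type theory with `Π`, `Σ`, identity types, `𝟎`, `𝟏`, `𝟐`, `ℕ`, `⊎`, a
cumulative hierarchy of universes, function extensionality, univalence, propositional truncation,
and the quotient inductive-inductive type of Brouwer trees. As in the first formal presentation in
the appendix of the HoTT book, all type formers except `Π` and universes are primitive constants.
-/

namespace HoTT

/-! ### Raw terms -/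

/-- The primitive constants. Indices are universe levels; `i` is the level of the types
involved and `j` the level of the motive of an eliminator. -/
inductive Const : Type
  -- dependent pairs
  | sig (i : ℕ) | pair (i : ℕ) | fst (i : ℕ) | snd (i : ℕ)
  -- identity types
  | id (i : ℕ) | refl (i : ℕ) | J (i j : ℕ)
  -- empty type, unit type, booleans, natural numbers, binary sums
  | empty | emptyElim (j : ℕ)
  | unit | star | unitElim (j : ℕ)
  | bool | ff | tt | boolElim (j : ℕ)
  | nat | nzero | nsucc | natElim (j : ℕ)
  | sum (i : ℕ) | inl (i : ℕ) | inr (i : ℕ) | sumElim (i j : ℕ)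
  -- axioms: function extensionality and univalence
  | funext (i : ℕ) | ua (i : ℕ)
  -- propositional truncation
  | trunc (i : ℕ) | tr (i : ℕ) | squash (i : ℕ) | truncElim (i j : ℕ)
  -- Brouwer trees
  | brw | bzero | bsucc | limit | bisim | brwSet
  -- the order of Brouwer trees
  | le | leZero | leTrans | leSuccMono | leCocone | leLimiting | leProp
  -- simultaneous induction for Brouwer trees and their order
  | brwElim (j : ℕ) | leElim (j : ℕ)
  deriving DecidableEq

/-- Raw terms, with de Bruijn indices. Types are terms (universes are à la Russell). -/
inductive Tm : Type
  | var (n : ℕ)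
  | univ (i : ℕ)
  | pi (A B : Tm)
  | lam (A t : Tm)
  | app (f a : Tm)
  | con (c : Const)
  deriving DecidableEq

namespace Tm

/-- Extend a renaming under a binder. -/
def upRen (ρ : ℕ → ℕ) : ℕ → ℕ
  | 0 => 0
  | n + 1 => ρ n + 1

def rename : (ℕ → ℕ) → Tm → Tm
  | ρ, var n => var (ρ n)
  | _, univ i => univ i
  | ρ, pi A B => pi (rename ρ A) (rename (upRen ρ) B)
  | ρ, lam A t => lam (rename ρ A) (rename (upRen ρ) t)
  | ρ, app f a => app (rename ρ f) (rename ρ a)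
  | _, con c => con c

/-- Weakening by one variable. -/
def lift (t : Tm) : Tm := rename Nat.succ t

/-- Extend a substitution under a binder. -/
def upSub (σ : ℕ → Tm) : ℕ → Tm
  | 0 => var 0
  | n + 1 => lift (σ n)

def subst : (ℕ → Tm) → Tm → Tm
  | σ, var n => σ n
  | _, univ i => univ i
  | σ, pi A B => pi (subst σ A) (subst (upSub σ) B)
  | σ, lam A t => lam (subst σ A) (subst (upSub σ) t)
  | σ, app f a => app (subst σ f) (subst σ a)
  | _, con c => con c

/-- The substitution that replaces variable `0` by `a` and lowers the other variables. -/
def single (a : Tm) : ℕ → Tm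
  | 0 => a
  | n + 1 => var n

/-- `t[a]`: instantiate variable `0` of `t` by `a`. -/
def inst (t a : Tm) : Tm := subst (single a) t

/-- A constant applied to a list of arguments. -/
def capp (c : Const) (as : List Tm) : Tm := as.foldl app (con c)

end Tm

/-! ### Writing terms with named binders

`Sch` is a device for writing closed raw terms legibly: a `Sch` is a term as a function of the
number of binders around it, so that binders can be written as Lean functions. The raw term that
a closed `Sch` denotes is its value at `0`. -/

structure Sch : Type where
  toTm : ℕ → Tm

/-- The variable bound by the binder that is itself under `n` binders. -/
def bvar (n : ℕ) : Sch := ⟨fun m => .var (m - (n + 1))⟩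

def PiT (A : Sch) (B : Sch → Sch) : Sch :=
  ⟨fun n => .pi (A.toTm n) ((B (bvar n)).toTm (n + 1))⟩

def Lam (A : Sch) (t : Sch → Sch) : Sch :=
  ⟨fun n => .lam (A.toTm n) ((t (bvar n)).toTm (n + 1))⟩

def App (f a : Sch) : Sch := ⟨fun n => .app (f.toTm n) (a.toTm n)⟩

def U (i : ℕ) : Sch := ⟨fun _ => .univ i⟩

def K (c : Const) : Sch := ⟨fun _ => .con c⟩

/-- The raw term denoted by a closed scheme. -/
def Sch.close (t : Sch) : Tm := t.toTm 0

infixl:90 " ⬝ " => App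

/-- Non-dependent function type. -/
def Arr (A B : Sch) : Sch := PiT A fun _ => B

infixr:60 " ⇒ " => Arr

/-! ### Basic type formers and defined notions -/

/-- `Σ (x : A). B x` -/
def Sig (i : ℕ) (A : Sch) (B : Sch → Sch) : Sch := K (.sig i) ⬝ A ⬝ Lam A B

/-- `A × B` -/
def ProdT (i : ℕ) (A B : Sch) : Sch := Sig i A fun _ => B

/-- `(a, b) : Σ (x : A). B x` -/
def Pair (i : ℕ) (A : Sch) (B : Sch → Sch) (a b : Sch) : Sch :=
  K (.pair i) ⬝ A ⬝ Lam A B ⬝ a ⬝ b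

def Fst (i : ℕ) (A : Sch) (B : Sch → Sch) (p : Sch) : Sch := K (.fst i) ⬝ A ⬝ Lam A B ⬝ p

def Snd (i : ℕ) (A : Sch) (B : Sch → Sch) (p : Sch) : Sch := K (.snd i) ⬝ A ⬝ Lam A B ⬝ p

/-- `a =_A b` -/
def IdT (i : ℕ) (A a b : Sch) : Sch := K (.id i) ⬝ A ⬝ a ⬝ b

def Refl (i : ℕ) (A a : Sch) : Sch := K (.refl i) ⬝ A ⬝ a

/-- Path induction based at `a`, with motive `C x p` for `p : a = x`, used at `p : a = b`. -/
def PathInd (i j : ℕ) (A a : Sch) (C : Sch → Sch → Sch) (d b p : Sch) : Sch :=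
  K (.J i j) ⬝ A ⬝ a ⬝ (Lam A fun x => Lam (IdT i A a x) fun e => C x e) ⬝ d ⬝ b ⬝ p

/-- Transport of `u : P x` along `e : x = y`. -/
def Transport (i j : ℕ) (A : Sch) (P : Sch → Sch) (x y e u : Sch) : Sch :=
  PathInd i j A x (fun y _ => P y) u y e

def isProp (i : ℕ) (A : Sch) : Sch := PiT A fun x => PiT A fun y => IdT i A x y

def isSet (i : ℕ) (A : Sch) : Sch := PiT A fun x => PiT A fun y => isProp i (IdT i A x y)

def EmptyT : Sch := K .empty
def UnitT : Sch := K .unit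
def Star : Sch := K .star
def BoolT : Sch := K .bool
def FF : Sch := K .ff
def TT : Sch := K .tt
def NatT : Sch := K .nat
def NZero : Sch := K .nzero
def NSucc (n : Sch) : Sch := K .nsucc ⬝ n

/-- `A ⊎ B` -/
def SumT (i : ℕ) (A B : Sch) : Sch := K (.sum i) ⬝ A ⬝ B

/-- Propositional truncation `∥A∥`. -/
def TruncT (i : ℕ) (A : Sch) : Sch := K (.trunc i) ⬝ A

/-- `∃ (x : A). B x`, the truncated `Σ`. -/
def Ex (i : ℕ) (A : Sch) (B : Sch → Sch) : Sch := TruncT i (Sig i A B)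

/-- `¬ A`, for small `A`. -/
def NotT (A : Sch) : Sch := A ⇒ EmptyT

/-- `Dec A`, that is, `A ⊎ ¬ A`, for small `A`. -/
def Dec (A : Sch) : Sch := SumT 0 A (NotT A)

/-- `f : A → B` has a right inverse and a left inverse. -/
def isEquiv (i : ℕ) (A B f : Sch) : Sch :=
  ProdT i (Sig i (B ⇒ A) fun g => PiT B fun b => IdT i B (f ⬝ (g ⬝ b)) b)
    (Sig i (B ⇒ A) fun h => PiT A fun a => IdT i A (h ⬝ (f ⬝ a)) a)

/-- `A ≃ B` -/
def EquivT (i : ℕ) (A B : Sch) : Sch := Sig i (A ⇒ B) (isEquiv i A B)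

/-- The identity equivalence. -/
def idEquiv (i : ℕ) (A : Sch) : Sch :=
  let inv : Sch :=
    Pair i (A ⇒ A) (fun g => PiT A fun a => IdT i A (g ⬝ a) a) (Lam A fun x => x)
      (Lam A fun a => Refl i A a)
  Pair i (A ⇒ A) (isEquiv i A A) (Lam A fun x => x)
    (Pair i (Sig i (A ⇒ A) fun g => PiT A fun a => IdT i A (g ⬝ a) a)
      (fun _ => Sig i (A ⇒ A) fun g => PiT A fun a => IdT i A (g ⬝ a) a) inv inv)

/-- The canonical function `(A = B) → (A ≃ B)`. -/
def idToEquiv (i : ℕ) (A B : Sch) : Sch :=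
  Lam (IdT (i + 1) (U i) A B) fun p =>
    PathInd (i + 1) i (U i) A (fun X _ => EquivT i A X) (idEquiv i A) B p

/-! ### Brouwer trees: constructors -/

def Brw : Sch := K .brw
def BZero : Sch := K .bzero
def BSucc (x : Sch) : Sch := K .bsucc ⬝ x

/-- `limit f`, where `p` witnesses that `f` is increasing. -/
def Limit (f p : Sch) : Sch := K .limit ⬝ f ⬝ p

/-- `x ≤ y` -/
def Le (x y : Sch) : Sch := K .le ⬝ x ⬝ y

/-- `x < y`, that is, `succ x ≤ y`. -/
def Lt (x y : Sch) : Sch := Le (BSucc x) y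

/-- `f : ℕ → Brw` is (strictly) increasing. -/
def Increasing (f : Sch) : Sch := PiT NatT fun k => Lt (f ⬝ k) (f ⬝ NSucc k)

/-- `f` is simulated by `g`. Bisimilarity is simulation in both directions. -/
def Simulated (f g : Sch) : Sch := PiT NatT fun k => Ex 0 NatT fun n => Le (f ⬝ k) (g ⬝ n)

/-! ### Brouwer trees: induction

`Brw` and `≤` are eliminated simultaneously, into a family `A` of sets over `Brw` and a family `B`
of propositions over `≤` that depends on `A`. There is one method for every constructor; the
method for `bisim` produces a path over `bisim`, and its induction hypotheses for the truncated
premises are truncated as well. -/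

/-- `p` is increasing over `h`: the induction hypothesis for the increasingness witness `p` of
`f`, where `F` is the induction hypothesis for `f`, and `ms` the method for `succ`. -/
def IncreasingOver (B ms f p F : Sch) : Sch :=
  PiT NatT fun k => B ⬝ BSucc (f ⬝ k) ⬝ (f ⬝ NSucc k) ⬝ (ms ⬝ (f ⬝ k) ⬝ (F ⬝ k)) ⬝ (F ⬝ NSucc k) ⬝
    (p ⬝ k)

/-- The induction hypothesis for `Simulated f g`. -/
def SimulatedOver (j : ℕ) (B f F g G : Sch) : Sch :=
  PiT NatT fun k => Ex j NatT fun n => Sig j (Le (f ⬝ k) (g ⬝ n)) fun l =>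
    B ⬝ (f ⬝ k) ⬝ (g ⬝ n) ⬝ (F ⬝ k) ⬝ (G ⬝ n) ⬝ l

/-- An increasing sequence `f` with witness `p` and the induction hypotheses `F` and `P`. -/
def PiSeq (A B ms : Sch) (C : Sch → Sch → Sch → Sch → Sch) : Sch :=
  PiT (NatT ⇒ Brw) fun f => PiT (Increasing f) fun p =>
  PiT (PiT NatT fun k => A ⬝ (f ⬝ k)) fun F => PiT (IncreasingOver B ms f p F) fun P => C f p F P

/-- The type of the eliminators: the product over the motives and methods of `C A B ps`, where
`ps` is the list of all motives and methods. -/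
def ElimType (j : ℕ) (C : Sch → Sch → List Sch → Sch) : Sch :=
  -- motives
  PiT (Brw ⇒ U j) fun A =>
  PiT (PiT Brw fun x => PiT Brw fun y => (A ⬝ x) ⇒ (A ⬝ y) ⇒ Le x y ⇒ U j) fun B =>
  -- truncation constructors
  PiT (PiT Brw fun x => isSet j (A ⬝ x)) fun hA =>
  PiT (PiT Brw fun x => PiT Brw fun y => PiT (A ⬝ x) fun a => PiT (A ⬝ y) fun b => PiT (Le x y) fun l =>
    isProp j (B ⬝ x ⬝ y ⬝ a ⬝ b ⬝ l)) fun hB =>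
  -- zero, succ, limit, bisim
  PiT (A ⬝ BZero) fun mz =>
  PiT (PiT Brw fun x => (A ⬝ x) ⇒ (A ⬝ BSucc x)) fun ms =>
  PiT (PiSeq A B ms fun f p _ _ => A ⬝ Limit f p) fun ml =>
  PiT (PiSeq A B ms fun f p F P => PiSeq A B ms fun g q G Q =>
    PiT (Simulated f g) fun s => PiT (Simulated g f) fun t =>
    SimulatedOver j B f F g G ⇒ SimulatedOver j B g G f F ⇒
    IdT j (A ⬝ Limit g q)
      (Transport 0 j Brw (fun x => A ⬝ x) (Limit f p) (Limit g q)
        (K .bisim ⬝ f ⬝ p ⬝ g ⬝ q ⬝ s ⬝ t) (ml ⬝ f ⬝ p ⬝ F ⬝ P))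
      (ml ⬝ g ⬝ q ⬝ G ⬝ Q)) fun mb =>
  -- the constructors of the order
  PiT (PiT Brw fun x => PiT (A ⬝ x) fun a => B ⬝ BZero ⬝ x ⬝ mz ⬝ a ⬝ (K .leZero ⬝ x)) fun m₁ =>
  PiT (PiT Brw fun x => PiT Brw fun y => PiT Brw fun z =>
    PiT (A ⬝ x) fun a => PiT (A ⬝ y) fun b => PiT (A ⬝ z) fun c =>
    PiT (Le x y) fun l => PiT (Le y z) fun l' =>
    (B ⬝ x ⬝ y ⬝ a ⬝ b ⬝ l) ⇒ (B ⬝ y ⬝ z ⬝ b ⬝ c ⬝ l') ⇒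
    (B ⬝ x ⬝ z ⬝ a ⬝ c ⬝ (K .leTrans ⬝ x ⬝ y ⬝ z ⬝ l ⬝ l'))) fun m₂ =>
  PiT (PiT Brw fun x => PiT Brw fun y => PiT (A ⬝ x) fun a => PiT (A ⬝ y) fun b => PiT (Le x y) fun l =>
    (B ⬝ x ⬝ y ⬝ a ⬝ b ⬝ l) ⇒
    (B ⬝ BSucc x ⬝ BSucc y ⬝ (ms ⬝ x ⬝ a) ⬝ (ms ⬝ y ⬝ b) ⬝ (K .leSuccMono ⬝ x ⬝ y ⬝ l))) fun m₃ =>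
  PiT (PiSeq A B ms fun f p F P => PiT Brw fun x => PiT (A ⬝ x) fun a => PiT NatT fun k =>
    PiT (Le x (f ⬝ k)) fun l => (B ⬝ x ⬝ (f ⬝ k) ⬝ a ⬝ (F ⬝ k) ⬝ l) ⇒
    (B ⬝ x ⬝ Limit f p ⬝ a ⬝ (ml ⬝ f ⬝ p ⬝ F ⬝ P) ⬝ (K .leCocone ⬝ f ⬝ p ⬝ x ⬝ k ⬝ l))) fun m₄ =>
  PiT (PiSeq A B ms fun f p F P => PiT Brw fun x => PiT (A ⬝ x) fun a =>
    PiT (PiT NatT fun k => Le (f ⬝ k) x) fun l =>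
    (PiT NatT fun k => B ⬝ (f ⬝ k) ⬝ x ⬝ (F ⬝ k) ⬝ a ⬝ (l ⬝ k)) ⇒
    (B ⬝ Limit f p ⬝ x ⬝ (ml ⬝ f ⬝ p ⬝ F ⬝ P) ⬝ a ⬝ (K .leLimiting ⬝ f ⬝ p ⬝ x ⬝ l))) fun m₅ =>
  C A B [A, B, hA, hB, mz, ms, ml, mb, m₁, m₂, m₃, m₄, m₅]

/-- A constant applied to a list of arguments. -/
def KApp (c : Const) (as : List Sch) : Sch := as.foldl App (K c)

/-! ### The types of the constants -/

def constType : Const → Sch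
  | .sig i => PiT (U i) fun A => (A ⇒ U i) ⇒ U i
  | .pair i => PiT (U i) fun A => PiT (A ⇒ U i) fun B => PiT A fun a => (B ⬝ a) ⇒ (K (.sig i) ⬝ A ⬝ B)
  | .fst i => PiT (U i) fun A => PiT (A ⇒ U i) fun B => (K (.sig i) ⬝ A ⬝ B) ⇒ A
  | .snd i => PiT (U i) fun A => PiT (A ⇒ U i) fun B => PiT (K (.sig i) ⬝ A ⬝ B) fun p =>
      B ⬝ (K (.fst i) ⬝ A ⬝ B ⬝ p)
  | .id i => PiT (U i) fun A => A ⇒ A ⇒ U i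
  | .refl i => PiT (U i) fun A => PiT A fun a => IdT i A a a
  | .J i j => PiT (U i) fun A => PiT A fun a => PiT (PiT A fun x => IdT i A a x ⇒ U j) fun C =>
      (C ⬝ a ⬝ Refl i A a) ⇒ PiT A fun x => PiT (IdT i A a x) fun p => C ⬝ x ⬝ p
  | .empty => U 0
  | .emptyElim j => PiT (EmptyT ⇒ U j) fun C => PiT EmptyT fun x => C ⬝ x
  | .unit => U 0
  | .star => UnitT
  | .unitElim j => PiT (UnitT ⇒ U j) fun C => (C ⬝ Star) ⇒ PiT UnitT fun x => C ⬝ x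
  | .bool => U 0
  | .ff => BoolT
  | .tt => BoolT
  | .boolElim j => PiT (BoolT ⇒ U j) fun C => (C ⬝ FF) ⇒ (C ⬝ TT) ⇒ PiT BoolT fun x => C ⬝ x
  | .nat => U 0
  | .nzero => NatT
  | .nsucc => NatT ⇒ NatT
  | .natElim j => PiT (NatT ⇒ U j) fun C => (C ⬝ NZero) ⇒
      (PiT NatT fun n => (C ⬝ n) ⇒ (C ⬝ NSucc n)) ⇒ PiT NatT fun n => C ⬝ n
  | .sum i => U i ⇒ U i ⇒ U i
  | .inl i => PiT (U i) fun A => PiT (U i) fun B => A ⇒ SumT i A B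
  | .inr i => PiT (U i) fun A => PiT (U i) fun B => B ⇒ SumT i A B
  | .sumElim i j => PiT (U i) fun A => PiT (U i) fun B => PiT (SumT i A B ⇒ U j) fun C =>
      (PiT A fun a => C ⬝ (K (.inl i) ⬝ A ⬝ B ⬝ a)) ⇒
      (PiT B fun b => C ⬝ (K (.inr i) ⬝ A ⬝ B ⬝ b)) ⇒ PiT (SumT i A B) fun x => C ⬝ x
  | .funext i => PiT (U i) fun A => PiT (A ⇒ U i) fun B =>
      PiT (PiT A fun x => B ⬝ x) fun f => PiT (PiT A fun x => B ⬝ x) fun g =>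
      (PiT A fun x => IdT i (B ⬝ x) (f ⬝ x) (g ⬝ x)) ⇒ IdT i (PiT A fun x => B ⬝ x) f g
  | .ua i => PiT (U i) fun A => PiT (U i) fun B =>
      isEquiv (i + 1) (IdT (i + 1) (U i) A B) (EquivT i A B) (idToEquiv i A B)
  | .trunc i => U i ⇒ U i
  | .tr i => PiT (U i) fun A => A ⇒ TruncT i A
  | .squash i => PiT (U i) fun A => isProp i (TruncT i A)
  | .truncElim i j => PiT (U i) fun A => PiT (TruncT i A ⇒ U j) fun C =>
      (PiT (TruncT i A) fun x => isProp j (C ⬝ x)) ⇒ (PiT A fun a => C ⬝ (K (.tr i) ⬝ A ⬝ a)) ⇒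
      PiT (TruncT i A) fun x => C ⬝ x
  | .brw => U 0
  | .bzero => Brw
  | .bsucc => Brw ⇒ Brw
  | .limit => PiT (NatT ⇒ Brw) fun f => Increasing f ⇒ Brw
  | .bisim => PiT (NatT ⇒ Brw) fun f => PiT (Increasing f) fun p =>
      PiT (NatT ⇒ Brw) fun g => PiT (Increasing g) fun q =>
      Simulated f g ⇒ Simulated g f ⇒ IdT 0 Brw (Limit f p) (Limit g q)
  | .brwSet => isSet 0 Brw
  | .le => Brw ⇒ Brw ⇒ U 0
  | .leZero => PiT Brw fun x => Le BZero x
  | .leTrans => PiT Brw fun x => PiT Brw fun y => PiT Brw fun z => Le x y ⇒ Le y z ⇒ Le x z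
  | .leSuccMono => PiT Brw fun x => PiT Brw fun y => Le x y ⇒ Le (BSucc x) (BSucc y)
  | .leCocone => PiT (NatT ⇒ Brw) fun f => PiT (Increasing f) fun p => PiT Brw fun x =>
      PiT NatT fun k => Le x (f ⬝ k) ⇒ Le x (Limit f p)
  | .leLimiting => PiT (NatT ⇒ Brw) fun f => PiT (Increasing f) fun p => PiT Brw fun x =>
      (PiT NatT fun k => Le (f ⬝ k) x) ⇒ Le (Limit f p) x
  | .leProp => PiT Brw fun x => PiT Brw fun y => isProp 0 (Le x y)
  | .brwElim j => ElimType j fun A _ _ => PiT Brw fun x => A ⬝ x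
  | .leElim j => ElimType j fun _ B ps => PiT Brw fun x => PiT Brw fun y => PiT (Le x y) fun l =>
      B ⬝ x ⬝ y ⬝ KApp (.brwElim j) (ps ++ [x]) ⬝ KApp (.brwElim j) (ps ++ [y]) ⬝ l

/-! ### Computation rules of the constants

Computation rules for path constructors and for the order are not needed: there the corresponding
equations are equations in propositions. -/

open Tm in
inductive Comp : Tm → Tm → Prop
  | fst (i : ℕ) (A B a b : Tm) :
      Comp (capp (.fst i) [A, B, capp (.pair i) [A, B, a, b]]) a
  | snd (i : ℕ) (A B a b : Tm) :
      Comp (capp (.snd i) [A, B, capp (.pair i) [A, B, a, b]]) b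
  | sigEta (i : ℕ) (A B p : Tm) :
      Comp (capp (.pair i) [A, B, capp (.fst i) [A, B, p], capp (.snd i) [A, B, p]]) p
  | J (i j : ℕ) (A a C d : Tm) :
      Comp (capp (.J i j) [A, a, C, d, a, capp (.refl i) [A, a]]) d
  | unit (j : ℕ) (C c : Tm) : Comp (capp (.unitElim j) [C, c, con .star]) c
  | ff (j : ℕ) (C c d : Tm) : Comp (capp (.boolElim j) [C, c, d, con .ff]) c
  | tt (j : ℕ) (C c d : Tm) : Comp (capp (.boolElim j) [C, c, d, con .tt]) d
  | nzero (j : ℕ) (C z s : Tm) : Comp (capp (.natElim j) [C, z, s, con .nzero]) z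
  | nsucc (j : ℕ) (C z s n : Tm) :
      Comp (capp (.natElim j) [C, z, s, capp .nsucc [n]])
        (app (app s n) (capp (.natElim j) [C, z, s, n]))
  | inl (i j : ℕ) (A B C f g a : Tm) :
      Comp (capp (.sumElim i j) [A, B, C, f, g, capp (.inl i) [A, B, a]]) (app f a)
  | inr (i j : ℕ) (A B C f g b : Tm) :
      Comp (capp (.sumElim i j) [A, B, C, f, g, capp (.inr i) [A, B, b]]) (app g b)
  | tr (i j : ℕ) (A C h f a : Tm) :
      Comp (capp (.truncElim i j) [A, C, h, f, capp (.tr i) [A, a]]) (app f a)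
  | bzero (j : ℕ) (A B hA hB mz ms ml mb m₁ m₂ m₃ m₄ m₅ : Tm) :
      Comp (capp (.brwElim j) [A, B, hA, hB, mz, ms, ml, mb, m₁, m₂, m₃, m₄, m₅, con .bzero]) mz
  | bsucc (j : ℕ) (A B hA hB mz ms ml mb m₁ m₂ m₃ m₄ m₅ x : Tm) :
      Comp (capp (.brwElim j)
          [A, B, hA, hB, mz, ms, ml, mb, m₁, m₂, m₃, m₄, m₅, capp .bsucc [x]])
        (app (app ms x)
          (capp (.brwElim j) [A, B, hA, hB, mz, ms, ml, mb, m₁, m₂, m₃, m₄, m₅, x]))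
  | limit (j : ℕ) (A B hA hB mz ms ml mb m₁ m₂ m₃ m₄ m₅ f p : Tm) (ps : List Tm)
      (hps : ps = [A, B, hA, hB, mz, ms, ml, mb, m₁, m₂, m₃, m₄, m₅]) :
      Comp (capp (.brwElim j) (ps ++ [capp .limit [f, p]]))
        (app (app (app (app ml f) p)
          (lam (con .nat) (capp (.brwElim j) (ps.map lift ++ [app (lift f) (var 0)]))))
          (lam (con .nat) (capp (.leElim j) (ps.map lift ++
            [capp .bsucc [app (lift f) (var 0)], app (lift f) (capp .nsucc [var 0]),
              app (lift p) (var 0)]))))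

/-! ### Derivability -/

/-- Judgements: `t : A` and `t ≡ u : A`. -/
inductive Judgement : Type
  | ty (t A : Tm)
  | eq (t u A : Tm)

/-- Contexts; the head is the type of variable `0`, in the context given by the tail. -/
abbrev Ctx : Type := List Tm

open Tm Judgement in
/-- `Γ ⊢ 𝒥`, for well-formed contexts `Γ`: the rules extend a context by types only, so every
context in a derivation that ends in the empty context is well formed. -/
inductive Derivable : Ctx → Judgement → Prop
  -- variables, universes, constants
  | var {Γ : Ctx} {n : ℕ} {A : Tm} : Γ[n]? = some A →
      Derivable Γ (ty (var n) (rename (fun m => m + (n + 1)) A))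
  | univ {Γ : Ctx} (i : ℕ) : Derivable Γ (ty (univ i) (univ (i + 1)))
  | cumul {Γ : Ctx} {i : ℕ} {A : Tm} : Derivable Γ (ty A (univ i)) →
      Derivable Γ (ty A (univ (i + 1)))
  | con {Γ : Ctx} (c : Const) : Derivable Γ (ty (con c) (constType c).close)
  -- dependent functions
  | pi {Γ : Ctx} {i : ℕ} {A B : Tm} : Derivable Γ (ty A (univ i)) →
      Derivable (A :: Γ) (ty B (univ i)) → Derivable Γ (ty (pi A B) (univ i))
  | lam {Γ : Ctx} {i : ℕ} {A B t : Tm} : Derivable Γ (ty A (univ i)) →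
      Derivable (A :: Γ) (ty t B) → Derivable Γ (ty (lam A t) (pi A B))
  | app {Γ : Ctx} {A B f a : Tm} : Derivable Γ (ty f (pi A B)) → Derivable Γ (ty a A) →
      Derivable Γ (ty (app f a) (inst B a))
  -- conversion
  | conv {Γ : Ctx} {i : ℕ} {A B t : Tm} : Derivable Γ (ty t A) →
      Derivable Γ (eq A B (univ i)) → Derivable Γ (ty t B)
  -- judgemental equality is a congruence
  | eqRefl {Γ : Ctx} {A t : Tm} : Derivable Γ (ty t A) → Derivable Γ (eq t t A)
  | eqSymm {Γ : Ctx} {A t u : Tm} : Derivable Γ (eq t u A) → Derivable Γ (eq u t A)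
  | eqTrans {Γ : Ctx} {A t u v : Tm} : Derivable Γ (eq t u A) → Derivable Γ (eq u v A) →
      Derivable Γ (eq t v A)
  | eqConv {Γ : Ctx} {i : ℕ} {A B t u : Tm} : Derivable Γ (eq t u A) →
      Derivable Γ (eq A B (univ i)) → Derivable Γ (eq t u B)
  | eqCumul {Γ : Ctx} {i : ℕ} {A B : Tm} : Derivable Γ (eq A B (univ i)) →
      Derivable Γ (eq A B (univ (i + 1)))
  | eqPi {Γ : Ctx} {i : ℕ} {A A' B B' : Tm} : Derivable Γ (ty A (univ i)) →
      Derivable Γ (eq A A' (univ i)) → Derivable (A :: Γ) (eq B B' (univ i)) →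
      Derivable Γ (eq (pi A B) (pi A' B') (univ i))
  | eqLam {Γ : Ctx} {i : ℕ} {A A' B t t' : Tm} : Derivable Γ (ty A (univ i)) →
      Derivable Γ (eq A A' (univ i)) → Derivable (A :: Γ) (eq t t' B) →
      Derivable Γ (eq (lam A t) (lam A' t') (pi A B))
  | eqApp {Γ : Ctx} {A B f f' a a' : Tm} : Derivable Γ (eq f f' (pi A B)) →
      Derivable Γ (eq a a' A) → Derivable Γ (eq (app f a) (app f' a') (inst B a))
  -- computation and uniqueness
  | beta {Γ : Ctx} {i : ℕ} {A B t a : Tm} : Derivable Γ (ty A (univ i)) →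
      Derivable (A :: Γ) (ty t B) → Derivable Γ (ty a A) →
      Derivable Γ (eq (app (lam A t) a) (inst t a) (inst B a))
  | eta {Γ : Ctx} {A B f : Tm} : Derivable Γ (ty f (pi A B)) →
      Derivable Γ (eq f (lam A (app (lift f) (var 0))) (pi A B))
  | comp {Γ : Ctx} {A t u : Tm} : Comp t u → Derivable Γ (ty t A) → Derivable Γ (ty u A) →
      Derivable Γ (eq t u A)

/-- `P → Q` is inhabited in the empty context. -/
def Implies (P Q : Sch) : Prop := ∃ t : Tm, Derivable [] (.ty t (P ⇒ Q).close)

/-- Any two of the given closed types are logically equivalent: homotopy type theory has closed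
functions between them in both directions. -/
def AllEquivalent (S : List Sch) : Prop := ∀ P ∈ S, ∀ Q ∈ S, Implies P Q

/-! ### Auxiliary terms for addition

These are ordinary constructions in the theory; the comments give the types. -/

/-- `t[a]` for `a : A`, written as a redex so that `a` is not duplicated. -/
def LetIn (A a : Sch) (t : Sch → Sch) : Sch := Lam A t ⬝ a

/-- `a = b → b = a` -/
def SymP (i : ℕ) (A a b p : Sch) : Sch :=
  PathInd i i A a (fun x _ => IdT i A x a) (Refl i A a) b p

/-- `a = b → b = c → a = c` -/
def TransP (i : ℕ) (A a b c p q : Sch) : Sch :=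
  PathInd i i A b (fun x _ => IdT i A a x) p c q

/-- `a = b → f a = f b` for `f : A → B` -/
def Ap (i : ℕ) (A B : Sch) (f : Sch → Sch) (a b p : Sch) : Sch :=
  PathInd i i A a (fun x _ => IdT i B (f a) (f x)) (Refl i B (f a)) b p

/-- `isSet A`, given functions `φ x y : x = y → x = y` that are constant, by `κ`. -/
def setOfConstant (i : ℕ) : Sch :=
  Lam (U i) fun A =>
  Lam (PiT A fun x => PiT A fun y => IdT i A x y ⇒ IdT i A x y) fun φ =>
  Lam (PiT A fun x => PiT A fun y => PiT (IdT i A x y) fun p => PiT (IdT i A x y) fun q =>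
    IdT i (IdT i A x y) (φ ⬝ x ⬝ y ⬝ p) (φ ⬝ x ⬝ y ⬝ q)) fun κ =>
  Lam A fun x => Lam A fun y => Lam (IdT i A x y) fun p => Lam (IdT i A x y) fun q =>
    -- `τ z r = (φ refl)⁻¹ · r`, for `r : x = z`
    let τ : Sch → Sch → Sch := fun z r =>
      TransP i A x x z (SymP i A x x (φ ⬝ x ⬝ x ⬝ Refl i A x)) r
    -- `r⁻¹ · r = refl`
    let inv : Sch → Sch → Sch := fun z r =>
      PathInd i i A x
        (fun z r => IdT i (IdT i A z z) (TransP i A z x z (SymP i A x z r) r) (Refl i A z))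
        (Refl i (IdT i A x x) (Refl i A x)) z r
    -- `τ (φ p) = p`
    let red : Sch → Sch := fun p =>
      PathInd i i A x (fun z r => IdT i (IdT i A x z) (τ z (φ ⬝ x ⬝ z ⬝ r)) r)
        (inv x (φ ⬝ x ⬝ x ⬝ Refl i A x)) y p
    TransP i (IdT i A x y) p (τ y (φ ⬝ x ⬝ y ⬝ p)) q
      (SymP i (IdT i A x y) (τ y (φ ⬝ x ⬝ y ⬝ p)) p (red p))
      (TransP i (IdT i A x y) (τ y (φ ⬝ x ⬝ y ⬝ p)) (τ y (φ ⬝ x ⬝ y ⬝ q)) q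
        (Ap i (IdT i A x y) (IdT i A x y) (τ y) (φ ⬝ x ⬝ y ⬝ p) (φ ⬝ x ⬝ y ⬝ q) (κ ⬝ x ⬝ y ⬝ p ⬝ q))
        (red q))

/-- `isProp A → isSet A` -/
def setOfProp (i : ℕ) (A h : Sch) : Sch :=
  setOfConstant i ⬝ A ⬝
    (Lam A fun x => Lam A fun y => Lam (IdT i A x y) fun _ => h ⬝ x ⬝ y) ⬝
    (Lam A fun x => Lam A fun y => Lam (IdT i A x y) fun _ => Lam (IdT i A x y) fun _ =>
      Refl i (IdT i A x y) (h ⬝ x ⬝ y))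

/-- `isProp 𝟏` -/
def unitProp (i : ℕ) : Sch :=
  Lam UnitT fun u => Lam UnitT fun v =>
    K (.unitElim i) ⬝ (Lam UnitT fun u => IdT i UnitT u v) ⬝
      (K (.unitElim i) ⬝ (Lam UnitT fun v => IdT i UnitT Star v) ⬝ Refl i UnitT Star ⬝ v) ⬝ u

/-- Abstraction over an increasing sequence and its induction hypotheses. -/
def LamSeq (A B ms : Sch) (t : Sch → Sch → Sch → Sch → Sch) : Sch :=
  Lam (NatT ⇒ Brw) fun f => Lam (Increasing f) fun p =>
  Lam (PiT NatT fun k => A ⬝ (f ⬝ k)) fun F => Lam (IncreasingOver B ms f p F) fun P => t f p F P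

/-- `(x : Brw) → P x` for a family `P` of propositions, from the methods for `zero`, `succ` and
`limit`, where the last one does not use induction hypotheses about the order. -/
def brwIndProp (P : Sch → Sch) (hP : Sch → Sch) (z : Sch) (s : Sch → Sch → Sch)
    (l : Sch → Sch → Sch → Sch) : Sch :=
  let A : Sch := Lam Brw P
  let B : Sch := Lam Brw fun x => Lam Brw fun y => Lam (A ⬝ x) fun _ => Lam (A ⬝ y) fun _ =>
    Lam (Le x y) fun _ => UnitT
  let ms : Sch := Lam Brw fun x => Lam (A ⬝ x) fun a => s x a
  let ml : Sch := LamSeq A B ms fun f p F _ => l f p F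
  KApp (.brwElim 0) [A, B,
    Lam Brw fun x => setOfProp 0 (P x) (hP x),
    Lam Brw fun x => Lam Brw fun y => Lam (A ⬝ x) fun _ => Lam (A ⬝ y) fun _ => Lam (Le x y) fun _ =>
      unitProp 0,
    z, ms, ml,
    LamSeq A B ms fun f p F P => LamSeq A B ms fun g q G Q =>
      Lam (Simulated f g) fun s => Lam (Simulated g f) fun t =>
      Lam (SimulatedOver 0 B f F g G) fun _ => Lam (SimulatedOver 0 B g G f F) fun _ =>
      hP (Limit g q) ⬝
        (Transport 0 0 Brw (fun x => A ⬝ x) (Limit f p) (Limit g q)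
          (K .bisim ⬝ f ⬝ p ⬝ g ⬝ q ⬝ s ⬝ t) (ml ⬝ f ⬝ p ⬝ F ⬝ P)) ⬝
        (ml ⬝ g ⬝ q ⬝ G ⬝ Q),
    Lam Brw fun x => Lam (A ⬝ x) fun _ => Star,
    Lam Brw fun x => Lam Brw fun y => Lam Brw fun z =>
      Lam (A ⬝ x) fun _ => Lam (A ⬝ y) fun _ => Lam (A ⬝ z) fun _ =>
      Lam (Le x y) fun _ => Lam (Le y z) fun _ => Lam UnitT fun _ => Lam UnitT fun _ => Star,
    Lam Brw fun x => Lam Brw fun y => Lam (A ⬝ x) fun _ => Lam (A ⬝ y) fun _ =>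
      Lam (Le x y) fun _ => Lam UnitT fun _ => Star,
    LamSeq A B ms fun f _ _ _ => Lam Brw fun x => Lam (A ⬝ x) fun _ => Lam NatT fun k =>
      Lam (Le x (f ⬝ k)) fun _ => Lam UnitT fun _ => Star,
    LamSeq A B ms fun f _ _ _ => Lam Brw fun x => Lam (A ⬝ x) fun _ =>
      Lam (PiT NatT fun k => Le (f ⬝ k) x) fun _ => Lam (NatT ⇒ UnitT) fun _ => Star]

/-- `(x : Brw) → x ≤ x` -/
def leRefl : Sch :=
  brwIndProp (fun x => Le x x) (fun x => K .leProp ⬝ x ⬝ x) (K .leZero ⬝ BZero)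
    (fun x a => K .leSuccMono ⬝ x ⬝ x ⬝ a)
    (fun f p F => K .leLimiting ⬝ f ⬝ p ⬝ Limit f p ⬝
      Lam NatT fun k => K .leCocone ⬝ f ⬝ p ⬝ (f ⬝ k) ⬝ k ⬝ (F ⬝ k))

/-- `(x : Brw) → x ≤ succ x` -/
def leSucc : Sch :=
  LetIn (PiT Brw fun x => Le x x) leRefl fun r =>
  brwIndProp (fun x => Le x (BSucc x)) (fun x => K .leProp ⬝ x ⬝ BSucc x) (K .leZero ⬝ BSucc BZero)
    (fun x a => K .leSuccMono ⬝ x ⬝ BSucc x ⬝ a)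
    (fun f p F => K .leLimiting ⬝ f ⬝ p ⬝ BSucc (Limit f p) ⬝
      Lam NatT fun k => K .leTrans ⬝ (f ⬝ k) ⬝ BSucc (f ⬝ k) ⬝ BSucc (Limit f p) ⬝ (F ⬝ k) ⬝
        (K .leSuccMono ⬝ (f ⬝ k) ⬝ Limit f p ⬝
          (K .leCocone ⬝ f ⬝ p ⬝ (f ⬝ k) ⬝ k ⬝ (r ⬝ (f ⬝ k)))))

/-! ### Addition

To define `x + y` by recursion on `y`, one constructs simultaneously a proof of `x ≤ x + y`; the
monotonicity of addition in `y` is the part of the recursion that concerns the order. -/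

/-- The type of upper bounds of `x`. -/
def Above (x : Sch) : Sch := Sig 0 Brw fun z => Le x z

def mkAbove (x z l : Sch) : Sch := Pair 0 Brw (fun z => Le x z) z l

/-- The underlying tree of `a : Above x`. -/
def val (x a : Sch) : Sch := Fst 0 Brw (fun z => Le x z) a

/-- The proof that `x` is below the underlying tree of `a : Above x`. -/
def bound (x a : Sch) : Sch := Snd 0 Brw (fun z => Le x z) a

/-- `(z, l) = (z', l')` in `Above x`, given `e : z = z'` -/
def aboveEq (x z l z' l' e : Sch) : Sch :=
  PathInd 0 0 Brw z
    (fun w _ => PiT (Le x w) fun m => IdT 0 (Above x) (mkAbove x z l) (mkAbove x w m))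
    (Lam (Le x z) fun m =>
      Ap 0 (Le x z) (Above x) (fun n => mkAbove x z n) l m (K .leProp ⬝ x ⬝ z ⬝ l ⬝ m))
    z' e ⬝ l'

/-- `isSet (Above x)` -/
def aboveSet (x : Sch) : Sch :=
  let S := Above x
  let ap : Sch → Sch → Sch → Sch := fun a b p => Ap 0 S Brw (val x) a b p
  let φ : Sch → Sch → Sch → Sch := fun a b e =>
    aboveEq x (val x a) (bound x a) (val x b) (bound x b) e
  setOfConstant 0 ⬝ S ⬝
    (Lam S fun a => Lam S fun b => Lam (IdT 0 S a b) fun p => φ a b (ap a b p)) ⬝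
    (Lam S fun a => Lam S fun b => Lam (IdT 0 S a b) fun p => Lam (IdT 0 S a b) fun q =>
      Ap 0 (IdT 0 Brw (val x a) (val x b)) (IdT 0 S a b) (φ a b) (ap a b p) (ap a b q)
        (K .brwSet ⬝ val x a ⬝ val x b ⬝ ap a b p ⬝ ap a b q))

/-- Addition, `Brw → Brw → Brw`. Judgementally, `x + zero ≡ x`, `x + succ y ≡ succ (x + y)` and
`x + limit f ≡ limit (λ k. x + f k)`. -/
def addition : Sch :=
  LetIn (PiT Brw fun x => Le x x) leRefl fun lr =>
  LetIn (PiT Brw fun x => Le x (BSucc x)) leSucc fun ls =>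
  Lam Brw fun x => Lam Brw fun y =>
  let A : Sch := Lam Brw fun _ => Above x
  let B : Sch := Lam Brw fun y => Lam Brw fun y' => Lam (A ⬝ y) fun a => Lam (A ⬝ y') fun b =>
    Lam (Le y y') fun _ => Le (val x a) (val x b)
  let mz : Sch := mkAbove x x (lr ⬝ x)
  let ms : Sch := Lam Brw fun y => Lam (A ⬝ y) fun a =>
    mkAbove x (BSucc (val x a))
      (K .leTrans ⬝ x ⬝ val x a ⬝ BSucc (val x a) ⬝ bound x a ⬝ (ls ⬝ val x a))
  let seq : Sch → Sch := fun F => Lam NatT fun k => val x (F ⬝ k)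
  let lim : Sch → Sch → Sch := fun F P => Limit (seq F) P
  let limBound : Sch → Sch → Sch := fun F P =>
    K .leCocone ⬝ seq F ⬝ P ⬝ x ⬝ NZero ⬝ bound x (F ⬝ NZero)
  let ml : Sch := LamSeq A B ms fun _ _ F P => mkAbove x (lim F P) (limBound F P)
  -- forget the underlying inequality in the induction hypothesis `S` for a simulation
  let sim : Sch → Sch → Sch → Sch → Sch → Sch := fun f F g G S =>
    Lam NatT fun k =>
      let D : Sch → Sch := fun n => Sig 0 (Le (f ⬝ k) (g ⬝ n)) fun l =>
        B ⬝ (f ⬝ k) ⬝ (g ⬝ n) ⬝ (F ⬝ k) ⬝ (G ⬝ n) ⬝ l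
      let E : Sch → Sch := fun n => Le (seq F ⬝ k) (seq G ⬝ n)
      K (.truncElim 0 0) ⬝ Sig 0 NatT D ⬝ (Lam (Ex 0 NatT D) fun _ => Ex 0 NatT E) ⬝
        (Lam (Ex 0 NatT D) fun _ => K (.squash 0) ⬝ Sig 0 NatT E) ⬝
        (Lam (Sig 0 NatT D) fun w => K (.tr 0) ⬝ Sig 0 NatT E ⬝
          Pair 0 NatT E (Fst 0 NatT D w)
            (Snd 0 (Le (f ⬝ k) (g ⬝ Fst 0 NatT D w))
              (fun l => B ⬝ (f ⬝ k) ⬝ (g ⬝ Fst 0 NatT D w) ⬝ (F ⬝ k) ⬝ (G ⬝ Fst 0 NatT D w) ⬝ l)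
              (Snd 0 NatT D w))) ⬝
        (S ⬝ k)
  val x (KApp (.brwElim 0) [A, B,
    Lam Brw fun _ => aboveSet x,
    Lam Brw fun y => Lam Brw fun y' => Lam (A ⬝ y) fun a => Lam (A ⬝ y') fun b =>
      Lam (Le y y') fun _ => K .leProp ⬝ val x a ⬝ val x b,
    mz, ms, ml,
    LamSeq A B ms fun f p F P => LamSeq A B ms fun g q G Q =>
      Lam (Simulated f g) fun s => Lam (Simulated g f) fun t =>
      Lam (SimulatedOver 0 B f F g G) fun S => Lam (SimulatedOver 0 B g G f F) fun T =>
      PathInd 0 0 Brw (Limit f p)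
        (fun z e => IdT 0 (Above x)
          (Transport 0 0 Brw (fun w => A ⬝ w) (Limit f p) z e (ml ⬝ f ⬝ p ⬝ F ⬝ P))
          (ml ⬝ g ⬝ q ⬝ G ⬝ Q))
        (aboveEq x (lim F P) (limBound F P) (lim G Q) (limBound G Q)
          (K .bisim ⬝ seq F ⬝ P ⬝ seq G ⬝ Q ⬝ sim f F g G S ⬝ sim g G f F T))
        (Limit g q) (K .bisim ⬝ f ⬝ p ⬝ g ⬝ q ⬝ s ⬝ t),
    Lam Brw fun y => Lam (A ⬝ y) fun a => bound x a,
    Lam Brw fun y => Lam Brw fun y' => Lam Brw fun z =>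
      Lam (A ⬝ y) fun a => Lam (A ⬝ y') fun b => Lam (A ⬝ z) fun c =>
      Lam (Le y y') fun _ => Lam (Le y' z) fun _ =>
      Lam (Le (val x a) (val x b)) fun l => Lam (Le (val x b) (val x c)) fun l' =>
      K .leTrans ⬝ val x a ⬝ val x b ⬝ val x c ⬝ l ⬝ l',
    Lam Brw fun y => Lam Brw fun y' => Lam (A ⬝ y) fun a => Lam (A ⬝ y') fun b =>
      Lam (Le y y') fun _ => Lam (Le (val x a) (val x b)) fun l =>
      K .leSuccMono ⬝ val x a ⬝ val x b ⬝ l,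
    LamSeq A B ms fun f _ F P => Lam Brw fun y => Lam (A ⬝ y) fun a => Lam NatT fun k =>
      Lam (Le y (f ⬝ k)) fun _ => Lam (Le (val x a) (val x (F ⬝ k))) fun l =>
      K .leCocone ⬝ seq F ⬝ P ⬝ val x a ⬝ k ⬝ l,
    LamSeq A B ms fun f _ F P => Lam Brw fun y => Lam (A ⬝ y) fun a =>
      Lam (PiT NatT fun k => Le (f ⬝ k) y) fun _ =>
      Lam (PiT NatT fun k => Le (val x (F ⬝ k)) (val x a)) fun l =>
      K .leLimiting ⬝ seq F ⬝ P ⬝ val x a ⬝ l,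
    y])

/-- `x + y` -/
def Add (x y : Sch) : Sch := addition ⬝ x ⬝ y

/-! ### The statements -/

/-- `ι : ℕ → Brw`, the embedding of the natural numbers as finite Brouwer trees. -/
def iota : Sch :=
  K (.natElim 0) ⬝ (Lam NatT fun _ => Brw) ⬝ BZero ⬝ (Lam NatT fun _ => Lam Brw fun x => BSucc x)

/-- `ι` is increasing. -/
def iotaIncreasing : Sch :=
  Lam NatT fun k => leRefl ⬝ BSucc (iota ⬝ k)

/-- `ω`, the limit of the finite Brouwer trees. -/
def omega : Sch := Limit iota iotaIncreasing

/-- `x · n` for a natural number `n`, given by the defining clauses of multiplication at `zero`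
and at successors: `x · zero = zero` and `x · succ n = x · n + x`. -/
def timesNat (x : Sch) : ℕ → Sch
  | 0 => BZero
  | n + 1 => Add (timesNat x n) x

/-- The limited principle of omniscience:
`(s : ℕ → 𝟐) → (∀ n. s n = ff) ⊎ (∃ n. s n = tt)`. -/
def LPO : Sch :=
  PiT (NatT ⇒ BoolT) fun s =>
    SumT 0 (PiT NatT fun n => IdT 0 BoolT (s ⬝ n) FF) (Ex 0 NatT fun n => IdT 0 BoolT (s ⬝ n) TT)

end HoTT

/-! ### A sound type checker -/

/-! Mathematically, everything rests on inversion of the strict order: nothing is below `zero`;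
`succ x ≤ succ y` gives `x ≤ y`; and `x < limit f` gives some `n` with `x < f n`. Inversion is
proved by encoding. Recursion on `y` defines a proposition `L x y` that is empty at `zero`, is `x ≤
y'` at `succ y'`, and is `∃ n. L x (f n)` at `limit f`. The part of the recursion that concerns the
order shows that `L` is monotone in `y`; together with propositional extensionality, the only place
where univalence is needed, this makes the recursion respect `bisim`. Irreflexivity and antisymmetry
follow from inversion.

Given LPO, a double induction decides `x ≤ y`. By inversion, `x < limit g` is an existential
statement over `ℕ`, and `limit f ≤ y` is a universal one, both about propositions already decided.
Decidability of `≤` yields that of `<` at once and that of equality by antisymmetry; the statements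
about `ω` and `ω · 2` are instances. For the converse, a boolean sequence `s` is turned into an
increasing sequence `f` that runs through `0, 1, 2, …` until `s` takes the value `tt` and continues
as `succⁿ w` afterwards, where `w` is `ω` (or `0 + ω`). If `w < limit f`, then `w < f n` for some
`n`, so `s` has taken the value `tt`. If `s` takes that value, then `w < limit f`, and `limit f` is
even `w + ω`. Hence deciding `ω < limit f` or `limit f = ω · 2` decides the instance of LPO.

Since the claim is about derivability, each of these arguments is an explicit proof term, and a type
checker for the theory is proved sound with respect to `Derivable` and evaluated on these terms.
Only soundness matters: the checker has bounded recursion depth and may reject anything. The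
soundness proof relies on stability under substitution, but not on injectivity of products or on
preservation of types under reduction; the checker records or rechecks what these would supply.
Definitions stay folded as named context entries, and proved theorems enter as variables.

The terms for `ω` and addition occur in the statement itself, so these very terms have to be typed.
The arguments about them are carried out for a variable `add` with the universal property of `x +
ω`, and for an arbitrary witness that `ι` is increasing; the large terms are put in only at the end.
-/

namespace HoTT

open Judgement

/-! ### Executable shifting and substitution -/

namespace Tm

/-- Add `k` to the variables that are at least `c`. -/
def shift (k : ℕ) : ℕ → Tm → Tm
  | c, var n => bif Nat.blt n c then var n else var (n + k)
  | _, univ i => univ i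
  | c, pi A B => pi (shift k c A) (shift k (c + 1) B)
  | c, lam A t => lam (shift k c A) (shift k (c + 1) t)
  | c, app f a => app (shift k c f) (shift k c a)
  | _, con c => con c

def nth : List Tm → ℕ → Option Tm
  | [], _ => none
  | a :: _, 0 => some a
  | _ :: as, n + 1 => nth as n

/-- Simultaneous substitution of a list of terms for the variables from `d` on. -/
def msubst (as : List Tm) : ℕ → Tm → Tm
  | d, var n => bif Nat.blt n d then var n else
      match nth as (n - d) with
      | some a => shift d 0 a
      | none => var (n - as.length)
  | _, univ i => univ i
  | d, pi A B => pi (msubst as d A) (msubst as (d + 1) B)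
  | d, lam A t => lam (msubst as d A) (msubst as (d + 1) t)
  | d, app f a => app (msubst as d f) (msubst as d a)
  | _, con c => con c

theorem blt_iff (n c : ℕ) : Nat.blt n c = decide (n < c) := by
  rw [Bool.eq_iff_iff, decide_eq_true_iff]
  exact ⟨Nat.le_of_ble_eq_true, Nat.ble_eq_true_of_le⟩

theorem natBeq_iff (n m : ℕ) : Nat.beq n m = true ↔ n = m :=
  ⟨Nat.eq_of_beq_eq_true, by rintro rfl; exact Nat.beq_refl n⟩

/-- The hypothesis on `ρ` has the shape that survives `upRen`: under a binder the cut-off `c`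
becomes `c + 1`. Both `lift` and the renaming in the variable rule are instances with `c = 0`. -/
theorem rename_eq_shift (t : Tm) : ∀ (k c : ℕ) (ρ : ℕ → ℕ),
    (∀ n, ρ n = if n < c then n else n + k) → rename ρ t = shift k c t := by
  induction t with
  | var n =>
    intro k c ρ h
    by_cases hn : n < c
    · simp [rename, shift, h, hn, blt_iff]
    · simp [rename, shift, h, hn, blt_iff]
  | univ i => intros; rfl
  | con c => intros; rfl
  | app f a hf ha => intro k c ρ h; simp only [rename, shift, hf k c ρ h, ha k c ρ h]
  | pi A B hA hB | lam A B hA hB =>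
    intro k c ρ h
    simp only [rename, shift, hA k c ρ h]
    rw [hB k (c + 1)]
    rintro (_ | n)
    · simp [upRen]
    · simp only [upRen, h, Nat.add_lt_add_iff_right]
      split <;> omega

theorem rename_add_eq_shift (k : ℕ) (t : Tm) : rename (fun m => m + k) t = shift k 0 t :=
  rename_eq_shift t k 0 _ (by simp)

theorem lift_eq_shift (t : Tm) : lift t = shift 1 0 t :=
  rename_eq_shift t 1 0 _ (by simp)

theorem shift_zero (t : Tm) : ∀ c, shift 0 c t = t := by
  induction t with
  | var n => intro c; simp only [shift, Nat.add_zero]; cases Nat.blt n c <;> rfl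
  | univ i => intros; rfl
  | con c => intros; rfl
  | app f a hf ha => intro c; simp only [shift, hf, ha]
  | pi A B hA hB | lam A B hA hB => intro c; simp only [shift, hA, hB]

/-- The first shift leaves no variable between `c` and `c + k`, so a cut-off `d` in this gap
separates the same variables as `c` did. -/
theorem shift_shift (t : Tm) : ∀ (k l c d : ℕ), c ≤ d → d ≤ c + k →
    shift l d (shift k c t) = shift (k + l) c t := by
  induction t with
  | var n =>
    intro k l c d h1 h2
    simp only [shift, blt_iff]
    by_cases h : n < c
    · simp [h, shift, blt_iff, show n < d by omega]
    · simp [h, shift, blt_iff, show ¬ n + k < d by omega]; omega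
  | univ i => intros; rfl
  | con c => intros; rfl
  | app f a hf ha => intro k l c d h1 h2; simp only [shift, hf _ _ _ _ h1 h2, ha _ _ _ _ h1 h2]
  | pi A B hA hB | lam A B hA hB =>
    intro k l c d h1 h2
    simp only [shift, hA _ _ _ _ h1 h2]
    rw [hB _ _ _ _ (by omega) (by omega)]

/-- The hypothesis describes what `single a` has become after passing `d` binders; the induction
needs all `d` at once. -/
theorem subst_eq_msubst (t : Tm) (a : Tm) : ∀ (d : ℕ) (σ : ℕ → Tm),
    (∀ n, σ n = if n < d then var n else if n = d then shift d 0 a else var (n - 1)) →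
    subst σ t = msubst [a] d t := by
  induction t with
  | var n =>
    intro d σ h
    simp only [subst, msubst, h, blt_iff]
    by_cases h1 : n < d
    · simp [h1]
    · by_cases h2 : n = d
      · subst h2; simp [nth]
      · obtain ⟨m, hm⟩ : ∃ m, n - d = m + 1 := ⟨n - d - 1, by omega⟩
        simp [h1, h2, hm, nth]
  | univ i => intros; rfl
  | con c => intros; rfl
  | app f a hf ha => intro d σ h; simp only [subst, msubst, hf d σ h, ha d σ h]
  | pi A B hA hB | lam A B hA hB =>
    intro d σ h
    simp only [subst, msubst, hA d σ h]
    rw [hB (d + 1)]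
    rintro (_ | n)
    · simp [upSub]
    · simp only [upSub, h, Nat.add_lt_add_iff_right, Nat.add_right_cancel_iff]
      by_cases h1 : n < d
      · simp [h1, lift, rename]
      · by_cases h2 : n = d
        · subst h2
          simp only [lt_irrefl, if_false, if_true, lift_eq_shift]
          exact shift_shift _ _ _ _ _ (by omega) (by omega)
        · simp [h1, h2, lift, rename, show n - 1 + 1 = n by omega]

theorem inst_eq_msubst (t a : Tm) : inst t a = msubst [a] 0 t := by
  apply subst_eq_msubst
  rintro (_ | n)
  · simp [single, shift_zero]
  · simp [single]

theorem msubst_nil (t : Tm) : ∀ d, msubst [] d t = t := by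
  induction t with
  | var n => intro d; simp only [msubst, nth, List.length_nil]; cases Nat.blt n d <;> rfl
  | univ i => intros; rfl
  | con c => intros; rfl
  | app f a hf ha => intro c; simp only [msubst, hf, ha]
  | pi A B hA hB | lam A B hA hB => intro c; simp only [msubst, hA, hB]

/-- The shift creates `d + 1` unused places, and the substitution removes one of them; `a` is never
inserted, and a shift by `d` remains. -/
theorem msubst_shift (t a : Tm) : ∀ c d : ℕ,
    msubst [a] (c + d) (shift (d + 1) c t) = shift d c t := by
  induction t with
  | var n =>
    intro c d
    simp only [shift, blt_iff]
    by_cases h : n < c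
    · simp [h, msubst, blt_iff, show n < c + d by omega]
    · obtain ⟨m, hm⟩ : ∃ m, n + (d + 1) - (c + d) = m + 1 := ⟨n - c, by omega⟩
      simp [h, msubst, blt_iff, show ¬ n + (d + 1) < c + d by omega, hm, nth]
  | univ i => intros; rfl
  | con c => intros; rfl
  | app f a hf ha => intro c d; simp only [shift, msubst, hf, ha]
  | pi A B hA hB | lam A B hA hB =>
    intro c d
    simp only [shift, msubst, hA]
    rw [show c + d + 1 = (c + 1) + d by omega, hB]

theorem nth_eq_none {as : List Tm} : ∀ {n : ℕ}, nth as n = none → as.length ≤ n := by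
  induction as with
  | nil => intros; simp
  | cons a as ih =>
    rintro (_ | n) h
    · simp [nth] at h
    · simpa using ih h

/-- This lets the checker collect the arguments of an application and substitute them all at once.
The newest argument is the head of the list because it belongs to the innermost binder; the older
ones are substituted under that binder, whence `d + 1`. -/
theorem msubst_cons (t a : Tm) (as : List Tm) : ∀ d,
    msubst [a] d (msubst as (d + 1) t) = msubst (a :: as) d t := by
  induction t with
  | var n =>
    intro d
    simp only [msubst, blt_iff]
    by_cases h1 : n < d
    · simp [h1, msubst, blt_iff, show n < d + 1 by omega]
    · by_cases h2 : n = d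
      · subst h2; simp [msubst, blt_iff, nth]
      · obtain ⟨m, hm⟩ : ∃ m, n = d + 1 + m := ⟨n - d - 1, by omega⟩
        subst hm
        simp only [show ¬ d + 1 + m < d + 1 by omega, show ¬ d + 1 + m < d by omega, decide_false,
          cond_false, show d + 1 + m - d = m + 1 by omega, show d + 1 + m - (d + 1) = m by omega, nth]
        cases h : nth as m with
        | some b => simpa using msubst_shift b a 0 d
        | none =>
          have := nth_eq_none h
          obtain ⟨k, hk⟩ : ∃ k, d + 1 + m - as.length - d = k + 1 :=
            ⟨d + 1 + m - as.length - d - 1, by omega⟩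
          simp [msubst, blt_iff, show ¬ d + 1 + m - as.length < d by omega, hk, nth]; omega
  | univ i => intros; rfl
  | con c => intros; rfl
  | app f a hf ha => intro d; simp only [msubst, hf, ha]
  | pi A B hA hB | lam A B hA hB => intro d; simp only [msubst, hA, hB]

end Tm

/-! ### Boolean equality of constants -/

namespace Const

/-- A numerical code for constants. -/
def code : Const → ℕ × ℕ × ℕ
  | sig i => (0, i, 0) | pair i => (1, i, 0) | fst i => (2, i, 0) | snd i => (3, i, 0)
  | id i => (4, i, 0) | refl i => (5, i, 0) | J i j => (6, i, j)
  | empty => (7, 0, 0) | emptyElim j => (8, j, 0)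
  | unit => (9, 0, 0) | star => (10, 0, 0) | unitElim j => (11, j, 0)
  | bool => (12, 0, 0) | ff => (13, 0, 0) | tt => (14, 0, 0) | boolElim j => (15, j, 0)
  | nat => (16, 0, 0) | nzero => (17, 0, 0) | nsucc => (18, 0, 0) | natElim j => (19, j, 0)
  | sum i => (20, i, 0) | inl i => (21, i, 0) | inr i => (22, i, 0) | sumElim i j => (23, i, j)
  | funext i => (24, i, 0) | ua i => (25, i, 0)
  | trunc i => (26, i, 0) | tr i => (27, i, 0) | squash i => (28, i, 0)
  | truncElim i j => (29, i, j)
  | brw => (30, 0, 0) | bzero => (31, 0, 0) | bsucc => (32, 0, 0) | limit => (33, 0, 0)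
  | bisim => (34, 0, 0) | brwSet => (35, 0, 0)
  | le => (36, 0, 0) | leZero => (37, 0, 0) | leTrans => (38, 0, 0) | leSuccMono => (39, 0, 0)
  | leCocone => (40, 0, 0) | leLimiting => (41, 0, 0) | leProp => (42, 0, 0)
  | brwElim j => (43, j, 0) | leElim j => (44, j, 0)

/-- A left inverse of `code`. -/
def ofCode : ℕ × ℕ × ℕ → Const
  | (0, i, _) => sig i | (1, i, _) => pair i | (2, i, _) => fst i | (3, i, _) => snd i
  | (4, i, _) => id i | (5, i, _) => refl i | (6, i, j) => J i j
  | (7, _, _) => empty | (8, j, _) => emptyElim j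
  | (9, _, _) => unit | (10, _, _) => star | (11, j, _) => unitElim j
  | (12, _, _) => bool | (13, _, _) => ff | (14, _, _) => tt | (15, j, _) => boolElim j
  | (16, _, _) => nat | (17, _, _) => nzero | (18, _, _) => nsucc | (19, j, _) => natElim j
  | (20, i, _) => sum i | (21, i, _) => inl i | (22, i, _) => inr i | (23, i, j) => sumElim i j
  | (24, i, _) => funext i | (25, i, _) => ua i
  | (26, i, _) => trunc i | (27, i, _) => tr i | (28, i, _) => squash i
  | (29, i, j) => truncElim i j
  | (30, _, _) => brw | (31, _, _) => bzero | (32, _, _) => bsucc | (33, _, _) => limit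
  | (34, _, _) => bisim | (35, _, _) => brwSet
  | (36, _, _) => le | (37, _, _) => leZero | (38, _, _) => leTrans | (39, _, _) => leSuccMono
  | (40, _, _) => leCocone | (41, _, _) => leLimiting | (42, _, _) => leProp
  | (43, j, _) => brwElim j | (_, j, _) => leElim j

theorem ofCode_code (c : Const) : ofCode (code c) = c := by
  cases c <;> rfl

def beq (c d : Const) : Bool :=
  match code c, code d with
  | (k, i, j), (k', i', j') => Nat.beq k k' && (Nat.beq i i' && Nat.beq j j')

theorem beq_iff (c d : Const) : beq c d = true ↔ c = d := by
  refine ⟨fun h => ?_, ?_⟩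
  swap
  · rintro rfl; simp [beq]
  -- The left inverse of the coding reduces the claim to equality of codes, without comparing all
  -- pairs of constructors.
  rw [← ofCode_code c, ← ofCode_code d]
  unfold beq at h
  simp only [Bool.and_eq_true, Tm.natBeq_iff] at h
  congr 1
  exact Prod.ext h.1 (Prod.ext h.2.1 h.2.2)

end Const

namespace Tm

def beq : Tm → Tm → Bool
  | var n, t => match t with | var m => Nat.beq n m | _ => false
  | univ n, t => match t with | univ m => Nat.beq n m | _ => false
  | con c, t => match t with | con d => Const.beq c d | _ => false
  | pi A B, t => match t with | pi A' B' => beq A A' && beq B B' | _ => false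
  | lam A B, t => match t with | lam A' B' => beq A A' && beq B B' | _ => false
  | app A B, t => match t with | app A' B' => beq A A' && beq B B' | _ => false

theorem beq_iff {t : Tm} : ∀ {u : Tm}, beq t u = true ↔ t = u := by
  induction t with
  | var n | univ n => rintro (_ | _ | _ | _ | _ | _) <;> simp [beq]
  | con n => rintro (_ | _ | _ | _ | _ | _) <;> simp [beq, Const.beq_iff]
  | pi A B hA hB | lam A B hA hB | app A B hA hB =>
    rintro (_ | _ | _ | _ | _ | _) <;> simp [beq, hA, hB]

/-- The constant at the head of a term, and its arguments. -/
def spine : Tm → List Tm → Option (Const × List Tm)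
  | app f a, as => spine f (a :: as)
  | con c, as => some (c, as)
  | _, _ => none

theorem eq_of_spine {t : Tm} : ∀ {as : List Tm} {c : Const} {bs : List Tm},
    spine t as = some (c, bs) → as.foldl app t = capp c bs := by
  induction t with
  | app f a hf _ => intro as c bs h; exact hf h
  | con c => intro as d bs h; simp only [spine, Option.some.injEq, Prod.mk.injEq] at h; simp [h, capp]
  | _ => intro as c bs h; simp [spine] at h

theorem eq_capp_of_spine {t : Tm} {c : Const} {bs : List Tm} (h : spine t [] = some (c, bs)) :
    t = capp c bs := eq_of_spine h

end Tm

/-! ### Executable computation rules -/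

open Tm

/-- The right hand side of a computation rule. -/
def compStep : Const → List Tm → Option Tm
  | .fst i, [A, B, p] =>
    match spine p [] with
    | some (.pair i', [A', B', a, _]) =>
      bif Nat.beq i i' && (beq A A' && beq B B') then some a else none
    | _ => none
  | .snd i, [A, B, p] =>
    match spine p [] with
    | some (.pair i', [A', B', _, b]) =>
      bif Nat.beq i i' && (beq A A' && beq B B') then some b else none
    | _ => none
  | .pair i, [A, B, a, b] =>
    match spine a [], spine b [] with
    | some (.fst i', [A', B', p]), some (.snd i'', [A'', B'', p']) =>
      bif (Nat.beq i i' && (beq A A' && beq B B')) &&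
        (Nat.beq i i'' && (beq A A'' && (beq B B'' && beq p p'))) then some p else none
    | _, _ => none
  | .J i _, [A, a, _, d, b, e] =>
    match spine e [] with
    | some (.refl i', [A', a']) =>
      bif Nat.beq i i' && (beq A A' && (beq a a' && beq a b)) then some d else none
    | _ => none
  | .unitElim _, [_, c, x] => match spine x [] with | some (.star, []) => some c | _ => none
  | .boolElim _, [_, c, d, x] =>
    match spine x [] with
    | some (.ff, []) => some c
    | some (.tt, []) => some d
    | _ => none
  | .natElim j, [C, z, s, x] =>
    match spine x [] with
    | some (.nzero, []) => some z
    | some (.nsucc, [n]) => some (app (app s n) (capp (.natElim j) [C, z, s, n]))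
    | _ => none
  | .sumElim i _, [A, B, _, f, g, x] =>
    match spine x [] with
    | some (.inl i', [A', B', a]) =>
      bif Nat.beq i i' && (beq A A' && beq B B') then some (app f a) else none
    | some (.inr i', [A', B', a]) =>
      bif Nat.beq i i' && (beq A A' && beq B B') then some (app g a) else none
    | _ => none
  | .truncElim i _, [A, _, _, f, x] =>
    match spine x [] with
    | some (.tr i', [A', a]) => bif Nat.beq i i' && beq A A' then some (app f a) else none
    | _ => none
  | .brwElim j, [A, B, hA, hB, mz, ms, ml, mb, m₁, m₂, m₃, m₄, m₅, t] =>
    match spine t [] with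
    | some (.bzero, []) => some mz
    | some (.bsucc, [x]) => some (app (app ms x)
        (capp (.brwElim j) [A, B, hA, hB, mz, ms, ml, mb, m₁, m₂, m₃, m₄, m₅, x]))
    | some (.limit, [f, p]) =>
      let ps := [A, B, hA, hB, mz, ms, ml, mb, m₁, m₂, m₃, m₄, m₅].map (shift 1 0)
      some (app (app (app (app ml f) p)
        (lam (con .nat) (capp (.brwElim j) (ps ++ [app (shift 1 0 f) (var 0)]))))
        (lam (con .nat) (capp (.leElim j) (ps ++
          [capp .bsucc [app (shift 1 0 f) (var 0)], app (shift 1 0 f) (capp .nsucc [var 0]),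
            app (shift 1 0 p) (var 0)]))))
    | _ => none
  | _, _ => none

/-- The computation rules are non-linear: the parameters of an eliminator recur in the constructor.
`compStep` tests these repetitions, and once they are identified the term is literally an instance
of a rule. -/
theorem comp_of_compStep {k : Const} {as : List Tm} {u : Tm} (h : compStep k as = some u) :
    Comp (capp k as) u := by
  unfold compStep at h
  split at h
  case h_10 =>
    split at h
    case h_1 hs =>
      rw [eq_capp_of_spine hs]; obtain rfl := Option.some.inj h; exact .bzero ..
    case h_2 hs =>
      rw [eq_capp_of_spine hs]; obtain rfl := Option.some.inj h; exact .bsucc ..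
    case h_3 hs =>
      rw [eq_capp_of_spine hs]; obtain rfl := Option.some.inj h
      simp only [← funext lift_eq_shift]
      exact .limit (ps := [_, _, _, _, _, _, _, _, _, _, _, _, _]) (hps := rfl) ..
    case h_4 => cases h
  all_goals
    repeat' split at h
    all_goals first | cases h; done | skip
  all_goals
    rename_i hs
    first
    | (rename_i hs'
       rw [eq_capp_of_spine hs, eq_capp_of_spine hs'])
    | rw [eq_capp_of_spine hs]
  all_goals
    first
    | (obtain rfl := Option.some.inj h; constructor)
    | (rw [Bool.cond_eq_ite] at h
       split at h
       case isFalse => cases h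
       case isTrue h' =>
        simp only [Bool.and_eq_true, natBeq_iff, beq_iff, and_assoc] at h'
        obtain rfl := Option.some.inj h
        -- Seven equations occur in the η-rule for pairs, which is the longest case.
        obtain ⟨rfl, rfl, rfl, rfl, rfl, rfl, rfl⟩ := h'
        constructor)

end HoTT

/-! ### Substitution -/

namespace HoTT

open Judgement

namespace Tm

theorem upSub_var (ρ : ℕ → ℕ) : upSub (fun n => var (ρ n)) = fun n => var (upRen ρ n) := by
  funext n
  cases n <;> rfl

theorem subst_var (t : Tm) : ∀ ρ : ℕ → ℕ, subst (fun n => var (ρ n)) t = rename ρ t := by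
  induction t with
  | pi A B hA hB | lam A B hA hB => intro ρ; simp only [subst, rename, hA, upSub_var, hB]
  | app f a hf ha => intro ρ; simp only [subst, rename, hf, ha]
  | _ => intros; rfl

theorem upSub_comp_upRen (σ : ℕ → Tm) (ρ : ℕ → ℕ) :
    (fun n => upSub σ (upRen ρ n)) = upSub fun n => σ (ρ n) := by
  funext n
  cases n <;> rfl

theorem subst_rename (t : Tm) : ∀ (σ : ℕ → Tm) (ρ : ℕ → ℕ),
    subst σ (rename ρ t) = subst (fun n => σ (ρ n)) t := by
  induction t with
  | pi A B hA hB | lam A B hA hB => intro σ ρ; simp only [subst, rename, hA, hB, upSub_comp_upRen]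
  | app f a hf ha => intro σ ρ; simp only [subst, rename, hf, ha]
  | _ => intros; rfl

theorem rename_rename (t : Tm) (ρ ρ' : ℕ → ℕ) :
    rename ρ (rename ρ' t) = rename (fun n => ρ (ρ' n)) t := by
  rw [← subst_var, subst_rename, subst_var]

theorem rename_upSub (σ : ℕ → Tm) (ρ : ℕ → ℕ) :
    (fun n => rename (upRen ρ) (upSub σ n)) = upSub fun n => rename ρ (σ n) := by
  funext n
  cases n with
  | zero => rfl
  | succ n => simp only [upSub, lift, rename_rename]; rfl

theorem rename_subst (t : Tm) : ∀ (σ : ℕ → Tm) (ρ : ℕ → ℕ),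
    rename ρ (subst σ t) = subst (fun n => rename ρ (σ n)) t := by
  induction t with
  | pi A B hA hB | lam A B hA hB => intro σ ρ; simp only [subst, rename, hA, hB, rename_upSub]
  | app f a hf ha => intro σ ρ; simp only [subst, rename, hf, ha]
  | _ => intros; rfl

theorem subst_lift (σ : ℕ → Tm) (t : Tm) : subst (upSub σ) (lift t) = lift (subst σ t) := by
  rw [lift, subst_rename, lift, rename_subst]
  rfl

theorem subst_upSub (σ τ : ℕ → Tm) :
    (fun n => subst (upSub τ) (upSub σ n)) = upSub fun n => subst τ (σ n) := by
  funext n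
  cases n with
  | zero => rfl
  | succ n => exact subst_lift τ (σ n)

theorem subst_subst (t : Tm) : ∀ σ τ : ℕ → Tm,
    subst τ (subst σ t) = subst (fun n => subst τ (σ n)) t := by
  induction t with
  | pi A B hA hB | lam A B hA hB => intro σ τ; simp only [subst, hA, hB, subst_upSub]
  | app f a hf ha => intro σ τ; simp only [subst, hf, ha]
  | _ => intros; rfl

theorem upSub_id : upSub var = var := by
  funext n
  cases n <;> rfl

theorem subst_id (t : Tm) : subst var t = t := by
  induction t with
  | pi A B hA hB | lam A B hA hB => simp only [subst, hA, upSub_id, hB]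
  | app f a hf ha => simp only [subst, hf, ha]
  | _ => rfl

/-- Extend a substitution by a term for the variable `0`. -/
def cons (a : Tm) (σ : ℕ → Tm) : ℕ → Tm
  | 0 => a
  | n + 1 => σ n

theorem subst_cons_lift (a : Tm) (σ : ℕ → Tm) (t : Tm) : subst (cons a σ) (lift t) = subst σ t :=
  subst_rename t _ _

theorem inst_lift (t a : Tm) : inst (lift t) a = t := by
  rw [inst, lift, subst_rename]
  exact subst_id t

theorem inst_subst_upSub (σ : ℕ → Tm) (t a : Tm) :
    inst (subst (upSub σ) t) a = subst (cons a σ) t := by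
  rw [inst, subst_subst]
  congr 1
  funext n
  cases n with
  | zero => rfl
  | succ n => exact inst_lift _ _

theorem subst_inst (σ : ℕ → Tm) (t a : Tm) :
    subst σ (inst t a) = inst (subst (upSub σ) t) (subst σ a) := by
  rw [inst_subst_upSub, inst, subst_subst]
  congr 1
  funext n
  cases n <;> rfl

/-- All variables of the term are less than `d`. -/
def closedAt : ℕ → Tm → Bool
  | d, var n => Nat.blt n d
  | _, univ _ => true
  | d, pi A B => closedAt d A && closedAt (d + 1) B
  | d, lam A B => closedAt d A && closedAt (d + 1) B
  | d, app A B => closedAt d A && closedAt d B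
  | _, con _ => true

theorem subst_of_closedAt (t : Tm) : ∀ (d : ℕ) (σ : ℕ → Tm), closedAt d t = true →
    (∀ n < d, σ n = var n) → subst σ t = t := by
  induction t with
  | var n => intro d σ h hσ; exact hσ n (by simpa [closedAt, blt_iff] using h)
  | pi A B hA hB | lam A B hA hB =>
    intro d σ h hσ
    simp only [closedAt, Bool.and_eq_true] at h
    rw [subst, hA d σ h.1 hσ, hB (d + 1) _ h.2]
    rintro (_ | n) hn
    · rfl
    · rw [upSub, hσ n (by omega)]; rfl
  | app f a hf ha =>
    intro d σ h hσ
    simp only [closedAt, Bool.and_eq_true] at h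
    rw [subst, hf d σ h.1 hσ, ha d σ h.2 hσ]
  | _ => intros; rfl

theorem subst_of_closed {t : Tm} (h : closedAt 0 t = true) (σ : ℕ → Tm) : subst σ t = t :=
  subst_of_closedAt t 0 σ h (by simp)

theorem subst_capp (σ : ℕ → Tm) (c : Const) (as : List Tm) :
    subst σ (capp c as) = capp c (as.map (subst σ)) := by
  have : ∀ t, subst σ (as.foldl app t) = (as.map (subst σ)).foldl app (subst σ t) := by
    induction as with
    | nil => intro t; rfl
    | cons a as ih => intro t; exact ih _
  exact this _

end Tm

open Tm

theorem closedAt_constType (c : Const) : closedAt 0 (constType c).close = true := by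
  cases c <;> rfl

theorem Comp.subst {t u : Tm} (h : Comp t u) (σ : ℕ → Tm) : Comp (t.subst σ) (u.subst σ) := by
  cases h with
  | limit j A B hA hB mz ms ml mb m₁ m₂ m₃ m₄ m₅ f p ps hps =>
    have := Comp.limit j (A.subst σ) (B.subst σ) (hA.subst σ) (hB.subst σ) (mz.subst σ) (ms.subst σ)
      (ml.subst σ) (mb.subst σ) (m₁.subst σ) (m₂.subst σ) (m₃.subst σ) (m₄.subst σ) (m₅.subst σ)
      (f.subst σ) (p.subst σ) _ rfl
    subst hps
    simpa only [subst_capp, Tm.subst, List.map_append, List.map_cons, List.map_nil, subst_lift,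
      upSub] using this
  | _ =>
    simp only [subst_capp, Tm.subst, List.map_cons, List.map_nil]
    constructor

def Judgement.subst (σ : ℕ → Tm) : Judgement → Judgement
  | ty t A => ty (t.subst σ) (A.subst σ)
  | eq t u A => eq (t.subst σ) (u.subst σ) (A.subst σ)

/-- Derivability is stable under a class `P` of substitutions. -/
theorem Derivable.subst_of_class (P : Ctx → Ctx → (ℕ → Tm) → Prop)
    (hvar : ∀ {Γ Δ σ n A}, P Γ Δ σ → Γ[n]? = some A →
      Derivable Δ (ty (σ n) (subst σ (rename (fun m => m + (n + 1)) A))))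
    (hup : ∀ {Γ Δ σ A}, P Γ Δ σ → P (A :: Γ) (subst σ A :: Δ) (upSub σ))
    {Γ : Ctx} {J : Judgement} (h : Derivable Γ J) :
    ∀ {Δ : Ctx} {σ : ℕ → Tm}, P Γ Δ σ → Derivable Δ (J.subst σ) := by
  induction h with
  | var h => intro Δ σ hσ; exact hvar hσ h
  | univ i => intros; exact .univ i
  | cumul _ ih => intro Δ σ hσ; exact .cumul (ih hσ)
  | con c =>
    intro Δ σ _
    rw [Judgement.subst, subst_of_closed (closedAt_constType c)]
    exact .con c
  | pi _ _ ih₁ ih₂ => intro Δ σ hσ; exact .pi (ih₁ hσ) (ih₂ (hup hσ))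
  | lam _ _ ih₁ ih₂ => intro Δ σ hσ; exact .lam (ih₁ hσ) (ih₂ (hup hσ))
  | app _ _ ih₁ ih₂ => intro Δ σ hσ; rw [Judgement.subst, subst_inst]; exact .app (ih₁ hσ) (ih₂ hσ)
  | conv _ _ ih₁ ih₂ => intro Δ σ hσ; exact .conv (ih₁ hσ) (ih₂ hσ)
  | eqRefl _ ih => intro Δ σ hσ; exact .eqRefl (ih hσ)
  | eqSymm _ ih => intro Δ σ hσ; exact .eqSymm (ih hσ)
  | eqTrans _ _ ih₁ ih₂ => intro Δ σ hσ; exact .eqTrans (ih₁ hσ) (ih₂ hσ)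
  | eqConv _ _ ih₁ ih₂ => intro Δ σ hσ; exact .eqConv (ih₁ hσ) (ih₂ hσ)
  | eqCumul _ ih => intro Δ σ hσ; exact .eqCumul (ih hσ)
  | eqPi _ _ _ ih₁ ih₂ ih₃ => intro Δ σ hσ; exact .eqPi (ih₁ hσ) (ih₂ hσ) (ih₃ (hup hσ))
  | eqLam _ _ _ ih₁ ih₂ ih₃ => intro Δ σ hσ; exact .eqLam (ih₁ hσ) (ih₂ hσ) (ih₃ (hup hσ))
  | eqApp _ _ ih₁ ih₂ =>
    intro Δ σ hσ; rw [Judgement.subst, subst_inst]; exact .eqApp (ih₁ hσ) (ih₂ hσ)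
  | beta _ _ _ ih₁ ih₂ ih₃ =>
    intro Δ σ hσ
    simp only [Judgement.subst, subst_inst]
    exact .beta (ih₁ hσ) (ih₂ (hup hσ)) (ih₃ hσ)
  | eta _ ih =>
    intro Δ σ hσ
    simp only [Judgement.subst, Tm.subst, subst_lift]
    exact .eta (ih hσ)
  | comp hc _ _ ih₁ ih₂ => intro Δ σ hσ; exact .comp (hc.subst σ) (ih₁ hσ) (ih₂ hσ)

/-- Renamings are treated before general substitutions because carrying a substitution under a
binder requires weakening. Types are compared after weakening to the whole context, a condition that
is stable under `upRen`. -/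
theorem Derivable.rename {Γ Δ : Ctx} {J : Judgement} (h : Derivable Γ J) (ρ : ℕ → ℕ)
    (hρ : ∀ n A, Γ[n]? = some A → ∃ B, Δ[ρ n]? = some B ∧
      Tm.rename (fun m => m + (ρ n + 1)) B = Tm.rename ρ (Tm.rename (fun m => m + (n + 1)) A)) :
    Derivable Δ (J.subst fun n => Tm.var (ρ n)) := by
  refine h.subst_of_class (fun Γ Δ σ => ∃ ρ : ℕ → ℕ, (σ = fun n => Tm.var (ρ n)) ∧
    ∀ n A, Γ[n]? = some A → ∃ B, Δ[ρ n]? = some B ∧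
      Tm.rename (fun m => m + (ρ n + 1)) B = Tm.rename ρ (Tm.rename (fun m => m + (n + 1)) A))
    ?_ ?_ ⟨ρ, rfl, hρ⟩
  · rintro Γ Δ σ n A ⟨ρ, rfl, hρ⟩ hn
    obtain ⟨B, hB, e⟩ := hρ n A hn
    rw [subst_var, ← e]
    exact .var hB
  · rintro Γ Δ σ A ⟨ρ, rfl, hρ⟩
    refine ⟨upRen ρ, upSub_var ρ, ?_⟩
    rintro (_ | n) B hn
    · simp only [List.getElem?_cons_zero, Option.some.injEq] at hn
      subst hn
      refine ⟨_, rfl, ?_⟩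
      rw [subst_var, rename_rename, rename_rename]
      rfl
    · obtain ⟨C, hC, e⟩ := hρ n B hn
      refine ⟨C, hC, ?_⟩
      have := congrArg lift e
      simp only [lift, rename_rename] at this ⊢
      exact this

theorem Derivable.weaken {Γ : Ctx} {t A : Tm} (h : Derivable Γ (ty t A)) (B : Tm) :
    Derivable (B :: Γ) (ty (lift t) (lift A)) := by
  have := h.rename (Δ := B :: Γ) Nat.succ fun n A hn => ⟨A, hn, by rw [rename_rename]; rfl⟩
  rwa [Judgement.subst, subst_var, subst_var] at this

/-- `σ` is a substitution from `Γ` to `Δ`. -/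
def IsSubst (Γ Δ : Ctx) (σ : ℕ → Tm) : Prop :=
  ∀ n A, Γ[n]? = some A → Derivable Δ (ty (σ n) (subst σ (rename (fun m => m + (n + 1)) A)))

theorem IsSubst.up {Γ Δ : Ctx} {σ : ℕ → Tm} (h : IsSubst Γ Δ σ) (A : Tm) :
    IsSubst (A :: Γ) (subst σ A :: Δ) (upSub σ) := by
  rintro (_ | n) B hn
  · simp only [List.getElem?_cons_zero, Option.some.injEq] at hn
    subst hn
    have : Derivable (subst σ A :: Δ) (ty (var 0) (lift (subst σ A))) := .var rfl
    rwa [← subst_lift] at this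
  · have := (h n B hn).weaken (subst σ A)
    rw [← subst_lift] at this
    simp only [lift, rename_rename] at this
    exact this

theorem Derivable.subst {Γ Δ : Ctx} {J : Judgement} {σ : ℕ → Tm} (h : Derivable Γ J)
    (hσ : IsSubst Γ Δ σ) : Derivable Δ (J.subst σ) :=
  h.subst_of_class IsSubst (fun hσ hn => hσ _ _ hn) (fun hσ => hσ.up _) hσ

theorem IsSubst.cons {Γ Δ : Ctx} {σ : ℕ → Tm} (h : IsSubst Γ Δ σ) {a A : Tm}
    (ha : Derivable Δ (ty a (A.subst σ))) : IsSubst (A :: Γ) Δ (Tm.cons a σ) := by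
  rintro (_ | n) B hn
  · simp only [List.getElem?_cons_zero, Option.some.injEq] at hn
    subst hn
    rwa [← subst_cons_lift a] at ha
  · have := h n B hn
    rw [subst_rename] at this ⊢
    exact this

theorem IsSubst.id (Γ : Ctx) : IsSubst Γ Γ var := by
  intro n A hn
  rw [subst_id]
  exact .var hn

theorem IsSubst.single {Γ : Ctx} {a A : Tm} (ha : Derivable Γ (ty a A)) :
    IsSubst (A :: Γ) Γ (Tm.single a) := by
  have := (IsSubst.id Γ).cons (a := a) (A := A) (by rwa [subst_id])
  convert this using 1
  funext n
  cases n <;> rfl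

end HoTT

/-! ### Contexts with definitions -/

namespace HoTT

open Judgement Tm

/-- A context entry: a variable of type `T`, or a name for the term `v` of type `T`. -/
inductive Entry : Type
  | hyp (T : Tm)
  | dfn (v T : Tm)

/-- Contexts with definitions. -/
abbrev LCtx : Type := List Entry

/-- The number of leading binders that a term shares with its type. -/
def binders : Tm → Tm → ℕ
  | lam _ t, T => match T with
    | pi _ B => binders t B + 1
    | _ => 0
  | _, _ => 0

theorem binders_shift (k : ℕ) (t : Tm) : ∀ (c : ℕ) (T : Tm),
    binders (shift k c t) (shift k c T) = binders t T := by
  induction t with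
  | lam A t _ ih =>
    intro c T
    cases T with
    | pi A' B => simp only [shift, binders, ih]
    | var n => simp only [shift, binders]; cases Nat.blt n c <;> rfl
    | _ => rfl
  | var n => intro c T; simp only [shift]; cases Nat.blt n c <;> rfl
  | _ => intros; rfl

/-- `t : T`, where the `n` leading binders of `t` and `T` carry the same types. -/
def Strict : ℕ → Ctx → Tm → Tm → Prop
  | 0, Γ, t, T => Derivable Γ (ty t T)
  | n + 1, Γ, t, T => ∃ A b B i, t = lam A b ∧ T = pi A B ∧ Derivable Γ (ty A (univ i)) ∧
      Strict n (A :: Γ) b B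

theorem Strict.derivable {n : ℕ} : ∀ {Γ : Ctx} {t T : Tm}, Strict n Γ t T →
    Derivable Γ (ty t T) := by
  induction n with
  | zero => intro Γ t T h; exact h
  | succ n ih => rintro Γ _ _ ⟨A, b, B, i, rfl, rfl, hA, hb⟩; exact .lam hA (ih hb)

theorem Strict.subst {n : ℕ} : ∀ {Γ Δ : Ctx} {σ : ℕ → Tm} {t T : Tm}, Strict n Γ t T →
    IsSubst Γ Δ σ → Strict n Δ (t.subst σ) (T.subst σ) := by
  induction n with
  | zero => intro Γ Δ σ t T h hσ; exact Derivable.subst h hσ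
  | succ n ih =>
    rintro Γ Δ σ _ _ ⟨A, b, B, i, rfl, rfl, hA, hb⟩ hσ
    exact ⟨_, _, _, i, rfl, rfl, hA.subst hσ, ih hb (hσ.up A)⟩

theorem IsSubst.weaken (Γ : Ctx) (A : Tm) : IsSubst Γ (A :: Γ) fun n => var (n + 1) := by
  intro n B hn
  rw [subst_var (ρ := fun n => n + 1), rename_rename]
  exact .var hn

theorem subst_succ (t : Tm) : t.subst (fun n => var (n + 1)) = lift t :=
  subst_var t Nat.succ

/-- `Δ` unfolds to the context `Γ`, where `σ` substitutes for the definitions, and possibly for some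
of the variables. -/
inductive Models : LCtx → Ctx → (ℕ → Tm) → Prop
  | nil : Models [] [] var
  | hyp {Δ : LCtx} {Γ : Ctx} {σ : ℕ → Tm} (T : Tm) : Models Δ Γ σ →
      Models (.hyp T :: Δ) (T.subst σ :: Γ) (upSub σ)
  | inst {Δ : LCtx} {Γ : Ctx} {σ : ℕ → Tm} {t T : Tm} : Models Δ Γ σ →
      Derivable Γ (ty t (T.subst σ)) → Models (.hyp T :: Δ) Γ (cons t σ)
  | dfn {Δ : LCtx} {Γ : Ctx} {σ : ℕ → Tm} {v T : Tm} : Models Δ Γ σ →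
      Strict (binders v T) Γ (v.subst σ) (T.subst σ) →
      Models (.dfn v T :: Δ) Γ (cons (v.subst σ) σ)

def nthEntry : LCtx → ℕ → Option Entry
  | [], _ => none
  | a :: _, 0 => some a
  | _ :: as, n + 1 => nthEntry as n

theorem subst_cons_rename (n : ℕ) (a : Tm) (σ : ℕ → Tm) (t : Tm) :
    subst (cons a σ) (Tm.rename (fun m => m + (n + 1)) t) =
      subst σ (Tm.rename (fun m => m + n) t) := by
  rw [subst_rename, subst_rename]
  rfl

theorem subst_rename_zero (σ : ℕ → Tm) (t : Tm) :
    subst σ (Tm.rename (fun m => m + 0) t) = subst σ t :=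
  subst_rename t _ _

/-- This justifies the unfolding of names: `σ` sends a defined variable to the unfolded body, so
exchanging name and body changes nothing after substitution. Strictness is kept because the body may
become the head of a β-redex. -/
theorem Models.var {Δ : LCtx} {Γ : Ctx} {σ : ℕ → Tm} (h : Models Δ Γ σ) : ∀ {n : ℕ},
    (∀ {T}, nthEntry Δ n = some (.hyp T) →
      Derivable Γ (ty (σ n) (subst σ (Tm.rename (fun m => m + (n + 1)) T)))) ∧
    (∀ {v T}, nthEntry Δ n = some (.dfn v T) →
      σ n = subst σ (Tm.rename (fun m => m + (n + 1)) v) ∧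
      Strict (binders v T) Γ (σ n) (subst σ (Tm.rename (fun m => m + (n + 1)) T))) := by
  induction h with
  | nil => intro n; constructor <;> intros <;> contradiction
  | @hyp Δ Γ σ T h ih =>
    rintro (_ | n)
    · refine ⟨fun hn => ?_, fun hn => by cases hn⟩
      cases hn
      have : Derivable (T.subst σ :: Γ) (ty (Tm.var 0) (lift (T.subst σ))) := .var rfl
      rwa [← subst_lift] at this
    · refine ⟨fun {S} hn => ?_, fun {v S} hn => ?_⟩
      · have := (ih.1 hn).weaken (T.subst σ)
        rw [← subst_lift] at this
        simp only [lift, rename_rename] at this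
        exact this
      · obtain ⟨h₁, h₂⟩ := ih.2 hn
        have h₃ := h₂.subst (IsSubst.weaken Γ (T.subst σ))
        rw [subst_succ, subst_succ, ← subst_lift] at h₃
        have h₄ := congrArg lift h₁
        rw [← subst_lift] at h₄
        simp only [lift, rename_rename] at h₃ h₄
        exact ⟨h₄, h₃⟩
  | @inst Δ Γ σ t S h ht ih =>
    rintro (_ | n)
    · refine ⟨fun hn => ?_, fun hn => (by cases hn)⟩
      cases hn
      rw [subst_cons_rename, subst_rename_zero]
      exact ht
    · refine ⟨fun {S} hn => ?_, fun {v S} hn => ?_⟩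
      · rw [subst_cons_rename]; exact ih.1 hn
      · rw [subst_cons_rename, subst_cons_rename]; exact ih.2 hn
  | @dfn Δ Γ σ w S h hw ih =>
    rintro (_ | n)
    · refine ⟨fun hn => (by cases hn), fun hn => ?_⟩
      cases hn
      rw [subst_cons_rename, subst_cons_rename, subst_rename_zero, subst_rename_zero]
      exact ⟨rfl, hw⟩
    · refine ⟨fun {S} hn => ?_, fun {v S} hn => ?_⟩
      · rw [subst_cons_rename]; exact ih.1 hn
      · rw [subst_cons_rename, subst_cons_rename]; exact ih.2 hn

/-- Derivability in a context with definitions. -/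
def Valid (Δ : LCtx) (J : Judgement) : Prop := ∀ ⦃Γ σ⦄, Models Δ Γ σ → Derivable Γ (J.subst σ)

def ValidStrict (n : ℕ) (Δ : LCtx) (t T : Tm) : Prop :=
  ∀ ⦃Γ σ⦄, Models Δ Γ σ → Strict n Γ (t.subst σ) (T.subst σ)

namespace Valid

variable {Δ : LCtx} {A A' B B' C f f' a a' t t' u v : Tm} {i : ℕ}

theorem con (c : Const) : Valid Δ (ty (con c) (constType c).close) := by
  intro Γ σ _
  rw [Judgement.subst, subst_of_closed (closedAt_constType c)]
  exact .con c

theorem univ (i : ℕ) : Valid Δ (ty (univ i) (univ (i + 1))) := fun _ _ _ => .univ i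

theorem cumul (h : Valid Δ (ty A (Tm.univ i))) : Valid Δ (ty A (Tm.univ (i + 1))) :=
  fun _ _ m => .cumul (h m)

theorem pi (h : Valid Δ (ty A (Tm.univ i))) (h' : Valid (.hyp A :: Δ) (ty B (Tm.univ i))) :
    Valid Δ (ty (Tm.pi A B) (Tm.univ i)) :=
  fun _ _ m => .pi (h m) (h' (m.hyp A))

theorem lam (h : Valid Δ (ty A (Tm.univ i))) (h' : Valid (.hyp A :: Δ) (ty t B)) :
    Valid Δ (ty (Tm.lam A t) (Tm.pi A B)) :=
  fun _ _ m => .lam (h m) (h' (m.hyp A))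

theorem app (h : Valid Δ (ty f (Tm.pi A B))) (h' : Valid Δ (ty a A)) :
    Valid Δ (ty (Tm.app f a) (inst B a)) := by
  intro Γ σ m
  rw [Judgement.subst, subst_inst]
  exact .app (h m) (h' m)

theorem conv (h : Valid Δ (ty t A)) (h' : Valid Δ (eq A B (Tm.univ i))) : Valid Δ (ty t B) :=
  fun _ _ m => .conv (h m) (h' m)

theorem eqRefl (h : Valid Δ (ty t A)) : Valid Δ (eq t t A) := fun _ _ m => .eqRefl (h m)

theorem eqSymm (h : Valid Δ (eq t u A)) : Valid Δ (eq u t A) := fun _ _ m => .eqSymm (h m)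

theorem eqTrans (h : Valid Δ (eq t u A)) (h' : Valid Δ (eq u v A)) : Valid Δ (eq t v A) :=
  fun _ _ m => .eqTrans (h m) (h' m)

theorem eqConv (h : Valid Δ (eq t u A)) (h' : Valid Δ (eq A B (Tm.univ i))) : Valid Δ (eq t u B) :=
  fun _ _ m => .eqConv (h m) (h' m)

theorem eqCumul (h : Valid Δ (eq A B (Tm.univ i))) : Valid Δ (eq A B (Tm.univ (i + 1))) :=
  fun _ _ m => .eqCumul (h m)

theorem eqPi (h : Valid Δ (ty A (Tm.univ i))) (h' : Valid Δ (eq A A' (Tm.univ i)))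
    (h'' : Valid (.hyp A :: Δ) (eq B B' (Tm.univ i))) :
    Valid Δ (eq (Tm.pi A B) (Tm.pi A' B') (Tm.univ i)) :=
  fun _ _ m => .eqPi (h m) (h' m) (h'' (m.hyp A))

theorem eqLam (h : Valid Δ (ty A (Tm.univ i))) (h' : Valid Δ (eq A A' (Tm.univ i)))
    (h'' : Valid (.hyp A :: Δ) (eq t t' B)) :
    Valid Δ (eq (Tm.lam A t) (Tm.lam A' t') (Tm.pi A B)) :=
  fun _ _ m => .eqLam (h m) (h' m) (h'' (m.hyp A))

theorem eqApp (h : Valid Δ (eq f f' (Tm.pi A B))) (h' : Valid Δ (eq a a' A)) :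
    Valid Δ (eq (Tm.app f a) (Tm.app f' a') (inst B a)) := by
  intro Γ σ m
  rw [Judgement.subst, subst_inst]
  exact .eqApp (h m) (h' m)

theorem comp (h : Comp t u) (h₁ : Valid Δ (ty t A)) (h₂ : Valid Δ (ty u A)) :
    Valid Δ (eq t u A) :=
  fun _ σ m => .comp (h.subst σ) (h₁ m) (h₂ m)

end Valid

namespace ValidStrict

variable {Δ : LCtx} {n : ℕ} {A B t T a : Tm}

theorem valid (h : ValidStrict n Δ t T) : Valid Δ (ty t T) := fun _ _ m => (h m).derivable

theorem lam {i : ℕ} (h : Valid Δ (ty A (univ i))) (h' : ValidStrict n (.hyp A :: Δ) t B) :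
    ValidStrict (n + 1) Δ (Tm.lam A t) (pi A B) :=
  fun _ _ m => ⟨_, _, _, i, rfl, rfl, h m, h' (m.hyp A)⟩

/-- A mere derivation of `lam A t : pi A' B` may end in a conversion, and without injectivity of
products it does not yield `t : B`. Strict typing remembers the premises of the β-rule. It also
makes the two domains agree, which gives the last conclusion. -/
theorem beta {A' : Tm} (h : ValidStrict (n + 1) Δ (Tm.lam A t) (pi A' B))
    (ha : Valid Δ (ty a A)) :
    ValidStrict n Δ (inst t a) (inst B a) ∧
      Valid Δ (eq (app (Tm.lam A t) a) (inst t a) (inst B a)) ∧ Valid Δ (ty a A') := by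
  refine ⟨fun Γ σ m => ?_, fun Γ σ m => ?_, fun Γ σ m => ?_⟩ <;>
    obtain ⟨A₀, b, B₀, i, h₁, h₂, h₃, h₄⟩ := h m <;> injection h₁ with e₁ e₂ <;>
    injection h₂ with e₃ e₄ <;> subst e₁ <;> subst e₂ <;> subst e₄
  · rw [subst_inst, subst_inst]
    exact h₄.subst (IsSubst.single (ha m))
  · rw [Judgement.subst, subst_inst, subst_inst]
    exact .beta h₃ h₄.derivable (ha m)
  · rw [Judgement.subst, e₃]
    exact ha m

end ValidStrict

/-- In the context `Δ`, terms and equations of type `A` are of type `B`. -/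
def Included (Δ : LCtx) (A B : Tm) : Prop :=
  (∀ t, Valid Δ (ty t A) → Valid Δ (ty t B)) ∧ ∀ t u, Valid Δ (eq t u A) → Valid Δ (eq t u B)

namespace Included

theorem refl (Δ : LCtx) (A : Tm) : Included Δ A A := ⟨fun _ h => h, fun _ _ h => h⟩

theorem trans {Δ : LCtx} {A B C : Tm} (h : Included Δ A B) (h' : Included Δ B C) :
    Included Δ A C :=
  ⟨fun t ht => h'.1 t (h.1 t ht), fun t u ht => h'.2 t u (h.2 t u ht)⟩

theorem of_eq {Δ : LCtx} {A B : Tm} {i : ℕ} (h : Valid Δ (eq A B (univ i))) : Included Δ A B :=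
  ⟨fun _ ht => ht.conv h, fun _ _ ht => ht.eqConv h⟩

theorem univ {Δ : LCtx} {i j : ℕ} (h : i ≤ j) : Included Δ (univ i) (univ j) := by
  induction h with
  | refl => exact refl _ _
  | step _ ih => exact ih.trans ⟨fun _ ht => ht.cumul, fun _ _ ht => ht.eqCumul⟩

end Included

/-! ### The type checker -/

/-- The mutually recursive functions of the type checker.

* `inferC` infers a type, in the form of a term under a simultaneous substitution;
* `check` checks a term against a type;
* `conv` converts two terms, and returns their common type;
* `convC` converts two terms at a given type;
* `red` performs a head reduction step and returns the reduct and the type;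
* `asPi` and `asUniv` reduce a type to a product or a universe. -/
structure Checker : Type where
  inferC : LCtx → Tm → Option (Tm × List Tm)
  check : LCtx → Tm → Tm → Bool
  conv : LCtx → Tm → Tm → Option Tm
  convC : LCtx → Tm → Tm → Tm → Bool
  red : LCtx → Tm → Option (Tm × Tm)
  asPi : LCtx → Tm → Option (Tm × Tm)
  asUniv : LCtx → Tm → Option ℕ

/-- The number of arguments of the constants that have computation rules. -/
def elimArity : Const → ℕ
  | .fst _ => 3
  | .snd _ => 3
  | .pair _ => 4
  | .J _ _ => 6
  | .unitElim _ => 3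
  | .boolElim _ => 4
  | .natElim _ => 4
  | .sumElim _ _ => 6
  | .truncElim _ _ => 5
  | .brwElim _ => 14
  | _ => 0

/-- The head of a term, and the list of its arguments, followed by `as`. -/
def unspine : Tm → List Tm → Tm × List Tm
  | app f a, as => unspine f (a :: as)
  | t, as => (t, as)

theorem foldl_unspine (t : Tm) : ∀ as : List Tm,
    (unspine t as).2.foldl app (unspine t as).1 = as.foldl app t := by
  induction t with
  | app f a hf _ => intro as; exact hf (a :: as)
  | _ => intros; rfl

/-- Split the list after `n` elements; the last of these is returned separately. -/
def splitLast : ℕ → List Tm → Option (List Tm × Tm × List Tm)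
  | 0, _ => none
  | _ + 1, [] => none
  | n + 1, a :: as => match n with
    | 0 => some ([], a, as)
    | _ + 1 => match splitLast n as with
      | some (l, b, r) => some (a :: l, b, r)
      | none => none

theorem eq_of_splitLast {n : ℕ} : ∀ {as l r : List Tm} {a : Tm},
    splitLast n as = some (l, a, r) → as = l ++ a :: r := by
  induction n with
  | zero => intro as l r a h; simp [splitLast] at h
  | succ n ih =>
    intro as l r a h
    match as, n, h with
    | [], _, h => simp [splitLast] at h
    | b :: as, 0, h => cases h; rfl
    | b :: as, n + 1, h =>
      simp only [splitLast] at h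
      split at h
      case h_2 => cases h
      case h_1 h' => cases h; rw [ih h']; rfl

namespace Checker

def infer (c : Checker) (Δ : LCtx) (t : Tm) : Option Tm :=
  match c.inferC Δ t with
  | some (T, e) => some (msubst e 0 T)
  | none => none

/-- The universe level of a type. -/
def sort (c : Checker) (Δ : LCtx) (A : Tm) : Option ℕ :=
  match c.infer Δ A with
  | some U => c.asUniv Δ U
  | none => none

/-- The universe level at which two types are convertible. -/
def convT (c : Checker) (Δ : LCtx) (A B : Tm) : Option ℕ :=
  match c.conv Δ A B with
  | some U => c.asUniv Δ U
  | none => none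

/-- Conversion of types up to cumulativity. -/
def sub (c : Checker) (Δ : LCtx) (A B : Tm) : Bool :=
  bif beq A B then true else
    match A, B with
    | univ i, univ j => Nat.ble i j
    | _, _ => match c.convT Δ A B with
      | some _ => true
      | none => false

/-- A type that contains `A` and `B`. -/
def join (c : Checker) (Δ : LCtx) (A B : Tm) : Option Tm :=
  bif c.sub Δ A B then some B else bif c.sub Δ B A then some A else none

def inferSub (c : Checker) (Δ : LCtx) (t T : Tm) : Bool :=
  match c.infer Δ t with
  | some S => c.sub Δ S T
  | none => false

def convSub (c : Checker) (Δ : LCtx) (t u T : Tm) : Bool :=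
  match c.conv Δ t u with
  | some S => c.sub Δ S T
  | none => false

/-- The type of a term of type `F` applied to a list of arguments. -/
def typeArgs (c : Checker) (Δ : LCtx) : Tm → List Tm → Option Tm
  | F, [] => some F
  | F, a :: as => match c.asPi Δ F with
    | some (A, B) => bif c.check Δ a A then typeArgs c Δ (msubst [a] 0 B) as else none
    | none => none

/-- Reduce a term of type `F` applied to a list of arguments by reducing the term to `u`. -/
def redHead (c : Checker) (Δ : LCtx) (u F : Tm) (as : List Tm) : Option (Tm × Tm) :=
  match c.typeArgs Δ F as with
  | some T => some (as.foldl app u, T)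
  | none => none

/-- Repeated `β`-reduction, of the term `b` of type `B` under the substitution `e`. -/
def redBeta (c : Checker) (Δ : LCtx) : List Tm → Tm → Tm → List Tm → Option (Tm × Tm)
  | [], b, B, e => some (msubst e 0 b, msubst e 0 B)
  | a :: as, b, B, e => match b, B with
    | lam A b, pi _ B => bif c.check Δ a (msubst e 0 A) then redBeta c Δ as b B (a :: e) else none
    | _, _ => c.redHead Δ (msubst e 0 b) (msubst e 0 B) (a :: as)

/-- Here `a` is the argument that an eliminator analyses; reducing it may expose a constructor. -/
def redArg (c : Checker) (Δ : LCtx) (f a : Tm) (as : List Tm) : Option (Tm × Tm) :=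
  match c.red Δ a with
  | some (a', S) => match c.infer Δ f with
    | some F => match c.asPi Δ F with
      | some (A, B) => bif c.sub Δ S A then c.redHead Δ (app f a') (msubst [a] 0 B) as else none
      | none => none
    | none => none
  | none => none

/-- The reduct is checked again, since the rule for computation asks for a typing of both sides. The
only rule headed by `pair` is η, which analyses no single argument; so no reduction inside an
argument is attempted there. -/
def redConst (c : Checker) (Δ : LCtx) (k : Const) (as : List Tm) : Option (Tm × Tm) :=
  match splitLast (elimArity k) as with
  | some (l, a, r) => match compStep k (l ++ [a]) with
    | some u => match c.infer Δ (app (capp k l) a) with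
      | some T => bif c.check Δ u T then c.redHead Δ u T r else none
      | none => none
    | none => match k with
      | .pair _ => none
      | _ => c.redArg Δ (capp k l) a r
  | none => none

def convStruct (c : Checker) (Δ : LCtx) : Tm → Tm → Option Tm
  | app f a, app f' a' => match c.conv Δ f f' with
    | some F => match c.asPi Δ F with
      | some (A, B) => bif c.convC Δ a a' A then some (msubst [a] 0 B) else none
      | none => none
    | none => none
  | lam A t, lam A' t' => match c.sort Δ A with
    | some _ => match c.convT Δ A A' with
      | some _ => match c.conv (.hyp A :: Δ) t t' with
        | some B => some (pi A B)
        | none => none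
      | none => none
    | none => none
  | pi A B, pi A' B' => match c.sort Δ A with
    | some i => match c.convT Δ A A' with
      | some j => match c.convT (.hyp A :: Δ) B B' with
        | some k => some (univ (max i (max j k)))
        | none => none
      | none => none
    | none => none
  | _, _ => none

/-- One level of the recursion. -/
def step (c : Checker) : Checker where
  inferC Δ t := match t with
    | var n => match nthEntry Δ n with
      | some (.hyp A) => some (shift (n + 1) 0 A, [])
      | some (.dfn _ A) => some (shift (n + 1) 0 A, [])
      | none => none
    | univ i => some (univ (i + 1), [])
    | con k => some ((constType k).close, [])
    | pi A B => match c.sort Δ A with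
      | some i => match c.sort (.hyp A :: Δ) B with
        | some j => some (univ (max i j), [])
        | none => none
      | none => none
    | lam A t => match c.sort Δ A with
      | some _ => match c.infer (.hyp A :: Δ) t with
        | some B => some (pi A B, [])
        | none => none
      | none => none
    | app f a => match c.inferC Δ f with
      | some (pi A B, e) => bif c.check Δ a (msubst e 0 A) then some (B, a :: e) else none
      | some (T, e) => match c.asPi Δ (msubst e 0 T) with
        | some (A, B) => bif c.check Δ a A then some (B, [a]) else none
        | none => none
      | none => none
  check Δ t T := match t with
    | lam A t₁ => match c.asPi Δ T with
      | some (A', B) => bif beq A A' then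
          match c.sort Δ A with
          | some _ => c.check (.hyp A :: Δ) t₁ B
          | none => false
        else c.inferSub Δ t T
      | none => false
    | _ => c.inferSub Δ t T
  conv Δ t u := bif beq t u then c.infer Δ t else
    match c.red Δ t with
    | some (t', T) => match c.conv Δ t' u with
      | some S => c.join Δ T S
      | none => none
    | none => match c.red Δ u with
      | some (u', T) => match c.conv Δ t u' with
        | some S => c.join Δ T S
        | none => none
      | none => c.convStruct Δ t u
  convC Δ t u T := bif beq t u then c.check Δ t T else
    match t, u with
    | lam A t₁, lam A' u₁ => match c.asPi Δ T with
      | some (A₁, B) => bif beq A A₁ then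
          match c.sort Δ A, c.convT Δ A A' with
          | some _, some _ => c.convC (.hyp A :: Δ) t₁ u₁ B
          | _, _ => false
        else c.convSub Δ t u T
      | none => false
    | _, _ => c.convSub Δ t u T
  red Δ t := match unspine t [] with
    | (lam A b, a :: as) => match c.sort Δ A with
      | some _ => match c.infer (.hyp A :: Δ) b with
        | some B => c.redBeta Δ (a :: as) (lam A b) (pi A B) []
        | none => none
      | none => none
    | (var n, as) => match nthEntry Δ n with
      | some (.dfn v T) => c.redBeta Δ as (shift (n + 1) 0 v) (shift (n + 1) 0 T) []
      | _ => none
    | (con k, as) => c.redConst Δ k as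
    | _ => none
  asPi Δ T := match T with
    | pi A B => some (A, B)
    | _ => match c.red Δ T with
      | some (T', U) => match c.asUniv Δ U with
        | some _ => c.asPi Δ T'
        | none => none
      | none => none
  asUniv Δ T := match T with
    | univ i => some i
    | _ => match c.red Δ T with
      | some (T', U) => match c.asUniv Δ U with
        | some _ => c.asUniv Δ T'
        | none => none
      | none => none

/-- The type checker with recursion depth `n`. -/
def ofDepth (n : ℕ) : Checker :=
  Nat.rec ⟨fun _ _ => none, fun _ _ _ => false, fun _ _ _ => none, fun _ _ _ _ => false,
    fun _ _ => none, fun _ _ => none, fun _ _ => none⟩ (fun _ c => step c) n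

/-- Check a definition, including the types of the leading binders. -/
def checkDfn (c : Checker) (Δ : LCtx) : Tm → Tm → Bool
  | lam A t, T => match T with
    | pi A' B => beq A A' && (match c.sort Δ A with | some _ => true | none => false) &&
        checkDfn c (.hyp A :: Δ) t B
    | _ => c.check Δ (lam A t) T
  | t, T => c.check Δ t T

end Checker

/-! ### Soundness -/

namespace Checker

/-- Both inclusions are needed for `asPi`: one to use a term of type `T` as a function, the other to
give an abstraction the type `T`. Inference has to be strict because its results enter β-reductions,
while `asUniv` is only used to recognise types. -/
structure Sound (c : Checker) : Prop where
  inferC : ∀ {Δ t T e}, c.inferC Δ t = some (T, e) →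
    ValidStrict (binders t (msubst e 0 T)) Δ t (msubst e 0 T)
  check : ∀ {Δ t T}, c.check Δ t T = true → Valid Δ (ty t T)
  conv : ∀ {Δ t u T}, c.conv Δ t u = some T → Valid Δ (eq t u T)
  convC : ∀ {Δ t u T}, c.convC Δ t u T = true → Valid Δ (eq t u T)
  red : ∀ {Δ t u T}, c.red Δ t = some (u, T) → Valid Δ (eq t u T)
  asPi : ∀ {Δ T A B}, c.asPi Δ T = some (A, B) → Included Δ T (pi A B) ∧ Included Δ (pi A B) T
  asUniv : ∀ {Δ T i}, c.asUniv Δ T = some i → Included Δ T (univ i)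

namespace Sound

variable {c : Checker} (hc : Sound c)

include hc

theorem inferS {Δ : LCtx} {t T : Tm} (h : c.infer Δ t = some T) :
    ValidStrict (binders t T) Δ t T := by
  unfold Checker.infer at h
  split at h
  case h_1 h' => obtain rfl := Option.some.inj h; exact hc.inferC h'
  case h_2 => cases h

theorem infer {Δ : LCtx} {t T : Tm} (h : c.infer Δ t = some T) : Valid Δ (ty t T) :=
  (hc.inferS h).valid

theorem sort {Δ : LCtx} {A : Tm} {i : ℕ} (h : c.sort Δ A = some i) :
    Valid Δ (ty A (univ i)) := by
  unfold Checker.sort at h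
  split at h
  case h_1 h' => exact (hc.asUniv h).1 _ (hc.infer h')
  case h_2 => cases h

theorem convT {Δ : LCtx} {A B : Tm} {i : ℕ} (h : c.convT Δ A B = some i) :
    Valid Δ (eq A B (univ i)) := by
  unfold Checker.convT at h
  split at h
  case h_1 h' => exact (hc.asUniv h).2 _ _ (hc.conv h')
  case h_2 => cases h

theorem sub {Δ : LCtx} {A B : Tm} (h : c.sub Δ A B = true) : Included Δ A B := by
  unfold Checker.sub at h
  rw [Bool.cond_eq_ite] at h
  split at h
  case isTrue h' => rw [beq_iff.1 h']; exact .refl _ _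
  case isFalse =>
    split at h
    · exact .univ (Nat.le_of_ble_eq_true h)
    · split at h
      case h_1 h' => exact .of_eq (hc.convT h')
      case h_2 => cases h

theorem join {Δ : LCtx} {A B C : Tm} (h : c.join Δ A B = some C) :
    Included Δ A C ∧ Included Δ B C := by
  unfold Checker.join at h
  simp only [Bool.cond_eq_ite] at h
  split at h
  case isTrue h' => obtain rfl := Option.some.inj h; exact ⟨hc.sub h', .refl _ _⟩
  case isFalse =>
    split at h
    case isTrue h' => obtain rfl := Option.some.inj h; exact ⟨.refl _ _, hc.sub h'⟩
    case isFalse => cases h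

theorem inferSub {Δ : LCtx} {t T : Tm} (h : c.inferSub Δ t T = true) : Valid Δ (ty t T) := by
  unfold Checker.inferSub at h
  split at h
  case h_2 => cases h
  case h_1 h' => exact (hc.sub h).1 _ (hc.infer h')

theorem convSub {Δ : LCtx} {t u T : Tm} (h : c.convSub Δ t u T = true) : Valid Δ (eq t u T) := by
  unfold Checker.convSub at h
  split at h
  case h_2 => cases h
  case h_1 h' => exact (hc.sub h).2 _ _ (hc.conv h')

/-- The induction is over equal heads, so that reducing the head of an application is a chain of
congruences, one for each argument. -/
theorem typeArgs {Δ : LCtx} {as : List Tm} : ∀ {t u F T : Tm}, c.typeArgs Δ F as = some T →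
    Valid Δ (eq t u F) → Valid Δ (eq (as.foldl app t) (as.foldl app u) T) := by
  induction as with
  | nil => intro t u F T h htu; cases h; exact htu
  | cons a as ih =>
    intro t u F T h htu
    unfold Checker.typeArgs at h
    split at h
    case h_2 => cases h
    case h_1 h₁ =>
    rw [Bool.cond_eq_ite] at h
    split at h
    case isFalse => cases h
    case isTrue h₂ =>
    refine ih h ?_
    rw [← inst_eq_msubst]
    exact .eqApp ((hc.asPi h₁).1.2 _ _ htu) (.eqRefl (hc.check h₂))

theorem redHead {Δ : LCtx} {as : List Tm} {t u F v T : Tm} (h : c.redHead Δ u F as = some (v, T))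
    (htu : Valid Δ (eq t u F)) : Valid Δ (eq (as.foldl app t) v T) := by
  unfold Checker.redHead at h
  split at h
  case h_2 => cases h
  case h_1 h₁ => cases h; exact hc.typeArgs h₁ htu

/-- The invariant is that `t` equals the body `b` under the pending substitution `e`, and that this
body is strict for the binders still to be consumed. Each argument moves into `e`; when no binder is
left, the remaining arguments are merely typed. -/
theorem redBeta {Δ : LCtx} {as : List Tm} : ∀ {t b B u T : Tm} {e : List Tm},
    c.redBeta Δ as b B e = some (u, T) → ValidStrict (binders b B) Δ (msubst e 0 b) (msubst e 0 B) →
    Valid Δ (eq t (msubst e 0 b) (msubst e 0 B)) → Valid Δ (eq (as.foldl app t) u T) := by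
  induction as with
  | nil => intro t b B u T e h _ ht; cases h; exact ht
  | cons a as ih =>
    intro t b B u T e h hb ht
    unfold Checker.redBeta at h
    split at h
    · rw [Bool.cond_eq_ite] at h
      split at h
      case isFalse => cases h
      case isTrue A b B₁ B h₁ =>
      have h₂ := hb.beta (hc.check h₁)
      refine ih h ?_ ?_
      · rw [← msubst_cons b, ← msubst_cons B, ← inst_eq_msubst, ← inst_eq_msubst]
        exact h₂.1
      · rw [← msubst_cons b, ← msubst_cons B, ← inst_eq_msubst, ← inst_eq_msubst]
        exact (Valid.eqApp ht (.eqRefl h₂.2.2)).eqTrans h₂.2.1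
    · exact hc.redHead h ht

theorem redArg {Δ : LCtx} {f a u T : Tm} {as : List Tm} (h : c.redArg Δ f a as = some (u, T)) :
    Valid Δ (eq (as.foldl app (app f a)) u T) := by
  unfold Checker.redArg at h
  split at h
  case h_2 => cases h
  case h_1 h₁ =>
  split at h
  case h_2 => cases h
  case h_1 h₂ =>
  split at h
  case h_2 => cases h
  case h_1 h₃ =>
  rw [Bool.cond_eq_ite] at h
  split at h
  case isFalse => cases h
  case isTrue h₄ =>
  refine hc.redHead h ?_
  rw [← inst_eq_msubst]
  exact .eqApp (.eqRefl ((hc.asPi h₃).1.1 _ (hc.infer h₂))) ((hc.sub h₄).2 _ _ (hc.red h₁))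

theorem redConst {Δ : LCtx} {k : Const} {as : List Tm} {u T : Tm}
    (h : c.redConst Δ k as = some (u, T)) : Valid Δ (eq (capp k as) u T) := by
  unfold Checker.redConst at h
  split at h
  case h_2 => cases h
  case h_1 l a r hl =>
  have e : capp k as = r.foldl app (app (capp k l) a) := by
    rw [eq_of_splitLast hl]
    simp [capp]
  rw [e]
  split at h
  case h_1 hu =>
    split at h
    case h_2 => cases h
    case h_1 h₁ =>
    rw [Bool.cond_eq_ite] at h
    split at h
    case isFalse => cases h
    case isTrue h₂ =>
    refine hc.redHead h (.comp ?_ (hc.infer h₁) (hc.check h₂))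
    have := comp_of_compStep hu
    simpa [capp] using this
  case h_2 =>
    split at h
    · cases h
    · exact hc.redArg h

theorem convStruct {Δ : LCtx} {t u T : Tm} (h : c.convStruct Δ t u = some T) :
    Valid Δ (eq t u T) := by
  unfold Checker.convStruct at h
  split at h
  · split at h
    case h_2 => cases h
    case h_1 h₁ =>
    split at h
    case h_2 => cases h
    case h_1 h₂ =>
    rw [Bool.cond_eq_ite] at h
    split at h
    case isFalse => cases h
    case isTrue h₃ =>
    cases h
    rw [← inst_eq_msubst]
    exact .eqApp ((hc.asPi h₂).1.2 _ _ (hc.conv h₁)) (hc.convC h₃)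
  · split at h
    case h_2 => cases h
    case h_1 i h₁ =>
    split at h
    case h_2 => cases h
    case h_1 j h₂ =>
    split at h
    case h_2 => cases h
    case h_1 h₃ =>
    cases h
    exact .eqLam (i := max i j) ((Included.univ (le_max_left _ _)).1 _ (hc.sort h₁))
      ((Included.univ (le_max_right _ _)).2 _ _ (hc.convT h₂)) (hc.conv h₃)
  · split at h
    case h_2 => cases h
    case h_1 i h₁ =>
    split at h
    case h_2 => cases h
    case h_1 j h₂ =>
    split at h
    case h_2 => cases h
    case h_1 k h₃ =>
    cases h
    exact .eqPi ((Included.univ (by simp)).1 _ (hc.sort h₁))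
      ((Included.univ (by simp)).2 _ _ (hc.convT h₂))
      ((Included.univ (by simp)).2 _ _ (hc.convT h₃))
  · cases h

theorem step_inferC {Δ : LCtx} {t T : Tm} {e : List Tm} (h : c.step.inferC Δ t = some (T, e)) :
    ValidStrict (binders t (msubst e 0 T)) Δ t (msubst e 0 T) := by
  simp only [step] at h
  split at h
  · split at h
    · rename_i h₁
      cases h
      rw [msubst_nil, ← rename_add_eq_shift]
      exact fun Γ σ m => m.var.1 h₁
    · rename_i h₁
      cases h
      rw [msubst_nil, ← rename_add_eq_shift]
      exact fun Γ σ m => (m.var.2 h₁).2.derivable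
    · cases h
  · cases h; exact Valid.univ _
  · cases h; rw [msubst_nil]; exact Valid.con _
  · split at h
    case h_2 => cases h
    case h_1 h₁ =>
    split at h
    case h_2 => cases h
    case h_1 h₂ =>
    cases h
    exact Valid.pi ((Included.univ (le_max_left _ _)).1 _ (hc.sort h₁))
      ((Included.univ (le_max_right _ _)).1 _ (hc.sort h₂))
  · split at h
    case h_2 => cases h
    case h_1 h₁ =>
    split at h
    case h_2 => cases h
    case h_1 h₂ =>
    cases h
    rw [msubst_nil]
    exact .lam (hc.sort h₁) (hc.inferS h₂)
  · split at h
    · rename_i h₁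
      rw [Bool.cond_eq_ite] at h
      split at h
      case isFalse => cases h
      case isTrue h₂ =>
      cases h
      rw [← msubst_cons, ← inst_eq_msubst]
      exact Valid.app (hc.inferC h₁).valid (hc.check h₂)
    · rename_i h₁
      split at h
      case h_2 => cases h
      case h_1 h₂ =>
      rw [Bool.cond_eq_ite] at h
      split at h
      case isFalse => cases h
      case isTrue h₃ =>
      cases h
      rw [← inst_eq_msubst]
      exact Valid.app ((hc.asPi h₂).1.1 _ (hc.inferC h₁).valid) (hc.check h₃)
    · cases h

theorem step_check {Δ : LCtx} {t T : Tm} (h : c.step.check Δ t T = true) : Valid Δ (ty t T) := by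
  simp only [step] at h
  split at h
  · split at h
    case h_2 => cases h
    case h_1 h₁ =>
    rw [Bool.cond_eq_ite] at h
    split at h
    case isFalse => exact hc.inferSub h
    case isTrue h₂ =>
    split at h
    case h_2 => cases h
    case h_1 h₃ =>
    rw [← beq_iff.1 h₂] at h₁
    exact (hc.asPi h₁).2.1 _ (.lam (hc.sort h₃) (hc.check h))
  · exact hc.inferSub h

theorem step_conv {Δ : LCtx} {t u T : Tm} (h : c.step.conv Δ t u = some T) :
    Valid Δ (eq t u T) := by
  simp only [step] at h
  rw [Bool.cond_eq_ite] at h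
  split at h
  case isTrue h₁ => rw [beq_iff.1 h₁] at h ⊢; exact .eqRefl (hc.infer h)
  case isFalse =>
  split at h
  case h_1 h₁ =>
    split at h
    case h_2 => cases h
    case h_1 h₂ =>
      -- The reduction and the remaining conversion may return different universes, or types equal
      -- only up to conversion; both equations are moved to the larger type.
      have h₃ := hc.join h
      exact .eqTrans (h₃.1.2 _ _ (hc.red h₁)) (h₃.2.2 _ _ (hc.conv h₂))
  case h_2 =>
  split at h
  case h_1 h₁ =>
    split at h
    case h_2 => cases h
    case h_1 h₂ =>
      have h₃ := hc.join h
      exact .eqTrans (h₃.2.2 _ _ (hc.conv h₂)) (.eqSymm (h₃.1.2 _ _ (hc.red h₁)))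
  case h_2 => exact hc.convStruct h

theorem step_convC {Δ : LCtx} {t u T : Tm} (h : c.step.convC Δ t u T = true) :
    Valid Δ (eq t u T) := by
  simp only [step] at h
  rw [Bool.cond_eq_ite] at h
  split at h
  case isTrue h₁ => rw [beq_iff.1 h₁] at h ⊢; exact .eqRefl (hc.check h)
  case isFalse =>
  split at h
  · split at h
    case h_2 => cases h
    case h_1 h₁ =>
    rw [Bool.cond_eq_ite] at h
    split at h
    case isFalse => exact hc.convSub h
    case isTrue h₂ =>
    split at h
    case h_2 => cases h
    case h_1 i j h₃ h₄ =>
    rw [← beq_iff.1 h₂] at h₁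
    exact (hc.asPi h₁).2.2 _ _ (.eqLam (i := max i j)
      ((Included.univ (le_max_left _ _)).1 _ (hc.sort h₃))
      ((Included.univ (le_max_right _ _)).2 _ _ (hc.convT h₄)) (hc.convC h))
  · exact hc.convSub h

theorem step_red {Δ : LCtx} {t u T : Tm} (h : c.step.red Δ t = some (u, T)) :
    Valid Δ (eq t u T) := by
  simp only [step] at h
  have e := foldl_unspine t []
  simp only [List.foldl_nil] at e
  rw [← e]
  split at h
  · rename_i A b a as hs
    rw [hs]
    split at h
    case h_2 => cases h
    case h_1 h₁ =>
    split at h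
    case h_2 => cases h
    case h_1 B h₂ =>
    have h₃ : ValidStrict (binders (lam A b) (pi A B)) Δ (lam A b) (pi A B) :=
      .lam (hc.sort h₁) (hc.inferS h₂)
    refine hc.redBeta h ?_ ?_
    · rw [msubst_nil, msubst_nil]; exact h₃
    · rw [msubst_nil, msubst_nil]; exact .eqRefl h₃.valid
  · rename_i n as hs
    rw [hs]
    split at h
    case h_2 => cases h
    case h_1 v T h₁ =>
    have h₂ : ValidStrict (binders v T) Δ (shift (n + 1) 0 v) (shift (n + 1) 0 T) := by
      intro Γ σ m
      rw [← rename_add_eq_shift, ← rename_add_eq_shift]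
      have := m.var.2 h₁
      rw [← this.1]
      exact this.2
    refine hc.redBeta h ?_ ?_
    · rw [msubst_nil, msubst_nil, binders_shift]; exact h₂
    · rw [msubst_nil, msubst_nil]
      intro Γ σ m
      rw [Judgement.subst, ← rename_add_eq_shift, ← rename_add_eq_shift]
      have := m.var.2 h₁
      rw [← this.1]
      exact .eqRefl this.2.derivable
  · rename_i hs
    rw [hs]
    exact hc.redConst h
  · cases h

theorem step_asPi {Δ : LCtx} {T A B : Tm} (h : c.step.asPi Δ T = some (A, B)) :
    Included Δ T (pi A B) ∧ Included Δ (pi A B) T := by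
  simp only [step] at h
  split at h
  · cases h; exact ⟨.refl _ _, .refl _ _⟩
  · split at h
    case h_2 => cases h
    case h_1 h₁ =>
    split at h
    case h_2 => cases h
    case h_1 h₂ =>
    have h₃ := (hc.asUniv h₂).2 _ _ (hc.red h₁)
    exact ⟨(Included.of_eq h₃).trans (hc.asPi h).1, (hc.asPi h).2.trans (.of_eq h₃.eqSymm)⟩

theorem step_asUniv {Δ : LCtx} {T : Tm} {i : ℕ} (h : c.step.asUniv Δ T = some i) :
    Included Δ T (univ i) := by
  simp only [step] at h
  split at h
  · cases h; exact .refl _ _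
  · split at h
    case h_2 => cases h
    case h_1 h₁ =>
    split at h
    case h_2 => cases h
    case h_1 h₂ =>
    exact (Included.of_eq ((hc.asUniv h₂).2 _ _ (hc.red h₁))).trans (hc.asUniv h)

theorem step : Sound c.step :=
  ⟨hc.step_inferC, hc.step_check, hc.step_conv, hc.step_convC, hc.step_red, hc.step_asPi,
    hc.step_asUniv⟩

theorem checkDfn {v : Tm} : ∀ {Δ : LCtx} {T : Tm}, c.checkDfn Δ v T = true →
    ValidStrict (binders v T) Δ v T := by
  induction v with
  | lam A t _ ih =>
    intro Δ T h
    cases T with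
    | pi A' B =>
      simp only [Checker.checkDfn, Bool.and_eq_true, beq_iff] at h
      obtain ⟨⟨rfl, h₁⟩, h₂⟩ := h
      split at h₁
      case h_2 => cases h₁
      case h_1 h₃ => exact .lam (hc.sort h₃) (ih h₂)
    | _ => exact hc.check h
  | _ => intro Δ T h; exact hc.check h

end Sound

/-- At depth zero every function fails, so soundness is vacuous; exhausting the depth can only lead
to rejection. -/
theorem sound_ofDepth (n : ℕ) : Sound (ofDepth n) := by
  induction n with
  | zero => constructor <;> intros <;> contradiction
  | succ n ih => exact ih.step

end Checker

/-- Substitute the definitions of the context. -/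
def LCtx.sub : LCtx → ℕ → Tm
  | [] => var
  | .hyp _ :: Δ => upSub (LCtx.sub Δ)
  | .dfn v _ :: Δ => cons (v.subst (LCtx.sub Δ)) (LCtx.sub Δ)

/-- The variables of the context. -/
def LCtx.hyps : LCtx → Ctx
  | [] => []
  | .hyp T :: Δ => T.subst (LCtx.sub Δ) :: LCtx.hyps Δ
  | .dfn _ _ :: Δ => LCtx.hyps Δ

end HoTT

/-! ### Theorems of homotopy type theory -/

namespace HoTT

open Judgement Tm

/-- The closed term `t` has the closed type `A`, and the leading binders of `t` and `A` carry the
same types. -/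
structure HasType (t A : Sch) : Prop where
  closed_tm : closedAt 0 t.close = true
  closed : closedAt 0 A.close = true
  strict : Strict (binders t.close A.close) [] t.close A.close

/-- The closed type `A` is inhabited. -/
structure Inhabited (A : Sch) : Prop where
  closed : closedAt 0 A.close = true
  inh : ∃ t : Tm, Derivable [] (ty t A.close)

theorem HasType.inhabited {t A : Sch} (h : HasType t A) : Inhabited A :=
  ⟨h.closed, _, h.strict.derivable⟩

/-- The reason for which a context entry is valid. -/
inductive Reason : Type
  /-- a definition that has to be checked -/
  | checked
  /-- a definition that is already known to be well-typed -/
  | known {t A : Sch} (h : HasType t A)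
  /-- a variable for a proof of a theorem -/
  | used {A : Sch} (h : Inhabited A)
  /-- a variable -/
  | assumed

/-- A typing problem in a context with definitions. -/
structure Problem : Type where
  ctx : LCtx
  reasons : List Reason
  tm : Tm
  type : Tm

/-- A `Problem` as a function of the context in which it is stated. -/
abbrev Script : Type := ℕ → LCtx → List Reason → Problem

/-- Prove `t : T`. -/
def Prove (t T : Sch) : Script := fun n Δ L => ⟨Δ, L, t.toTm n, T.toTm n⟩

/-- Name the term `v : T`. -/
def Let (v T : Sch) (k : Sch → Script) : Script :=
  fun n Δ L => k (bvar n) (n + 1) (.dfn (v.toTm n) (T.toTm n) :: Δ) (.checked :: L)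

/-- Name the term `v`, whose type is known. -/
def Known {v T : Sch} (h : HasType v T) (k : Sch → Script) : Script :=
  fun n Δ L => k (bvar n) (n + 1) (.dfn v.close T.close :: Δ) (.known h :: L)

/-- Use a theorem. -/
def Use {A : Sch} (h : Inhabited A) (k : Sch → Script) : Script :=
  fun n Δ L => k (bvar n) (n + 1) (.hyp A.close :: Δ) (.used h :: L)

/-- Introduce a variable of type `T`. -/
def Assume (T : Sch) (k : Sch → Script) : Script :=
  fun n Δ L => k (bvar n) (n + 1) (.hyp (T.toTm n) :: Δ) (.assumed :: L)

/-- Are the entries of the context valid? -/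
def verify (c : Checker) : LCtx → List Reason → Bool
  | [], [] => true
  | .dfn v T :: Δ, .checked :: L => verify c Δ L && c.checkDfn Δ v T
  | .dfn v T :: Δ, .known (t := t) (A := A) _ :: L =>
    verify c Δ L && (beq v t.close && beq T A.close)
  | .hyp T :: Δ, .used (A := A) _ :: L => verify c Δ L && beq T A.close
  | .hyp _ :: Δ, .assumed :: L => verify c Δ L
  | _, _ => false

def Reason.isAssumed : Reason → Bool
  | .assumed => true
  | _ => false

def Reason.isUsed : Reason → Bool
  | .used _ => true
  | _ => false

theorem HasType.strict_subst {t A : Sch} (h : HasType t A) (Γ : Ctx) (σ : ℕ → Tm) :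
    Strict (binders t.close A.close) Γ (t.close.subst σ) (A.close.subst σ) :=
  h.strict.subst fun n B hn => by cases hn

/-- A variable that stands for a proved theorem is instantiated by some closed proof of it, which is
never inspected. This is why `Inhabited` only asserts the existence of a term. -/
theorem exists_models {c : Checker} (hc : c.Sound) {Δ : LCtx} {L : List Reason} :
    verify c Δ L = true → L.all (fun r => !r.isAssumed) = true → ∃ σ, Models Δ [] σ := by
  fun_induction verify c Δ L with
  | case1 => exact fun _ _ => ⟨_, .nil⟩
  | case2 v T Δ L ih =>
    intro h h'
    simp only [Bool.and_eq_true] at h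
    obtain ⟨σ, m⟩ := ih h.1 (by simpa [Reason.isAssumed] using h')
    exact ⟨_, .dfn m (hc.checkDfn h.2 m)⟩
  | case3 v T Δ t A hA L ih =>
    intro h h'
    simp only [Bool.and_eq_true, beq_iff] at h
    obtain ⟨σ, m⟩ := ih h.1 (by simpa [Reason.isAssumed] using h')
    obtain ⟨-, rfl, rfl⟩ := h
    exact ⟨_, .dfn m (hA.strict_subst _ _)⟩
  | case4 T Δ A hA L ih =>
    intro h h'
    simp only [Bool.and_eq_true, beq_iff] at h
    obtain ⟨σ, m⟩ := ih h.1 (by simpa [Reason.isAssumed] using h')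
    obtain ⟨-, rfl⟩ := h
    obtain ⟨t, ht⟩ := hA.inh
    exact ⟨_, .inst m (by rwa [subst_of_closed hA.closed])⟩
  | case5 T Δ L ih => intro _ h; simp [Reason.isAssumed] at h
  | case6 => intro h; cases h

/-- Without used theorems nothing has to be instantiated: assumed variables remain variables and
only definitions are unfolded, so the resulting term is known explicitly. -/
theorem models_sub {c : Checker} (hc : c.Sound) {Δ : LCtx} {L : List Reason} :
    verify c Δ L = true → L.all (fun r => !r.isUsed) = true → Models Δ Δ.hyps Δ.sub := by
  fun_induction verify c Δ L with
  | case1 => exact fun _ _ => .nil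
  | case2 v T Δ L ih =>
    intro h h'
    simp only [Bool.and_eq_true] at h
    have m := ih h.1 (by simpa [Reason.isUsed] using h')
    exact .dfn m (hc.checkDfn h.2 m)
  | case3 v T Δ t A hA L ih =>
    intro h h'
    simp only [Bool.and_eq_true, beq_iff] at h
    have m := ih h.1 (by simpa [Reason.isUsed] using h')
    obtain ⟨-, rfl, rfl⟩ := h
    exact .dfn m (hA.strict_subst _ _)
  | case4 T Δ A hA L ih => intro _ h; simp [Reason.isUsed] at h
  | case5 T Δ L ih => exact fun h h' => .hyp T (ih h (by simpa [Reason.isUsed] using h'))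
  | case6 => intro h; cases h

/-- Does `Δ` declare the variables of `Γ`, and nothing else? -/
def LCtx.isCtx : LCtx → Ctx → Bool
  | [], [] => true
  | .hyp T :: Δ, A :: Γ => beq T A && isCtx Δ Γ
  | _, _ => false

/-- Does `Δ` declare the variables of `Γ`, followed by definitions? -/
def LCtx.extends : LCtx → Ctx → Bool
  | .dfn _ _ :: Δ, Γ => LCtx.extends Δ Γ
  | Δ, Γ => Δ.isCtx Γ

/-- Unfold the definitions at the end of `Δ`. -/
def LCtx.unfold : LCtx → Tm → Tm
  | .dfn v _ :: Δ, t => LCtx.unfold Δ (msubst [v] 0 t)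
  | _, t => t

theorem LCtx.sub_of_isCtx : ∀ {Δ : LCtx} {Γ : Ctx}, Δ.isCtx Γ = true → Δ.sub = var ∧ Δ.hyps = Γ
  | [], [], _ => ⟨rfl, rfl⟩
  | .hyp T :: Δ, A :: Γ, h => by
    simp only [LCtx.isCtx, Bool.and_eq_true, beq_iff] at h
    obtain ⟨h₁, h₂⟩ := LCtx.sub_of_isCtx h.2
    rw [LCtx.sub, LCtx.hyps, h₁, h₂, h.1, subst_id, upSub_id]
    exact ⟨rfl, rfl⟩
  | [], _ :: _, h => by cases h
  | .hyp _ :: _, [], h => by cases h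
  | .dfn _ _ :: _, _, h => by simp [LCtx.isCtx] at h

/-- All definitions come after the declared variables, so removing them one at a time, the last one
first, ends in the context `Γ` itself. -/
theorem LCtx.sub_of_extends : ∀ {Δ : LCtx} {Γ : Ctx}, Δ.extends Γ = true →
    (∀ t, Δ.unfold t = t.subst Δ.sub) ∧ Δ.hyps = Γ
  | .dfn v T :: Δ, Γ, h => by
    obtain ⟨h₁, h₂⟩ := LCtx.sub_of_extends (Δ := Δ) h
    refine ⟨fun t => ?_, h₂⟩
    rw [LCtx.unfold, h₁, ← inst_eq_msubst, subst_inst, inst_subst_upSub]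
    rfl
  | [], Γ, h => by
    obtain ⟨h₁, h₂⟩ := LCtx.sub_of_isCtx (Δ := []) h
    exact ⟨fun t => by rw [h₁, subst_id]; rfl, h₂⟩
  | .hyp T :: Δ, Γ, h => by
    obtain ⟨h₁, h₂⟩ := LCtx.sub_of_isCtx (Δ := .hyp T :: Δ) h
    exact ⟨fun t => by rw [h₁, subst_id]; rfl, h₂⟩

/-! ### From accepted scripts to derivations -/

namespace Script

/-- Check a script that proves `A`. -/
def check (s : Script) (A : Sch) : Bool :=
  match s 0 [] [] with
  | ⟨Δ, L, t, T⟩ => closedAt 0 A.close && (beq T A.close && (L.all (fun r => !r.isAssumed) &&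
      (verify (.ofDepth 10000) Δ L && (Checker.ofDepth 10000).check Δ t T)))

/-- Check that a script in the context `Γ` defines the term `t` of type `A`. -/
def checkTm (s : Script) (Γ : Ctx) (t A : Tm) : Bool :=
  match s 0 [] [] with
  | ⟨Δ, L, u, T⟩ => L.all (fun r => !r.isUsed) && (verify (.ofDepth 10000) Δ L &&
      ((Checker.ofDepth 10000).checkDfn Δ u T && (Δ.extends Γ && (beq (Δ.unfold u) t &&
        (beq (Δ.unfold T) A && Nat.beq (binders u T) (binders t A))))))

/-- Check that a script in the context `Γ` proves `A`. -/
def checkIn (s : Script) (Γ : Ctx) (A : Tm) : Bool :=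
  match s 0 [] [] with
  | ⟨Δ, L, u, T⟩ => L.all (fun r => !r.isUsed) && (verify (.ofDepth 10000) Δ L &&
      ((Checker.ofDepth 10000).check Δ u T && (Δ.extends Γ && beq (Δ.unfold T) A)))

end Script

theorem Inhabited.of_check (s : Script) {A : Sch} (h : s.check A = true) : Inhabited A := by
  unfold Script.check at h
  split at h
  rename_i Δ L t T _
  simp only [Bool.and_eq_true, beq_iff] at h
  obtain ⟨h₁, rfl, h₂, h₃, h₄⟩ := h
  have hc := Checker.sound_ofDepth 10000
  obtain ⟨σ, m⟩ := exists_models hc h₃ h₂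
  have := hc.check h₄ m
  rw [Judgement.subst, subst_of_closed h₁] at this
  exact ⟨h₁, _, this⟩

/-- Needed where the proof term is prescribed: the local definitions of the script keep checking
feasible, and after unfolding, the result must be `t` literally, with the same number of strict
binders. -/
theorem strict_of_checkTm (s : Script) {Γ : Ctx} {t A : Tm} (h : s.checkTm Γ t A = true) :
    Strict (binders t A) Γ t A := by
  unfold Script.checkTm at h
  split at h
  rename_i Δ L u T _
  simp only [Bool.and_eq_true, beq_iff, natBeq_iff] at h
  obtain ⟨h₁, h₂, h₃, h₄, rfl, rfl, h₅⟩ := h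
  obtain ⟨h₆, rfl⟩ := LCtx.sub_of_extends h₄
  rw [← h₅, h₆, h₆]
  have hc := Checker.sound_ofDepth 10000
  exact hc.checkDfn h₃ (models_sub hc h₂ h₁)

theorem exists_of_checkIn (s : Script) {Γ : Ctx} {A : Tm} (h : s.checkIn Γ A = true) :
    ∃ t, Derivable Γ (ty t A) := by
  unfold Script.checkIn at h
  split at h
  rename_i Δ L u T _
  simp only [Bool.and_eq_true, beq_iff] at h
  obtain ⟨h₁, h₂, h₃, h₄, rfl⟩ := h
  obtain ⟨h₅, rfl⟩ := LCtx.sub_of_extends h₄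
  have hc := Checker.sound_ofDepth 10000
  have := hc.check h₃ (models_sub hc h₂ h₁)
  rw [h₅]
  exact ⟨_, this⟩

theorem HasType.of_check (s : Script) {t A : Sch}
    (h : (closedAt 0 t.close && (closedAt 0 A.close && s.checkTm [] t.close A.close)) = true) :
    HasType t A := by
  simp only [Bool.and_eq_true] at h
  exact ⟨h.1, h.2.1, strict_of_checkTm s h.2.2⟩

end HoTT

namespace HoTT

/-! ### Logic -/

/-- `∃ (x : A). B x` for a family `B`. -/
def Exists' (A B : Sch) : Sch := TruncT 0 (K (.sig 0) ⬝ A ⬝ B)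

def exElimT : Sch :=
  PiT (U 0) fun A => PiT (A ⇒ U 0) fun B => PiT (U 0) fun C => isProp 0 C ⇒
    (PiT A fun a => (B ⬝ a) ⇒ C) ⇒ Exists' A B ⇒ C

def exElimS : Script := Prove
    (Lam (U 0) fun A => Lam (A ⇒ U 0) fun B => Lam (U 0) fun C => Lam (isProp 0 C) fun h =>
      Lam (PiT A fun a => (B ⬝ a) ⇒ C) fun t => Lam (Exists' A B) fun e =>
      K (.truncElim 0 0) ⬝ (K (.sig 0) ⬝ A ⬝ B) ⬝ (Lam (Exists' A B) fun _ => C) ⬝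
        (Lam (Exists' A B) fun _ => h) ⬝
        (Lam (K (.sig 0) ⬝ A ⬝ B) fun w =>
          t ⬝ (K (.fst 0) ⬝ A ⬝ B ⬝ w) ⬝ (K (.snd 0) ⬝ A ⬝ B ⬝ w)) ⬝ e)
    exElimT
theorem exElim : Inhabited exElimT := .of_check exElimS (by decide +kernel)

def exIntroT : Sch :=
  PiT (U 0) fun A => PiT (A ⇒ U 0) fun B => PiT A fun a => (B ⬝ a) ⇒ Exists' A B
def exIntroS : Script := Prove
    (Lam (U 0) fun A => Lam (A ⇒ U 0) fun B => Lam A fun a => Lam (B ⬝ a) fun b =>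
      K (.tr 0) ⬝ (K (.sig 0) ⬝ A ⬝ B) ⬝ (K (.pair 0) ⬝ A ⬝ B ⬝ a ⬝ b))
    exIntroT
theorem exIntro : Inhabited exIntroT := .of_check exIntroS (by decide +kernel)

def sumRecT : Sch :=
  PiT (U 0) fun A => PiT (U 0) fun B => PiT (U 0) fun C => (A ⇒ C) ⇒ (B ⇒ C) ⇒ SumT 0 A B ⇒ C
def sumRecS : Script := Prove
    (Lam (U 0) fun A => Lam (U 0) fun B => Lam (U 0) fun C => Lam (A ⇒ C) fun f =>
      Lam (B ⇒ C) fun g => Lam (SumT 0 A B) fun x =>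
      K (.sumElim 0 0) ⬝ A ⬝ B ⬝ (Lam (SumT 0 A B) fun _ => C) ⬝ f ⬝ g ⬝ x)
    sumRecT
theorem sumRec : Inhabited sumRecT := .of_check sumRecS (by decide +kernel)

def emptyRecT : Sch := PiT (U 0) fun C => EmptyT ⇒ C
def emptyRecS : Script := Prove
    (Lam (U 0) fun C => Lam EmptyT fun x => K (.emptyElim 0) ⬝ (Lam EmptyT fun _ => C) ⬝ x) emptyRecT
theorem emptyRec : Inhabited emptyRecT := .of_check emptyRecS (by decide +kernel)

def emptyPropT : Sch := isProp 0 EmptyT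
def emptyPropS : Script := Prove
    (Lam EmptyT fun x => Lam EmptyT fun y =>
      K (.emptyElim 0) ⬝ (Lam EmptyT fun _ => IdT 0 EmptyT x y) ⬝ x) emptyPropT
theorem emptyProp : Inhabited emptyPropT := .of_check emptyPropS (by decide +kernel)

def transportT (i j : ℕ) : Sch :=
  PiT (U i) fun A => PiT (A ⇒ U j) fun P => PiT A fun x => PiT A fun y => IdT i A x y ⇒
    (P ⬝ x) ⇒ P ⬝ y
def transportS (i j : ℕ) : Script := Prove
    (Lam (U i) fun A => Lam (A ⇒ U j) fun P => Lam A fun x => Lam A fun y => Lam (IdT i A x y) fun e =>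
      Lam (P ⬝ x) fun u => Transport i j A (fun y => P ⬝ y) x y e u)
    (transportT i j)
theorem transport : Inhabited (transportT 0 0) := .of_check (transportS 0 0) (by decide +kernel)

def symmT : Sch := PiT (U 0) fun A => PiT A fun x => PiT A fun y => IdT 0 A x y ⇒ IdT 0 A y x
def symmS : Script := Prove
    (Lam (U 0) fun A => Lam A fun x => Lam A fun y => Lam (IdT 0 A x y) fun e => SymP 0 A x y e) symmT
theorem symm : Inhabited symmT := .of_check symmS (by decide +kernel)

def piPropT : Sch :=
  PiT (U 0) fun A => PiT (A ⇒ U 0) fun B => (PiT A fun x => isProp 0 (B ⬝ x)) ⇒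
    isProp 0 (PiT A fun x => B ⬝ x)
def piPropS : Script := Prove
    (Lam (U 0) fun A => Lam (A ⇒ U 0) fun B => Lam (PiT A fun x => isProp 0 (B ⬝ x)) fun h =>
      Lam (PiT A fun x => B ⬝ x) fun f => Lam (PiT A fun x => B ⬝ x) fun g =>
      K (.funext 0) ⬝ A ⬝ B ⬝ f ⬝ g ⬝ Lam A fun x => h ⬝ x ⬝ (f ⬝ x) ⬝ (g ⬝ x))
    piPropT
theorem piProp : Inhabited piPropT := .of_check piPropS (by decide +kernel)

def decPropT : Sch := PiT (U 0) fun A => isProp 0 A ⇒ isProp 0 (Dec A)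
-- Two positive answers agree since `A` is a proposition, two negative ones by function
-- extensionality, and mixed answers are contradictory.
def decPropS : Script :=
  Use piProp fun piProp => Use emptyProp fun emptyProp => Use emptyRec fun emptyRec =>
  Prove
    (Lam (U 0) fun A => Lam (isProp 0 A) fun h => Lam (Dec A) fun u => Lam (Dec A) fun v =>
      K (.sumElim 0 0) ⬝ A ⬝ NotT A ⬝ (Lam (Dec A) fun u => IdT 0 (Dec A) u v) ⬝
        (Lam A fun a => K (.sumElim 0 0) ⬝ A ⬝ NotT A ⬝
          (Lam (Dec A) fun v => IdT 0 (Dec A) (K (.inl 0) ⬝ A ⬝ NotT A ⬝ a) v) ⬝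
          (Lam A fun b => Ap 0 A (Dec A) (fun z => K (.inl 0) ⬝ A ⬝ NotT A ⬝ z) a b (h ⬝ a ⬝ b)) ⬝
          (Lam (NotT A) fun n => emptyRec ⬝
            (IdT 0 (Dec A) (K (.inl 0) ⬝ A ⬝ NotT A ⬝ a) (K (.inr 0) ⬝ A ⬝ NotT A ⬝ n)) ⬝ (n ⬝ a)) ⬝
          v) ⬝
        (Lam (NotT A) fun n => K (.sumElim 0 0) ⬝ A ⬝ NotT A ⬝
          (Lam (Dec A) fun v => IdT 0 (Dec A) (K (.inr 0) ⬝ A ⬝ NotT A ⬝ n) v) ⬝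
          (Lam A fun a => emptyRec ⬝
            (IdT 0 (Dec A) (K (.inr 0) ⬝ A ⬝ NotT A ⬝ n) (K (.inl 0) ⬝ A ⬝ NotT A ⬝ a)) ⬝ (n ⬝ a)) ⬝
          (Lam (NotT A) fun m =>
            Ap 0 (NotT A) (Dec A) (fun z => K (.inr 0) ⬝ A ⬝ NotT A ⬝ z) n m
              (piProp ⬝ A ⬝ (Lam A fun _ => EmptyT) ⬝ (Lam A fun _ => emptyProp) ⬝ n ⬝ m)) ⬝
          v) ⬝ u)
    decPropT
theorem decProp : Inhabited decPropT := .of_check decPropS (by decide +kernel)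

def setOfConstantT (i : ℕ) : Sch :=
  PiT (U i) fun A => PiT (PiT A fun x => PiT A fun y => IdT i A x y ⇒ IdT i A x y) fun φ =>
  (PiT A fun x => PiT A fun y => PiT (IdT i A x y) fun p => PiT (IdT i A x y) fun q =>
    IdT i (IdT i A x y) (φ ⬝ x ⬝ y ⬝ p) (φ ⬝ x ⬝ y ⬝ q)) ⇒ isSet i A
-- This is Hedberg's argument. Path induction gives `p = (φ refl)⁻¹ · φ p` for every path `p`; if
-- `φ` is constant, the right-hand side does not depend on `p`. Level 0 serves propositions and
-- upper bounds of a tree, level 1 the type of all propositions.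
theorem hasType_setOfConstant₀ : HasType (setOfConstant 0) (setOfConstantT 0) :=
  .of_check (Prove (setOfConstant 0) (setOfConstantT 0)) (by decide +kernel)
theorem hasType_setOfConstant₁ : HasType (setOfConstant 1) (setOfConstantT 1) :=
  .of_check (Prove (setOfConstant 1) (setOfConstantT 1)) (by decide +kernel)

theorem hasType_unitProp : HasType (unitProp 0) (isProp 0 UnitT) :=
  .of_check (Prove (unitProp 0) (isProp 0 UnitT)) (by decide +kernel)

def propIsSetT : Sch := PiT (U 0) fun A => isProp 0 A ⇒ isSet 0 A
def propIsSetS : Script :=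
  Use hasType_setOfConstant₀.inhabited fun soc => Prove
    (Lam (U 0) fun A => Lam (isProp 0 A) fun h => soc ⬝ A ⬝
      (Lam A fun x => Lam A fun y => Lam (IdT 0 A x y) fun _ => h ⬝ x ⬝ y) ⬝
      (Lam A fun x => Lam A fun y => Lam (IdT 0 A x y) fun _ => Lam (IdT 0 A x y) fun _ =>
        Refl 0 (IdT 0 A x y) (h ⬝ x ⬝ y))) propIsSetT
theorem propIsSet : Inhabited propIsSetT := .of_check propIsSetS (by decide +kernel)

/-! ### Booleans and natural numbers -/

def ffNeTtT : Sch := IdT 0 BoolT FF TT ⇒ EmptyT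
-- Transport of `Star` in the family that is `𝟏` at `ff` and `𝟎` at `tt`; its definition is an
-- elimination into a universe, hence level 1.
def ffNeTtS : Script := Use transport fun tp => Prove
    (Lam (IdT 0 BoolT FF TT) fun e =>
      tp ⬝ BoolT ⬝ (Lam BoolT fun b => K (.boolElim 1) ⬝ (Lam BoolT fun _ => U 0) ⬝ UnitT ⬝ EmptyT ⬝ b) ⬝
        FF ⬝ TT ⬝ e ⬝ Star) ffNeTtT
theorem ffNeTt : Inhabited ffNeTtT := .of_check ffNeTtS (by decide +kernel)

/-- A case distinction that remembers the equation for `b`, as needed when `b` is a value of a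
sequence. -/
def boolCasesT : Sch :=
  PiT BoolT fun b => PiT (U 0) fun C => (IdT 0 BoolT b FF ⇒ C) ⇒ (IdT 0 BoolT b TT ⇒ C) ⇒ C
def boolCasesS : Script := Prove
    (Lam BoolT fun b => Lam (U 0) fun C => K (.boolElim 0) ⬝
      (Lam BoolT fun b => (IdT 0 BoolT b FF ⇒ C) ⇒ (IdT 0 BoolT b TT ⇒ C) ⇒ C) ⬝
      (Lam (IdT 0 BoolT FF FF ⇒ C) fun f => Lam (IdT 0 BoolT FF TT ⇒ C) fun _ => f ⬝ Refl 0 BoolT FF) ⬝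
      (Lam (IdT 0 BoolT TT FF ⇒ C) fun _ => Lam (IdT 0 BoolT TT TT ⇒ C) fun g => g ⬝ Refl 0 BoolT TT) ⬝
      b) boolCasesT
theorem boolCases : Inhabited boolCasesT := .of_check boolCasesS (by decide +kernel)

end HoTT

namespace HoTT

/-! ### Induction for Brouwer trees -/

/-- The induction principle for families of propositions over trees. -/
def brwIndT : Sch :=
  PiT (Brw ⇒ U 0) fun P => (PiT Brw fun x => isProp 0 (P ⬝ x)) ⇒ (P ⬝ BZero) ⇒
    (PiT Brw fun x => (P ⬝ x) ⇒ P ⬝ BSucc x) ⇒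
    (PiT (NatT ⇒ Brw) fun f => PiT (Increasing f) fun p =>
      (PiT NatT fun k => P ⬝ (f ⬝ k)) ⇒ P ⬝ Limit f p) ⇒
    PiT Brw fun x => P ⬝ x

/-- The family over the order is taken to be constantly `𝟏`, so the methods for the order are
trivial. Since `P` consists of propositions, the method for `bisim` holds by proof irrelevance. -/
def brwIndS : Script :=
  Use propIsSet fun propIsSet => Use hasType_unitProp.inhabited fun unitProp =>
  Let (Lam (Brw ⇒ U 0) fun A => Lam Brw fun x => Lam Brw fun y => Lam (A ⬝ x) fun _ =>
      Lam (A ⬝ y) fun _ => Lam (Le x y) fun _ => UnitT)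
    (PiT (Brw ⇒ U 0) fun A => PiT Brw fun x => PiT Brw fun y => (A ⬝ x) ⇒ (A ⬝ y) ⇒
      Le x y ⇒ U 0) fun B' =>
  Prove (
    Lam (Brw ⇒ U 0) fun A => Lam (PiT Brw fun x => isProp 0 (A ⬝ x)) fun hP =>
    Lam (A ⬝ BZero) fun z => Lam (PiT Brw fun x => (A ⬝ x) ⇒ A ⬝ BSucc x) fun ms =>
    Lam (PiT (NatT ⇒ Brw) fun f => PiT (Increasing f) fun p =>
      (PiT NatT fun k => A ⬝ (f ⬝ k)) ⇒ A ⬝ Limit f p) fun l => Lam Brw fun x =>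
    let B := B' ⬝ A
    let ml := LamSeq A B ms fun f p F _ => l ⬝ f ⬝ p ⬝ F
    KApp (.brwElim 0) [A, B,
      Lam Brw fun x => propIsSet ⬝ (A ⬝ x) ⬝ (hP ⬝ x),
      Lam Brw fun x => Lam Brw fun y => Lam (A ⬝ x) fun _ => Lam (A ⬝ y) fun _ =>
        Lam (Le x y) fun _ => unitProp,
      z, ms, ml,
      LamSeq A B ms fun f p F P => LamSeq A B ms fun g q G Q =>
        Lam (Simulated f g) fun s => Lam (Simulated g f) fun t =>
        Lam (SimulatedOver 0 B f F g G) fun _ => Lam (SimulatedOver 0 B g G f F) fun _ =>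
        hP ⬝ (Limit g q) ⬝
          (Transport 0 0 Brw (fun x => A ⬝ x) (Limit f p) (Limit g q)
            (K .bisim ⬝ f ⬝ p ⬝ g ⬝ q ⬝ s ⬝ t) (ml ⬝ f ⬝ p ⬝ F ⬝ P)) ⬝
          (ml ⬝ g ⬝ q ⬝ G ⬝ Q),
      Lam Brw fun x => Lam (A ⬝ x) fun _ => Star,
      Lam Brw fun x => Lam Brw fun y => Lam Brw fun z =>
        Lam (A ⬝ x) fun _ => Lam (A ⬝ y) fun _ => Lam (A ⬝ z) fun _ =>
        Lam (Le x y) fun _ => Lam (Le y z) fun _ => Lam UnitT fun _ => Lam UnitT fun _ => Star,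
      Lam Brw fun x => Lam Brw fun y => Lam (A ⬝ x) fun _ => Lam (A ⬝ y) fun _ =>
        Lam (Le x y) fun _ => Lam UnitT fun _ => Star,
      LamSeq A B ms fun f _ _ _ => Lam Brw fun x => Lam (A ⬝ x) fun _ => Lam NatT fun k =>
        Lam (Le x (f ⬝ k)) fun _ => Lam UnitT fun _ => Star,
      LamSeq A B ms fun f _ _ _ => Lam Brw fun x => Lam (A ⬝ x) fun _ =>
        Lam (PiT NatT fun k => Le (f ⬝ k) x) fun _ => Lam (NatT ⇒ UnitT) fun _ => Star, x]) brwIndT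
theorem brwInd : Inhabited brwIndT := .of_check brwIndS (by decide +kernel)

/-- Proof of `(x : Brw) → P x` by induction. -/
def Ind (brwInd : Sch) (P : Sch → Sch) (hP : Sch → Sch) (z : Sch) (s : Sch → Sch → Sch)
    (l : Sch → Sch → Sch → Sch) : Sch :=
  brwInd ⬝ Lam Brw P ⬝ Lam Brw hP ⬝ z ⬝ (Lam Brw fun x => Lam (P x) fun h => s x h) ⬝
    (Lam (NatT ⇒ Brw) fun f => Lam (Increasing f) fun p => Lam (PiT NatT fun k => P (f ⬝ k)) fun F =>
      l f p F)

/-! ### Elementary facts about the order -/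

def leReflT : Sch := PiT Brw fun x => Le x x
def leReflS : Script :=
  Use brwInd fun brwInd => Prove
    (Ind brwInd (fun x => Le x x) (fun x => K .leProp ⬝ x ⬝ x) (K .leZero ⬝ BZero)
      (fun x h => K .leSuccMono ⬝ x ⬝ x ⬝ h)
      (fun f p F => K .leLimiting ⬝ f ⬝ p ⬝ Limit f p ⬝
        Lam NatT fun k => K .leCocone ⬝ f ⬝ p ⬝ (f ⬝ k) ⬝ k ⬝ (F ⬝ k))) leReflT
theorem le_refl : Inhabited leReflT := .of_check leReflS (by decide +kernel)

/-- Transitivity of the order. -/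
def LeTrans (x y z h h' : Sch) : Sch := K .leTrans ⬝ x ⬝ y ⬝ z ⬝ h ⬝ h'

def leLimitT : Sch :=
  PiT (NatT ⇒ Brw) fun f => PiT (Increasing f) fun p => PiT NatT fun k => Le (f ⬝ k) (Limit f p)
def leLimitS : Script :=
  Use le_refl fun leRefl => Prove
    (Lam (NatT ⇒ Brw) fun f => Lam (Increasing f) fun p => Lam NatT fun k =>
      K .leCocone ⬝ f ⬝ p ⬝ (f ⬝ k) ⬝ k ⬝ (leRefl ⬝ (f ⬝ k))) leLimitT
theorem le_limit : Inhabited leLimitT := .of_check leLimitS (by decide +kernel)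

def leSuccT : Sch := PiT Brw fun x => Le x (BSucc x)
def leSuccS : Script :=
  Use brwInd fun brwInd => Use le_limit fun leLimit => Prove
    (Ind brwInd (fun x => Le x (BSucc x)) (fun x => K .leProp ⬝ x ⬝ BSucc x)
      (K .leZero ⬝ BSucc BZero)
      (fun x h => K .leSuccMono ⬝ x ⬝ BSucc x ⬝ h)
      (fun f p F => K .leLimiting ⬝ f ⬝ p ⬝ BSucc (Limit f p) ⬝
        Lam NatT fun k => LeTrans (f ⬝ k) (BSucc (f ⬝ k)) (BSucc (Limit f p)) (F ⬝ k)
          (K .leSuccMono ⬝ (f ⬝ k) ⬝ Limit f p ⬝ (leLimit ⬝ f ⬝ p ⬝ k)))) leSuccT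
theorem le_succ : Inhabited leSuccT := .of_check leSuccS (by decide +kernel)

def leOfEqT : Sch := PiT Brw fun x => PiT Brw fun y => IdT 0 Brw x y ⇒ Le x y
def leOfEqS : Script :=
  Use le_refl fun leRefl => Use transport fun transport => Prove
    (Lam Brw fun x => Lam Brw fun y => Lam (IdT 0 Brw x y) fun e =>
      transport ⬝ Brw ⬝ (Lam Brw fun z => Le x z) ⬝ x ⬝ y ⬝ e ⬝ (leRefl ⬝ x)) leOfEqT
theorem le_of_eq : Inhabited leOfEqT := .of_check leOfEqS (by decide +kernel)

/-! ### Propositional extensionality -/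

/-- The type of propositions in the universe `U 0`. -/
def HProp : Sch := Sig 1 (U 0) fun A => isProp 0 A

def mkHProp (A h : Sch) : Sch := Pair 1 (U 0) (fun A => isProp 0 A) A h

/-- The underlying type of a proposition. -/
def El (a : Sch) : Sch := Fst 1 (U 0) (fun A => isProp 0 A) a

def elProp (a : Sch) : Sch := Snd 1 (U 0) (fun A => isProp 0 A) a

def eqOfIffT : Sch :=
  PiT (U 0) fun A => PiT (U 0) fun B => isProp 0 A ⇒ isProp 0 B ⇒ (A ⇒ B) ⇒ (B ⇒ A) ⇒
    IdT 1 (U 0) A B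
-- Two implications between propositions form an equivalence, both inverse laws being equations in
-- propositions; the right inverse supplied by univalence turns it into a path.
def eqOfIffS : Script := Prove
    (Lam (U 0) fun A => Lam (U 0) fun B => Lam (isProp 0 A) fun hA => Lam (isProp 0 B) fun hB =>
      Lam (A ⇒ B) fun f => Lam (B ⇒ A) fun g =>
      let I := IdT 1 (U 0) A B
      let E := EquivT 0 A B
      let R : Sch → Sch := fun g => PiT E fun b => IdT 1 E (idToEquiv 0 A B ⬝ (g ⬝ b)) b
      let S : Sch → Sch := fun h => PiT I fun a => IdT 1 I (h ⬝ (idToEquiv 0 A B ⬝ a)) a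
      let rinv : Sch → Sch := fun g => PiT B fun b => IdT 0 B (f ⬝ (g ⬝ b)) b
      let linv : Sch → Sch := fun g => PiT A fun a => IdT 0 A (g ⬝ (f ⬝ a)) a
      Fst 1 (E ⇒ I) R (Fst 1 (Sig 1 (E ⇒ I) R) (fun _ => Sig 1 (E ⇒ I) S) (K (.ua 0) ⬝ A ⬝ B)) ⬝
        Pair 0 (A ⇒ B) (isEquiv 0 A B) f
          (Pair 0 (Sig 0 (B ⇒ A) rinv) (fun _ => Sig 0 (B ⇒ A) linv)
            (Pair 0 (B ⇒ A) rinv g (Lam B fun b => hB ⬝ (f ⬝ (g ⬝ b)) ⬝ b))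
            (Pair 0 (B ⇒ A) linv g (Lam A fun a => hA ⬝ (g ⬝ (f ⬝ a)) ⬝ a))))
    eqOfIffT
theorem eqOfIff : Inhabited eqOfIffT := .of_check eqOfIffS (by decide +kernel)

def isPropPropT : Sch := PiT (U 0) fun A => isProp 0 (isProp 0 A)
-- A proposition is a set, so its identity types are propositions, and products of propositions are
-- propositions.
def isPropPropS : Script :=
  Use piProp fun piProp => Use propIsSet fun propIsSet => Prove
    (Lam (U 0) fun A => Lam (isProp 0 A) fun h => Lam (isProp 0 A) fun h' =>
      piProp ⬝ A ⬝ (Lam A fun x => PiT A fun y => IdT 0 A x y) ⬝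
        (Lam A fun x => piProp ⬝ A ⬝ (Lam A fun y => IdT 0 A x y) ⬝
          (Lam A fun y => propIsSet ⬝ A ⬝ h ⬝ x ⬝ y)) ⬝ h ⬝ h') isPropPropT
theorem isPropProp : Inhabited isPropPropT := .of_check isPropPropS (by decide +kernel)

def propExtT : Sch :=
  PiT HProp fun a => PiT HProp fun b => (El a ⇒ El b) ⇒ (El b ⇒ El a) ⇒ IdT 1 HProp a b
-- Path induction on the equality of the underlying types leaves two proofs of the same `isProp`,
-- which agree.
def propExtS : Script :=
  Use eqOfIff fun eqOfIff => Use isPropProp fun isPropProp => Prove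
    (Lam HProp fun a => Lam HProp fun b => Lam (El a ⇒ El b) fun f => Lam (El b ⇒ El a) fun g =>
      PathInd 1 1 (U 0) (El a)
        (fun B _ => PiT (isProp 0 B) fun hB => IdT 1 HProp (mkHProp (El a) (elProp a)) (mkHProp B hB))
        (Lam (isProp 0 (El a)) fun h =>
          PathInd 0 1 (isProp 0 (El a)) (elProp a)
            (fun h _ => IdT 1 HProp (mkHProp (El a) (elProp a)) (mkHProp (El a) h))
            (Refl 1 HProp (mkHProp (El a) (elProp a))) h (isPropProp ⬝ El a ⬝ elProp a ⬝ h))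
        (El b) (eqOfIff ⬝ El a ⬝ El b ⬝ elProp a ⬝ elProp b ⬝ f ⬝ g) ⬝ elProp b) propExtT
theorem propExt : Inhabited propExtT := .of_check propExtS (by decide +kernel)

/-- A function of two arguments from propositions is constant. It serves to show that the endomap in
`setHPropS` is constant. -/
def apPropT : Sch :=
  PiT (U 0) fun F => PiT (U 0) fun G => PiT (U 1) fun T => PiT (F ⇒ G ⇒ T) fun t =>
    isProp 0 F ⇒ isProp 0 G ⇒ PiT F fun f => PiT F fun f' => PiT G fun g => PiT G fun g' =>
      IdT 1 T (t ⬝ f ⬝ g) (t ⬝ f' ⬝ g')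
def apPropS : Script := Prove
    (Lam (U 0) fun F => Lam (U 0) fun G => Lam (U 1) fun T => Lam (F ⇒ G ⇒ T) fun t =>
      Lam (isProp 0 F) fun hF => Lam (isProp 0 G) fun hG =>
      Lam F fun f => Lam F fun f' => Lam G fun g => Lam G fun g' =>
      PathInd 0 1 F f (fun f' _ => IdT 1 T (t ⬝ f ⬝ g) (t ⬝ f' ⬝ g'))
        (PathInd 0 1 G g (fun g' _ => IdT 1 T (t ⬝ f ⬝ g) (t ⬝ f ⬝ g')) (Refl 1 T (t ⬝ f ⬝ g)) g'
          (hG ⬝ g ⬝ g'))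
        f' (hF ⬝ f ⬝ f')) apPropT
theorem apProp : Inhabited apPropT := .of_check apPropS (by decide +kernel)

def setHPropT : Sch := isSet 1 HProp
-- A path between propositions gives implications in both directions, and `propExt` returns a path
-- from these. This endomap depends on the path only through the implications, which are unique, so
-- it is constant and the criterion of `setOfConstant` applies.
def setHPropS : Script :=
  Use propExt fun propExt => Use apProp fun apProp => Use piProp fun piProp =>
  Use hasType_setOfConstant₁.inhabited fun setOfConstant =>
  Let (Lam HProp fun a => Lam HProp fun b => Lam (IdT 1 HProp a b) fun e =>
      PathInd 1 0 HProp a (fun b _ => El a ⇒ El b) (Lam (El a) fun u => u) b e)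
    (PiT HProp fun a => PiT HProp fun b => PiT (IdT 1 HProp a b) fun _ => El a ⇒ El b) fun fwd =>
  Let (Lam HProp fun a => Lam HProp fun b => Lam (IdT 1 HProp a b) fun e =>
      PathInd 1 0 HProp a (fun b _ => El b ⇒ El a) (Lam (El a) fun u => u) b e)
    (PiT HProp fun a => PiT HProp fun b => PiT (IdT 1 HProp a b) fun _ => El b ⇒ El a) fun bwd =>
  Prove (setOfConstant ⬝ HProp ⬝
    (Lam HProp fun a => Lam HProp fun b => Lam (IdT 1 HProp a b) fun e =>
      propExt ⬝ a ⬝ b ⬝ (fwd ⬝ a ⬝ b ⬝ e) ⬝ (bwd ⬝ a ⬝ b ⬝ e)) ⬝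
    (Lam HProp fun a => Lam HProp fun b => Lam (IdT 1 HProp a b) fun e =>
      Lam (IdT 1 HProp a b) fun e' =>
      apProp ⬝ (El a ⇒ El b) ⬝ (El b ⇒ El a) ⬝ IdT 1 HProp a b ⬝ (propExt ⬝ a ⬝ b) ⬝
        (piProp ⬝ El a ⬝ (Lam (El a) fun _ => El b) ⬝ (Lam (El a) fun _ => elProp b)) ⬝
        (piProp ⬝ El b ⬝ (Lam (El b) fun _ => El a) ⬝ (Lam (El b) fun _ => elProp a)) ⬝
        (fwd ⬝ a ⬝ b ⬝ e) ⬝ (fwd ⬝ a ⬝ b ⬝ e') ⬝ (bwd ⬝ a ⬝ b ⬝ e) ⬝ (bwd ⬝ a ⬝ b ⬝ e')))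
    setHPropT
theorem setHProp : Inhabited setHPropT := .of_check setHPropS (by decide +kernel)

end HoTT

namespace HoTT

/-! ### The code of the strict order -/

/-- The elimination into `HProp` takes place at level 1, so implications have to be propositions
with respect to identity types at that level; path induction lifts the equations from level 0. -/
def piProp₁T : Sch :=
  PiT (U 0) fun A => PiT (U 0) fun B => isProp 0 B ⇒ isProp 1 (A ⇒ B)
def piProp₁S : Script := Prove
    (Lam (U 0) fun A => Lam (U 0) fun B => Lam (isProp 0 B) fun h =>
      Lam (A ⇒ B) fun f => Lam (A ⇒ B) fun g =>
      K (.funext 1) ⬝ A ⬝ (Lam A fun _ => B) ⬝ f ⬝ g ⬝ Lam A fun x =>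
        PathInd 0 1 B (f ⬝ x) (fun y _ => IdT 1 B (f ⬝ x) y) (Refl 1 B (f ⬝ x)) (g ⬝ x)
          (h ⬝ (f ⬝ x) ⬝ (g ⬝ x))) piProp₁T
theorem piProp₁ : Inhabited piProp₁T := .of_check piProp₁S (by decide +kernel)

/-- From a simulation with induction hypotheses to a map of existential statements. -/
def exMapT : Sch :=
  PiT (NatT ⇒ U 0) fun F => PiT (NatT ⇒ U 0) fun G => PiT (NatT ⇒ NatT ⇒ U 0) fun D =>
    (PiT NatT fun k => Ex 1 NatT fun n => Sig 1 (D ⬝ k ⬝ n) fun _ => F ⬝ k ⇒ G ⬝ n) ⇒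
    Exists' NatT F ⇒ Exists' NatT G
def exMapS : Script :=
  Use exElim fun exElim => Use exIntro fun exIntro => Prove
    (Lam (NatT ⇒ U 0) fun F => Lam (NatT ⇒ U 0) fun G => Lam (NatT ⇒ NatT ⇒ U 0) fun D =>
      Lam (PiT NatT fun k => Ex 1 NatT fun n => Sig 1 (D ⬝ k ⬝ n) fun _ => F ⬝ k ⇒ G ⬝ n) fun S =>
      exElim ⬝ NatT ⬝ F ⬝ Exists' NatT G ⬝ (K (.squash 0) ⬝ (K (.sig 0) ⬝ NatT ⬝ G)) ⬝
        (Lam NatT fun k => Lam (F ⬝ k) fun a =>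
          let E : Sch → Sch := fun n => Sig 1 (D ⬝ k ⬝ n) fun _ => F ⬝ k ⇒ G ⬝ n
          K (.truncElim 1 0) ⬝ Sig 1 NatT E ⬝ (Lam (Ex 1 NatT E) fun _ => Exists' NatT G) ⬝
            (Lam (Ex 1 NatT E) fun _ => K (.squash 0) ⬝ (K (.sig 0) ⬝ NatT ⬝ G)) ⬝
            (Lam (Sig 1 NatT E) fun w =>
              exIntro ⬝ NatT ⬝ G ⬝ Fst 1 NatT E w ⬝
                (Snd 1 (D ⬝ k ⬝ Fst 1 NatT E w) (fun _ => F ⬝ k ⇒ G ⬝ Fst 1 NatT E w)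
                  (Snd 1 NatT E w) ⬝ a)) ⬝
            (S ⬝ k))) exMapT
theorem exMap : Inhabited exMapT := .of_check exMapS (by decide +kernel)

/-- `C` follows from a relation `L` with the properties that recursion on `y` gives to `x < y`. -/
def CodeMotive (C : Sch) : Sch :=
  PiT (Brw ⇒ Brw ⇒ U 0) fun L =>
    (PiT Brw fun x => L ⬝ x ⬝ BZero ⇒ EmptyT) ⇒
    (PiT Brw fun x => PiT Brw fun y => L ⬝ x ⬝ BSucc y ⇒ Le x y) ⇒
    (PiT Brw fun x => PiT Brw fun y => Le x y ⇒ L ⬝ x ⬝ BSucc y) ⇒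
    (PiT Brw fun x => PiT (NatT ⇒ Brw) fun f => PiT (Increasing f) fun p =>
      L ⬝ x ⬝ Limit f p ⇒ Ex 0 NatT fun n => L ⬝ x ⬝ (f ⬝ n)) ⇒
    (PiT Brw fun x => PiT Brw fun y => PiT Brw fun z => Le y z ⇒ L ⬝ x ⬝ y ⇒ L ⬝ x ⬝ z) ⇒ C

/-- There is a relation `L` as in `CodeMotive`. -/
def codeT : Sch := PiT (U 0) fun C => CodeMotive C ⇒ C

/-- The types of the methods of an elimination into `A` and `B` for the constructors of the order. -/
def LeZeroMethod (A B mz : Sch) : Sch :=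
  PiT Brw fun x => PiT (A ⬝ x) fun a => B ⬝ BZero ⬝ x ⬝ mz ⬝ a ⬝ (K .leZero ⬝ x)

/-- A method for a constructor of the order. -/
def LeTransMethod (A B : Sch) : Sch :=
  PiT Brw fun x => PiT Brw fun y => PiT Brw fun z =>
    PiT (A ⬝ x) fun a => PiT (A ⬝ y) fun b => PiT (A ⬝ z) fun c =>
    PiT (Le x y) fun l => PiT (Le y z) fun l' =>
    (B ⬝ x ⬝ y ⬝ a ⬝ b ⬝ l) ⇒ (B ⬝ y ⬝ z ⬝ b ⬝ c ⬝ l') ⇒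
    (B ⬝ x ⬝ z ⬝ a ⬝ c ⬝ (K .leTrans ⬝ x ⬝ y ⬝ z ⬝ l ⬝ l'))

/-- A method for a constructor of the order. -/
def LeSuccMonoMethod (A B ms : Sch) : Sch :=
  PiT Brw fun x => PiT Brw fun y => PiT (A ⬝ x) fun a => PiT (A ⬝ y) fun b => PiT (Le x y) fun l =>
    (B ⬝ x ⬝ y ⬝ a ⬝ b ⬝ l) ⇒
    (B ⬝ BSucc x ⬝ BSucc y ⬝ (ms ⬝ x ⬝ a) ⬝ (ms ⬝ y ⬝ b) ⬝ (K .leSuccMono ⬝ x ⬝ y ⬝ l))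

/-- A method for a constructor of the order. -/
def LeCoconeMethod (A B ms ml : Sch) : Sch :=
  PiSeq A B ms fun f p F P => PiT Brw fun x => PiT (A ⬝ x) fun a => PiT NatT fun k =>
    PiT (Le x (f ⬝ k)) fun l => (B ⬝ x ⬝ (f ⬝ k) ⬝ a ⬝ (F ⬝ k) ⬝ l) ⇒
    (B ⬝ x ⬝ Limit f p ⬝ a ⬝ (ml ⬝ f ⬝ p ⬝ F ⬝ P) ⬝ (K .leCocone ⬝ f ⬝ p ⬝ x ⬝ k ⬝ l))

/-- A method for a constructor of the order. -/
def LeLimitingMethod (A B ms ml : Sch) : Sch :=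
  PiSeq A B ms fun f p F P => PiT Brw fun x => PiT (A ⬝ x) fun a =>
    PiT (PiT NatT fun k => Le (f ⬝ k) x) fun l =>
    (PiT NatT fun k => B ⬝ (f ⬝ k) ⬝ x ⬝ (F ⬝ k) ⬝ a ⬝ (l ⬝ k)) ⇒
    (B ⬝ Limit f p ⬝ x ⬝ (ml ⬝ f ⬝ p ⬝ F ⬝ P) ⬝ a ⬝ (K .leLimiting ⬝ f ⬝ p ⬝ x ⬝ l))

/-- The type of the method for `bisim`. -/
def BisimMethod (j : ℕ) (A B ms ml : Sch) : Sch :=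
  PiSeq A B ms fun f p F P => PiSeq A B ms fun g q G Q =>
    PiT (Simulated f g) fun s => PiT (Simulated g f) fun t =>
    SimulatedOver j B f F g G ⇒ SimulatedOver j B g G f F ⇒
    IdT j (A ⬝ Limit g q)
      (Transport 0 j Brw (fun x => A ⬝ x) (Limit f p) (Limit g q)
        (K .bisim ⬝ f ⬝ p ⬝ g ⬝ q ⬝ s ⬝ t) (ml ⬝ f ⬝ p ⬝ F ⬝ P))
      (ml ⬝ g ⬝ q ⬝ G ⬝ Q)

/-- For fixed `x` the tree `y` is sent to a code of `x < y`: `𝟎` at `zero`, `x ≤ y'` at `succ y'`,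
and `∃ n` of the codes at `f n` for `limit f`. An inequality `y ≤ y'` is sent to an implication of
codes. The conclusion quantifies over `C`, so that later proofs see only the five properties of `L`
and never unfold the recursion. -/
def codeS : Script :=
  Use setHProp fun setHProp => Use piProp₁ fun piProp => Use emptyProp fun emptyProp =>
  Use emptyRec fun emptyRec => Use exIntro fun exIntro => Use exElim fun exElim =>
  Use propExt fun propExt => Use exMap fun exMap =>
  Let (Lam Brw fun _ => HProp) (Brw ⇒ U 1) fun A =>
  Let (Lam Brw fun y => Lam Brw fun y' => Lam (A ⬝ y) fun a => Lam (A ⬝ y') fun b =>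
      Lam (Le y y') fun _ => El a ⇒ El b)
    (PiT Brw fun y => PiT Brw fun y' => PiT (A ⬝ y) fun _ => PiT (A ⬝ y') fun _ =>
      PiT (Le y y') fun _ => U 1) fun B =>
  Let (Lam Brw fun _ => setHProp) (PiT Brw fun x => isSet 1 (A ⬝ x)) fun hA =>
  Let (Lam Brw fun y => Lam Brw fun y' => Lam (A ⬝ y) fun a => Lam (A ⬝ y') fun b =>
        Lam (Le y y') fun _ => piProp ⬝ El a ⬝ El b ⬝ elProp b)
    (PiT Brw fun x => PiT Brw fun y => PiT (A ⬝ x) fun a => PiT (A ⬝ y) fun b =>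
      PiT (Le x y) fun l => isProp 1 (B ⬝ x ⬝ y ⬝ a ⬝ b ⬝ l)) fun hB =>
  Let (mkHProp EmptyT emptyProp) (A ⬝ BZero) fun mz =>
  Let (Lam Brw fun x => Lam Brw fun y => Lam (A ⬝ y) fun _ => mkHProp (Le x y) (K .leProp ⬝ x ⬝ y))
    (PiT Brw fun _ => PiT Brw fun y => PiT (A ⬝ y) fun _ => A ⬝ BSucc y) fun ms =>
  let E : Sch → Sch := fun F => Lam NatT fun k => El (F ⬝ k)
  Let (Lam Brw fun x => LamSeq A B (ms ⬝ x) fun _ _ F _ =>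
      mkHProp (Exists' NatT (E F)) (K (.squash 0) ⬝ (K (.sig 0) ⬝ NatT ⬝ E F)))
    (PiT Brw fun x => PiSeq A B (ms ⬝ x) fun f p _ _ => A ⬝ Limit f p) fun ml =>
  Let (Lam Brw fun x =>
    LamSeq A B (ms ⬝ x) fun f p F P => LamSeq A B (ms ⬝ x) fun g q G Q =>
      Lam (Simulated f g) fun s => Lam (Simulated g f) fun t =>
      Lam (SimulatedOver 1 B f F g G) fun S => Lam (SimulatedOver 1 B g G f F) fun T =>
      -- Path induction replaces the transport along `bisim` by one along `refl`, which computes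
      -- away. What remains is an equality of two existential propositions, which imply each other
      -- by the induction hypotheses for the simulations.
      PathInd 0 1 Brw (Limit f p)
        (fun z e => IdT 1 HProp
          (Transport 0 1 Brw (fun w => A ⬝ w) (Limit f p) z e (ml ⬝ x ⬝ f ⬝ p ⬝ F ⬝ P))
          (ml ⬝ x ⬝ g ⬝ q ⬝ G ⬝ Q))
        (propExt ⬝ (ml ⬝ x ⬝ f ⬝ p ⬝ F ⬝ P) ⬝ (ml ⬝ x ⬝ g ⬝ q ⬝ G ⬝ Q) ⬝
          (exMap ⬝ E F ⬝ E G ⬝ (Lam NatT fun k => Lam NatT fun n => Le (f ⬝ k) (g ⬝ n)) ⬝ S) ⬝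
          (exMap ⬝ E G ⬝ E F ⬝ (Lam NatT fun k => Lam NatT fun n => Le (g ⬝ k) (f ⬝ n)) ⬝ T))
        (Limit g q) (K .bisim ⬝ f ⬝ p ⬝ g ⬝ q ⬝ s ⬝ t))
    (PiT Brw fun x => BisimMethod 1 A B (ms ⬝ x) (ml ⬝ x)) fun mb =>
  Let (Lam Brw fun y => Lam (A ⬝ y) fun a => emptyRec ⬝ El a) (LeZeroMethod A B mz) fun m₁ =>
  Let (Lam Brw fun y => Lam Brw fun y' => Lam Brw fun z =>
      Lam (A ⬝ y) fun a => Lam (A ⬝ y') fun b => Lam (A ⬝ z) fun c =>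
      Lam (Le y y') fun l => Lam (Le y' z) fun l' =>
      Lam (B ⬝ y ⬝ y' ⬝ a ⬝ b ⬝ l) fun h => Lam (B ⬝ y' ⬝ z ⬝ b ⬝ c ⬝ l') fun h' =>
      Lam (El a) fun u => h' ⬝ (h ⬝ u)) (LeTransMethod A B) fun m₂ =>
  Let (Lam Brw fun x => Lam Brw fun y => Lam Brw fun y' => Lam (A ⬝ y) fun a => Lam (A ⬝ y') fun b =>
      Lam (Le y y') fun l => Lam (B ⬝ y ⬝ y' ⬝ a ⬝ b ⬝ l) fun _ => Lam (Le x y) fun h =>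
      LeTrans x y y' h l) (PiT Brw fun x => LeSuccMonoMethod A B (ms ⬝ x)) fun m₃ =>
  Let (Lam Brw fun x => LamSeq A B (ms ⬝ x) fun f _ F _ =>
      Lam Brw fun y => Lam (A ⬝ y) fun a => Lam NatT fun k => Lam (Le y (f ⬝ k)) fun l =>
      Lam (B ⬝ y ⬝ (f ⬝ k) ⬝ a ⬝ (F ⬝ k) ⬝ l) fun h => Lam (El a) fun u =>
      exIntro ⬝ NatT ⬝ E F ⬝ k ⬝ (h ⬝ u))
    (PiT Brw fun x => LeCoconeMethod A B (ms ⬝ x) (ml ⬝ x)) fun m₄ =>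
  Let (Lam Brw fun x => LamSeq A B (ms ⬝ x) fun f _ F _ =>
      Lam Brw fun y => Lam (A ⬝ y) fun a => Lam (PiT NatT fun k => Le (f ⬝ k) y) fun l =>
      Lam (PiT NatT fun k => B ⬝ (f ⬝ k) ⬝ y ⬝ (F ⬝ k) ⬝ a ⬝ (l ⬝ k)) fun h =>
      exElim ⬝ NatT ⬝ E F ⬝ El a ⬝ elProp a ⬝ h)
    (PiT Brw fun x => LeLimitingMethod A B (ms ⬝ x) (ml ⬝ x)) fun m₅ =>
  let ps : Sch → List Sch := fun x =>
    [A, B, hA, hB, mz, ms ⬝ x, ml ⬝ x, mb ⬝ x, m₁, m₂, m₃ ⬝ x, m₄ ⬝ x, m₅ ⬝ x]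
  Let (Lam Brw fun x => KApp (.brwElim 1) (ps x)) (Brw ⇒ Brw ⇒ HProp) fun L =>
  Let (Lam Brw fun x => KApp (.leElim 1) (ps x))
    (PiT Brw fun x => PiT Brw fun y => PiT Brw fun z => Le y z ⇒
      El (L ⬝ x ⬝ y) ⇒ El (L ⬝ x ⬝ z)) fun mono =>
  -- The clauses at `zero`, `succ` and `limit` hold by computation, with identity functions as
  -- witnesses; monotonicity is the eliminator for the order.
  Prove
    (Lam (U 0) fun C => Lam (CodeMotive C) fun k =>
      k ⬝ (Lam Brw fun x => Lam Brw fun y => El (L ⬝ x ⬝ y)) ⬝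
        (Lam Brw fun _ => Lam EmptyT fun e => e) ⬝
        (Lam Brw fun x => Lam Brw fun y => Lam (Le x y) fun h => h) ⬝
        (Lam Brw fun x => Lam Brw fun y => Lam (Le x y) fun h => h) ⬝
        (Lam Brw fun x => Lam (NatT ⇒ Brw) fun f => Lam (Increasing f) fun _ =>
          Lam (Ex 0 NatT fun n => El (L ⬝ x ⬝ (f ⬝ n))) fun h => h) ⬝
        mono) codeT
theorem code : Inhabited codeT := .of_check codeS (by decide +kernel)

end HoTT

namespace HoTT

/-! ### Combinators for proof terms -/

/-- A proof of the proposition `C` from `∃ (x : A). B x`. -/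
def ExE (exElim A : Sch) (B : Sch → Sch) (C hC : Sch) (t : Sch → Sch → Sch) (e : Sch) : Sch :=
  exElim ⬝ A ⬝ Lam A B ⬝ C ⬝ hC ⬝ (Lam A fun a => Lam (B a) fun b => t a b) ⬝ e

/-- `∃ (x : A). B x` is a proposition. -/
def ExProp (A : Sch) (B : Sch → Sch) : Sch := K (.squash 0) ⬝ Sig 0 A B

/-- A proof of `∃ (x : A). B x`. -/
def ExI (exIntro A : Sch) (B : Sch → Sch) (a b : Sch) : Sch := exIntro ⬝ A ⬝ Lam A B ⬝ a ⬝ b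

/-- `(x : A) → B x` is a proposition if all `B x` are. -/
def PiProp (piProp A : Sch) (B hB : Sch → Sch) : Sch := piProp ⬝ A ⬝ Lam A B ⬝ Lam A hB

/-- Case distinction. -/
def SumE (sumRec A B C : Sch) (f g : Sch → Sch) (x : Sch) : Sch :=
  sumRec ⬝ A ⬝ B ⬝ C ⬝ Lam A f ⬝ Lam B g ⬝ x

/-- Case distinction by a decidable type. -/
def DecE (sumRec A C : Sch) (f g : Sch → Sch) (d : Sch) : Sch := SumE sumRec A (NotT A) C f g d

def Yes (A a : Sch) : Sch := K (.inl 0) ⬝ A ⬝ NotT A ⬝ a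

def No (A n : Sch) : Sch := K (.inr 0) ⬝ A ⬝ NotT A ⬝ n

/-- Use the relation `L` with its properties. -/
def CodeE (code C : Sch) (k : Sch → Sch → Sch → Sch → Sch → Sch → Sch) : Sch :=
  code ⬝ C ⬝ Lam (Brw ⇒ Brw ⇒ U 0) fun L =>
    Lam (PiT Brw fun x => L ⬝ x ⬝ BZero ⇒ EmptyT) fun z =>
    Lam (PiT Brw fun x => PiT Brw fun y => L ⬝ x ⬝ BSucc y ⇒ Le x y) fun s =>
    Lam (PiT Brw fun x => PiT Brw fun y => Le x y ⇒ L ⬝ x ⬝ BSucc y) fun s' =>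
    Lam (PiT Brw fun x => PiT (NatT ⇒ Brw) fun f => PiT (Increasing f) fun p =>
      L ⬝ x ⬝ Limit f p ⇒ Ex 0 NatT fun n => L ⬝ x ⬝ (f ⬝ n)) fun l =>
    Lam (PiT Brw fun x => PiT Brw fun y => PiT Brw fun z =>
      Le y z ⇒ L ⬝ x ⬝ y ⇒ L ⬝ x ⬝ z) fun m => k L z s s' l m

/-! ### Inversion of the strict order -/

def ssT : Sch := PiT Brw fun x => PiT Brw fun y => Lt x (BSucc y) ⇒ Le x y
-- Reflexivity gives a code of `x < succ x`, and monotonicity of `L` carries it along `succ x ≤ succ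
-- y`; the code at `succ y` is `x ≤ y`. The other two inversions encode in the same way.
def ssS : Script :=
  Use code fun code => Use le_refl fun leRefl => Prove
    (CodeE code ssT fun _ _ s s' _ m =>
      Lam Brw fun x => Lam Brw fun y => Lam (Lt x (BSucc y)) fun h =>
        s ⬝ x ⬝ y ⬝ (m ⬝ x ⬝ BSucc x ⬝ BSucc y ⬝ h ⬝ (s' ⬝ x ⬝ x ⬝ (leRefl ⬝ x)))) ssT
theorem le_of_lt_succ : Inhabited ssT := .of_check ssS (by decide +kernel)

def szT : Sch := PiT Brw fun x => Lt x BZero ⇒ EmptyT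
def szS : Script :=
  Use code fun code => Use le_refl fun leRefl => Prove
    (CodeE code szT fun _ z _ s' _ m =>
      Lam Brw fun x => Lam (Lt x BZero) fun h =>
        z ⬝ x ⬝ (m ⬝ x ⬝ BSucc x ⬝ BZero ⬝ h ⬝ (s' ⬝ x ⬝ x ⬝ (leRefl ⬝ x)))) szT
theorem not_lt_zero : Inhabited szT := .of_check szS (by decide +kernel)

def slT : Sch :=
  PiT (NatT ⇒ Brw) fun f => PiT (Increasing f) fun p => PiT Brw fun x => Lt x (Limit f p) ⇒
    Ex 0 NatT fun n => Lt x (f ⬝ n)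
-- Encoding yields `∃ n. L x (f n)`, so codes also have to be decoded: `L x y` implies `x < y`, by
-- induction on `y`.
def slS : Script :=
  Use code fun code => Use le_refl fun leRefl => Use brwInd fun brwInd => Use piProp fun piProp =>
  Use exElim fun exElim => Use exIntro fun exIntro => Use emptyRec fun emptyRec =>
  Prove
    (CodeE code slT fun L z s s' l m =>
      LetIn (PiT Brw fun x => PiT Brw fun y => L ⬝ x ⬝ y ⇒ Lt x y)
        (Lam Brw fun x => Ind brwInd (fun y => L ⬝ x ⬝ y ⇒ Lt x y)
          (fun y => PiProp piProp (L ⬝ x ⬝ y) (fun _ => Lt x y) (fun _ => K .leProp ⬝ BSucc x ⬝ y))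
          (Lam (L ⬝ x ⬝ BZero) fun u => emptyRec ⬝ Lt x BZero ⬝ (z ⬝ x ⬝ u))
          (fun y _ => Lam (L ⬝ x ⬝ BSucc y) fun u => K .leSuccMono ⬝ x ⬝ y ⬝ (s ⬝ x ⬝ y ⬝ u))
          (fun f p F => Lam (L ⬝ x ⬝ Limit f p) fun u =>
            ExE exElim NatT (fun n => L ⬝ x ⬝ (f ⬝ n)) (Lt x (Limit f p))
              (K .leProp ⬝ BSucc x ⬝ Limit f p)
              (fun n a => K .leCocone ⬝ f ⬝ p ⬝ BSucc x ⬝ n ⬝ (F ⬝ n ⬝ a))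
              (l ⬝ x ⬝ f ⬝ p ⬝ u))) fun lt =>
      Lam (NatT ⇒ Brw) fun f => Lam (Increasing f) fun p => Lam Brw fun x =>
      Lam (Lt x (Limit f p)) fun h =>
        ExE exElim NatT (fun n => L ⬝ x ⬝ (f ⬝ n)) (Ex 0 NatT fun n => Lt x (f ⬝ n))
          (ExProp NatT fun n => Lt x (f ⬝ n))
          (fun n a => ExI exIntro NatT (fun n => Lt x (f ⬝ n)) n (lt ⬝ x ⬝ (f ⬝ n) ⬝ a))
          (l ⬝ x ⬝ f ⬝ p ⬝ (m ⬝ x ⬝ BSucc x ⬝ Limit f p ⬝ h ⬝ (s' ⬝ x ⬝ x ⬝ (leRefl ⬝ x))))) slT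
theorem exists_lt_of_lt_limit : Inhabited slT := .of_check slS (by decide +kernel)

/-! ### Antisymmetry -/

def ltLimitT : Sch :=
  PiT (NatT ⇒ Brw) fun f => PiT (Increasing f) fun p => PiT NatT fun k => Lt (f ⬝ k) (Limit f p)
def ltLimitS : Script :=
  Use le_limit fun leLimit => Prove
    (Lam (NatT ⇒ Brw) fun f => Lam (Increasing f) fun p => Lam NatT fun k =>
      LeTrans (BSucc (f ⬝ k)) (f ⬝ NSucc k) (Limit f p) (p ⬝ k) (leLimit ⬝ f ⬝ p ⬝ NSucc k)) ltLimitT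
theorem lt_limit : Inhabited ltLimitT := .of_check ltLimitS (by decide +kernel)

def irreflT : Sch := PiT Brw fun x => Lt x x ⇒ EmptyT
-- By induction: at a successor, one `succ` is cancelled on both sides; at a limit, `limit f < f n`
-- for some `n`, and then `f n < succ (limit f) ≤ f n`.
def irreflS : Script :=
  Use brwInd fun brwInd => Use piProp fun piProp => Use emptyProp fun emptyProp =>
  Use not_lt_zero fun sz => Use le_of_lt_succ fun ss => Use exists_lt_of_lt_limit fun sl =>
  Use exElim fun exElim => Use le_limit fun leLimit => Prove
    (Ind brwInd (fun x => Lt x x ⇒ EmptyT)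
      (fun x => PiProp piProp (Lt x x) (fun _ => EmptyT) (fun _ => emptyProp))
      (sz ⬝ BZero)
      (fun x h => Lam (Lt (BSucc x) (BSucc x)) fun l => h ⬝ (ss ⬝ BSucc x ⬝ x ⬝ l))
      (fun f p F => Lam (Lt (Limit f p) (Limit f p)) fun l =>
        ExE exElim NatT (fun n => Lt (Limit f p) (f ⬝ n)) EmptyT emptyProp
          (fun n l => F ⬝ n ⬝ LeTrans (BSucc (f ⬝ n)) (BSucc (Limit f p)) (f ⬝ n)
            (K .leSuccMono ⬝ (f ⬝ n) ⬝ Limit f p ⬝ (leLimit ⬝ f ⬝ p ⬝ n)) l)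
          (sl ⬝ f ⬝ p ⬝ Limit f p ⬝ l))) irreflT
theorem lt_irrefl : Inhabited irreflT := .of_check irreflS (by decide +kernel)

def limitNeZeroT : Sch :=
  PiT (NatT ⇒ Brw) fun f => PiT (Increasing f) fun p => Le (Limit f p) BZero ⇒ EmptyT
def limitNeZeroS : Script :=
  Use not_lt_zero fun sz => Use lt_limit fun ltLimit => Prove
    (Lam (NatT ⇒ Brw) fun f => Lam (Increasing f) fun p => Lam (Le (Limit f p) BZero) fun l =>
      sz ⬝ (f ⬝ NZero) ⬝ LeTrans (BSucc (f ⬝ NZero)) (Limit f p) BZero (ltLimit ⬝ f ⬝ p ⬝ NZero) l)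
    limitNeZeroT
theorem not_limit_le_zero : Inhabited limitNeZeroT := .of_check limitNeZeroS (by decide +kernel)

def limitNeSuccT : Sch :=
  PiT (NatT ⇒ Brw) fun f => PiT (Increasing f) fun p => PiT Brw fun x =>
    Le (Limit f p) (BSucc x) ⇒ Lt x (Limit f p) ⇒ EmptyT
-- If `x < f n`, then `succ (f n) ≤ limit f ≤ succ x ≤ f n`, contradicting irreflexivity. This
-- excludes the mixed cases of antisymmetry.
def limitNeSuccS : Script :=
  Use exElim fun exElim => Use emptyProp fun emptyProp => Use lt_irrefl fun irrefl =>
  Use exists_lt_of_lt_limit fun sl => Use lt_limit fun ltLimit => Prove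
    (Lam (NatT ⇒ Brw) fun f => Lam (Increasing f) fun p => Lam Brw fun x =>
      Lam (Le (Limit f p) (BSucc x)) fun l => Lam (Lt x (Limit f p)) fun l' =>
      ExE exElim NatT (fun n => Lt x (f ⬝ n)) EmptyT emptyProp
        (fun n h => irrefl ⬝ (f ⬝ n) ⬝ LeTrans (BSucc (f ⬝ n)) (BSucc x) (f ⬝ n)
          (LeTrans (BSucc (f ⬝ n)) (Limit f p) (BSucc x) (ltLimit ⬝ f ⬝ p ⬝ n) l) h)
        (sl ⬝ f ⬝ p ⬝ x ⬝ l')) limitNeSuccT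
theorem limit_ne_succ : Inhabited limitNeSuccT := .of_check limitNeSuccS (by decide +kernel)

def leOfLtT : Sch := PiT Brw fun x => PiT Brw fun y => Lt x y ⇒ Le x y
def leOfLtS : Script :=
  Use le_succ fun leSucc => Prove
    (Lam Brw fun x => Lam Brw fun y => Lam (Lt x y) fun l => LeTrans x (BSucc x) y (leSucc ⬝ x) l)
    leOfLtT
theorem le_of_lt : Inhabited leOfLtT := .of_check leOfLtS (by decide +kernel)

def simulatedT : Sch :=
  PiT (NatT ⇒ Brw) fun f => PiT (Increasing f) fun p => PiT (NatT ⇒ Brw) fun g =>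
    PiT (Increasing g) fun q => Le (Limit f p) (Limit g q) ⇒ Simulated f g
-- Since `f k < limit f ≤ limit g`, inversion gives `f k < g n` for some `n`. These are the premises
-- of `bisim`.
def simulatedS : Script :=
  Use exElim fun exElim => Use exIntro fun exIntro => Use exists_lt_of_lt_limit fun sl =>
  Use lt_limit fun ltLimit => Use le_of_lt fun leOfLt => Prove
    (Lam (NatT ⇒ Brw) fun f => Lam (Increasing f) fun p => Lam (NatT ⇒ Brw) fun g =>
      Lam (Increasing g) fun q => Lam (Le (Limit f p) (Limit g q)) fun l => Lam NatT fun k =>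
      ExE exElim NatT (fun n => Lt (f ⬝ k) (g ⬝ n)) (Ex 0 NatT fun n => Le (f ⬝ k) (g ⬝ n))
        (ExProp NatT fun n => Le (f ⬝ k) (g ⬝ n))
        (fun n h => ExI exIntro NatT (fun n => Le (f ⬝ k) (g ⬝ n)) n (leOfLt ⬝ (f ⬝ k) ⬝ (g ⬝ n) ⬝ h))
        (sl ⬝ g ⬝ q ⬝ (f ⬝ k) ⬝
          LeTrans (BSucc (f ⬝ k)) (Limit f p) (Limit g q) (ltLimit ⬝ f ⬝ p ⬝ k) l)) simulatedT
theorem simulated_of_le : Inhabited simulatedT := .of_check simulatedS (by decide +kernel)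

def antisymmT : Sch :=
  PiT Brw fun x => PiT Brw fun y => Le x y ⇒ Le y x ⇒ IdT 0 Brw x y
-- Double induction into a proposition, as `Brw` is a set. Two successors reduce to their
-- predecessors, two limits are bisimilar, and trees of different shape cannot bound each other.
def antisymmS : Script :=
  Use brwInd fun brwInd => Use piProp fun piProp => Use emptyRec fun emptyRec =>
  Use not_lt_zero fun sz => Use le_of_lt_succ fun ss => Use not_limit_le_zero fun limNeZero =>
  Use limit_ne_succ fun limNeSucc => Use simulated_of_le fun sim =>
  let P : Sch → Sch → Sch := fun x y => Le x y ⇒ Le y x ⇒ IdT 0 Brw x y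
  let intro : Sch → Sch → (Sch → Sch → Sch) → Sch := fun x y t =>
    Lam (Le x y) fun l => Lam (Le y x) fun l' => t l l'
  let absurd : Sch → Sch → (Sch → Sch → Sch) → Sch := fun x y t =>
    intro x y fun l l' => emptyRec ⬝ IdT 0 Brw x y ⬝ t l l'
  Let (Lam Brw fun x => Lam Brw fun y =>
      PiProp piProp (Le x y) (fun _ => Le y x ⇒ IdT 0 Brw x y)
        (fun _ => PiProp piProp (Le y x) (fun _ => IdT 0 Brw x y) (fun _ => K .brwSet ⬝ x ⬝ y)))
    (PiT Brw fun x => PiT Brw fun y => isProp 0 (P x y)) fun hP =>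
  Prove
    (Ind brwInd (fun x => PiT Brw fun y => P x y)
      (fun x => PiProp piProp Brw (fun y => P x y) (fun y => hP ⬝ x ⬝ y))
      (Ind brwInd (fun y => P BZero y) (fun y => hP ⬝ BZero ⬝ y)
        (intro BZero BZero fun _ _ => Refl 0 Brw BZero)
        (fun y _ => absurd BZero (BSucc y) fun _ l => sz ⬝ y ⬝ l)
        (fun g q _ => absurd BZero (Limit g q) fun _ l => limNeZero ⬝ g ⬝ q ⬝ l))
      (fun x h => Ind brwInd (fun y => P (BSucc x) y) (fun y => hP ⬝ BSucc x ⬝ y)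
        (absurd (BSucc x) BZero fun l _ => sz ⬝ x ⬝ l)
        (fun y _ => intro (BSucc x) (BSucc y) fun l l' =>
          Ap 0 Brw Brw (fun z => BSucc z) x y (h ⬝ y ⬝ (ss ⬝ x ⬝ y ⬝ l) ⬝ (ss ⬝ y ⬝ x ⬝ l')))
        (fun g q _ => absurd (BSucc x) (Limit g q) fun l l' => limNeSucc ⬝ g ⬝ q ⬝ x ⬝ l' ⬝ l))
      (fun f p _ => Ind brwInd (fun y => P (Limit f p) y) (fun y => hP ⬝ Limit f p ⬝ y)
        (absurd (Limit f p) BZero fun l _ => limNeZero ⬝ f ⬝ p ⬝ l)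
        (fun y _ => absurd (Limit f p) (BSucc y) fun l l' => limNeSucc ⬝ f ⬝ p ⬝ y ⬝ l ⬝ l')
        (fun g q _ => intro (Limit f p) (Limit g q) fun l l' =>
          K .bisim ⬝ f ⬝ p ⬝ g ⬝ q ⬝ (sim ⬝ f ⬝ p ⬝ g ⬝ q ⬝ l) ⬝ (sim ⬝ g ⬝ q ⬝ f ⬝ p ⬝ l'))))
    antisymmT
theorem antisymm : Inhabited antisymmT := .of_check antisymmS (by decide +kernel)

/-! ### Decidability from the limited principle of omniscience -/

def decBoolT : Sch :=
  PiT (U 0) fun A => Dec A ⇒ Sig 0 BoolT fun b =>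
    ProdT 0 (IdT 0 BoolT b TT ⇒ A) (IdT 0 BoolT b FF ⇒ NotT A)
-- LPO speaks of boolean sequences; this replaces a decision by a boolean that reflects it.
def decBoolS : Script :=
  Use sumRec fun sumRec => Use emptyRec fun emptyRec => Use ffNeTt fun ffNeTt =>
  Use symm fun symm => Prove
    (Lam (U 0) fun A => Lam (Dec A) fun d =>
      let B : Sch → Sch := fun b => ProdT 0 (IdT 0 BoolT b TT ⇒ A) (IdT 0 BoolT b FF ⇒ NotT A)
      let mk : Sch → (Sch → Sch) → (Sch → Sch) → Sch := fun b f g =>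
        Pair 0 BoolT B b (Pair 0 (IdT 0 BoolT b TT ⇒ A) (fun _ => IdT 0 BoolT b FF ⇒ NotT A)
          (Lam (IdT 0 BoolT b TT) f) (Lam (IdT 0 BoolT b FF) g))
      DecE sumRec A (Sig 0 BoolT B)
        (fun a => mk TT (fun _ => a) fun e => emptyRec ⬝ NotT A ⬝ (ffNeTt ⬝ (symm ⬝ BoolT ⬝ TT ⬝ FF ⬝ e)))
        (fun n => mk FF (fun e => emptyRec ⬝ A ⬝ (ffNeTt ⬝ e)) fun _ => n) d) decBoolT
theorem decBool : Inhabited decBoolT := .of_check decBoolS (by decide +kernel)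

/-- The limited principle of omniscience for decidable families. -/
def lpoDecT : Sch :=
  LPO ⇒ PiT (NatT ⇒ U 0) fun P => (PiT NatT fun n => Dec (P ⬝ n)) ⇒
    SumT 0 (PiT NatT fun n => NotT (P ⬝ n)) (Ex 0 NatT fun n => P ⬝ n)
def lpoDecS : Script :=
  Use sumRec fun sumRec => Use exElim fun exElim => Use exIntro fun exIntro =>
  Use decBool fun decBool => Prove
    (Lam LPO fun lpo => Lam (NatT ⇒ U 0) fun P => Lam (PiT NatT fun n => Dec (P ⬝ n)) fun d =>
      let T : Sch → Sch → Sch := fun n b => IdT 0 BoolT b TT ⇒ P ⬝ n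
      let F : Sch → Sch → Sch := fun n b => IdT 0 BoolT b FF ⇒ NotT (P ⬝ n)
      let v : Sch → Sch := fun n => Fst 0 BoolT (fun b => ProdT 0 (T n b) (F n b)) (decBool ⬝ (P ⬝ n) ⬝ (d ⬝ n))
      let w : Sch → Sch := fun n => Snd 0 BoolT (fun b => ProdT 0 (T n b) (F n b)) (decBool ⬝ (P ⬝ n) ⬝ (d ⬝ n))
      let A := PiT NatT fun n => NotT (P ⬝ n)
      let B := Ex 0 NatT fun n => P ⬝ n
      SumE sumRec (PiT NatT fun n => IdT 0 BoolT (v n) FF) (Ex 0 NatT fun n => IdT 0 BoolT (v n) TT)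
        (SumT 0 A B)
        (fun h => K (.inl 0) ⬝ A ⬝ B ⬝ Lam NatT fun n =>
          Snd 0 (T n (v n)) (fun _ => F n (v n)) (w n) ⬝ (h ⬝ n))
        (fun h => K (.inr 0) ⬝ A ⬝ B ⬝
          ExE exElim NatT (fun n => IdT 0 BoolT (v n) TT) B (ExProp NatT fun n => P ⬝ n)
            (fun n e => ExI exIntro NatT (fun n => P ⬝ n) n
              (Fst 0 (T n (v n)) (fun _ => F n (v n)) (w n) ⬝ e)) h)
        (lpo ⬝ Lam NatT v)) lpoDecT
theorem lpoDec : Inhabited lpoDecT := .of_check lpoDecS (by decide +kernel)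

/-- Decidability of the order. -/
def DecLe : Sch := PiT Brw fun x => PiT Brw fun y => Dec (Le x y)

/-- Decidability of equality. -/
def DecEqBrw : Sch := PiT Brw fun x => PiT Brw fun y => Dec (IdT 0 Brw x y)

/-- The outer induction is on `x`, with all `y` in the statement; the successor case needs an inner
induction on `y`. LPO enters exactly at the limits. -/
def decLeS : Script :=
  Use brwInd fun brwInd => Use piProp fun piProp => Use decProp fun decProp =>
  Use sumRec fun sumRec => Use exElim fun exElim => Use lpoDec fun lpoDec =>
  Use emptyProp fun emptyProp => Use emptyRec fun emptyRec =>
  Use not_lt_zero fun sz => Use le_of_lt_succ fun ss => Use exists_lt_of_lt_limit fun sl =>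
  Use le_limit fun leLimit =>
  Let (Lam Brw fun x => Lam Brw fun y => decProp ⬝ Le x y ⬝ (K .leProp ⬝ x ⬝ y))
    (PiT Brw fun x => PiT Brw fun y => isProp 0 (Dec (Le x y))) fun hP =>
  Prove
    (Lam LPO fun lpo => Ind brwInd (fun x => PiT Brw fun y => Dec (Le x y))
      (fun x => PiProp piProp Brw (fun y => Dec (Le x y)) (fun y => hP ⬝ x ⬝ y))
      (Lam Brw fun y => Yes (Le BZero y) (K .leZero ⬝ y))
      (fun x h => Ind brwInd (fun y => Dec (Lt x y)) (fun y => hP ⬝ BSucc x ⬝ y)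
        (No (Lt x BZero) (sz ⬝ x))
        (fun y _ => DecE sumRec (Le x y) (Dec (Lt x (BSucc y)))
          (fun l => Yes (Lt x (BSucc y)) (K .leSuccMono ⬝ x ⬝ y ⬝ l))
          (fun n => No (Lt x (BSucc y)) (Lam (Lt x (BSucc y)) fun l => n ⬝ (ss ⬝ x ⬝ y ⬝ l)))
          (h ⬝ y))
        (fun g q G =>
          let A := Lt x (Limit g q)
          SumE sumRec (PiT NatT fun n => NotT (Lt x (g ⬝ n))) (Ex 0 NatT fun n => Lt x (g ⬝ n)) (Dec A)
            (fun h => No A (Lam A fun l => ExE exElim NatT (fun n => Lt x (g ⬝ n)) EmptyT emptyProp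
              (fun n l => h ⬝ n ⬝ l) (sl ⬝ g ⬝ q ⬝ x ⬝ l)))
            (fun e => Yes A (ExE exElim NatT (fun n => Lt x (g ⬝ n)) A (K .leProp ⬝ BSucc x ⬝ Limit g q)
              (fun n l => K .leCocone ⬝ g ⬝ q ⬝ BSucc x ⬝ n ⬝ l) e))
            (lpoDec ⬝ lpo ⬝ (Lam NatT fun n => Lt x (g ⬝ n)) ⬝ G)))
      (fun f p F => Lam Brw fun y =>
        let A := Le (Limit f p) y
        -- LPO is applied to the negations: either some `f n ≤ y` fails, or none does, and then
        -- double negations are removed by the decisions already available.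
        let N : Sch → Sch := fun n => NotT (Le (f ⬝ n) y)
        SumE sumRec (PiT NatT fun n => NotT (N n)) (Ex 0 NatT N) (Dec A)
          (fun h => Yes A (K .leLimiting ⬝ f ⬝ p ⬝ y ⬝ Lam NatT fun n =>
            DecE sumRec (Le (f ⬝ n) y) (Le (f ⬝ n) y) (fun l => l)
              (fun m => emptyRec ⬝ Le (f ⬝ n) y ⬝ (h ⬝ n ⬝ m)) (F ⬝ n ⬝ y)))
          (fun e => No A (Lam A fun l => ExE exElim NatT N EmptyT emptyProp
            (fun n m => m ⬝ LeTrans (f ⬝ n) (Limit f p) y (leLimit ⬝ f ⬝ p ⬝ n) l) e))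
          (lpoDec ⬝ lpo ⬝ (Lam NatT N) ⬝ Lam NatT fun n =>
            DecE sumRec (Le (f ⬝ n) y) (Dec (N n))
              (fun l => No (N n) (Lam (N n) fun m => m ⬝ l)) (fun m => Yes (N n) m) (F ⬝ n ⬝ y))))
    (LPO ⇒ DecLe)
theorem decLe_of_lpo : Inhabited (LPO ⇒ DecLe) := .of_check decLeS (by decide +kernel)

def decEqS : Script :=
  Use antisymm fun antisymm => Use le_of_eq fun leOfEq => Use sumRec fun sumRec =>
  Use symm fun symm => Prove
    (Lam DecLe fun d => Lam Brw fun x => Lam Brw fun y =>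
      let E := IdT 0 Brw x y
      DecE sumRec (Le x y) (Dec E)
        (fun l => DecE sumRec (Le y x) (Dec E)
          (fun l' => Yes E (antisymm ⬝ x ⬝ y ⬝ l ⬝ l'))
          (fun n => No E (Lam E fun e => n ⬝ (leOfEq ⬝ y ⬝ x ⬝ (symm ⬝ Brw ⬝ x ⬝ y ⬝ e)))) (d ⬝ y ⬝ x))
        (fun n => No E (Lam E fun e => n ⬝ (leOfEq ⬝ x ⬝ y ⬝ e))) (d ⬝ x ⬝ y)) (DecLe ⇒ DecEqBrw)
theorem decEq_of_decLe : Inhabited (DecLe ⇒ DecEqBrw) := .of_check decEqS (by decide +kernel)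

end HoTT

namespace HoTT

/-! ### A sequence that jumps at the first `tt` -/

/-- `iter x n = succⁿ x` -/
def iter (x : Sch) : Sch :=
  K (.natElim 0) ⬝ (Lam NatT fun _ => Brw) ⬝ x ⬝ (Lam NatT fun _ => Lam Brw fun x => BSucc x)

/-- Proof of `(n : ℕ) → P n` by induction. -/
def NatInd (P : Sch → Sch) (z : Sch) (s : Sch → Sch → Sch) : Sch :=
  K (.natElim 0) ⬝ Lam NatT P ⬝ z ⬝ Lam NatT fun n => Lam (P n) fun h => s n h

/-- Proof of `P b` by cases. -/
def BoolE (P : Sch → Sch) (c d b : Sch) : Sch := K (.boolElim 0) ⬝ Lam BoolT P ⬝ c ⬝ d ⬝ b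

def iotaLeIterT : Sch := PiT Brw fun x => PiT NatT fun n => Le (iota ⬝ n) (iter x ⬝ n)
def iotaLeIterS : Script := Prove
  (Lam Brw fun x => NatInd (fun n => Le (iota ⬝ n) (iter x ⬝ n)) (K .leZero ⬝ x)
    fun n h => K .leSuccMono ⬝ (iota ⬝ n) ⬝ (iter x ⬝ n) ⬝ h) iotaLeIterT
theorem iota_le_iter : Inhabited iotaLeIterT := .of_check iotaLeIterS (by decide +kernel)

def leIterT : Sch := PiT Brw fun x => PiT NatT fun n => Le x (iter x ⬝ n)
def leIterS : Script :=
  Use le_refl fun leRefl => Use le_succ fun leSucc => Prove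
    (Lam Brw fun x => NatInd (fun n => Le x (iter x ⬝ n)) (leRefl ⬝ x)
      fun n h => LeTrans x (iter x ⬝ n) (BSucc (iter x ⬝ n)) h (leSucc ⬝ (iter x ⬝ n))) leIterT
theorem le_iter : Inhabited leIterT := .of_check leIterS (by decide +kernel)

/-- There is an increasing sequence that follows `n ↦ succⁿ zero` until `s` takes the value `tt`, and
follows `n ↦ succⁿ w` from then on. -/
def jumpT : Sch :=
  PiT Brw fun w => PiT (NatT ⇒ BoolT) fun s => PiT (U 0) fun C =>
    (PiT (NatT ⇒ Brw) fun f => PiT (Increasing f) fun p =>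
      (PiT NatT fun n => Le (f ⬝ n) (iter w ⬝ n)) ⇒
      (PiT NatT fun n => IdT 0 BoolT (s ⬝ n) TT ⇒ PiT NatT fun m => Le (iter w ⬝ m) (Limit f p)) ⇒
      (PiT NatT fun n => SumT 0 (Le (f ⬝ n) (iota ⬝ n)) (Ex 0 NatT fun k => IdT 0 BoolT (s ⬝ k) TT)) ⇒
      C) ⇒ C

/-- Use the sequence given by `jumpT`. -/
def JumpE (jump w s C : Sch) (t : Sch → Sch → Sch → Sch → Sch → Sch) : Sch :=
  jump ⬝ w ⬝ s ⬝ C ⬝ Lam (NatT ⇒ Brw) fun f => Lam (Increasing f) fun p =>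
    Lam (PiT NatT fun n => Le (f ⬝ n) (iter w ⬝ n)) fun h₁ =>
    Lam (PiT NatT fun n => IdT 0 BoolT (s ⬝ n) TT ⇒
      PiT NatT fun m => Le (iter w ⬝ m) (Limit f p)) fun h₂ =>
    Lam (PiT NatT fun n => SumT 0 (Le (f ⬝ n) (iota ⬝ n))
      (Ex 0 NatT fun k => IdT 0 BoolT (s ⬝ k) TT)) fun h₃ => t f p h₁ h₂ h₃

def jumpS : Script :=
  Use le_refl fun leRefl => Use iota_le_iter fun iotaLe => Use le_iter fun leIter =>
  Use exIntro fun exIntro => Use ffNeTt fun ffNeTt => Use emptyRec fun emptyRec =>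
  Use le_limit fun leLimit =>
  let isT : Sch → Sch := fun b => IdT 0 BoolT b TT
  let S : Sch := NatT ⇒ BoolT
  let E : Sch → Sch := fun s => Ex 0 NatT fun k => isT (s ⬝ k)
  Let (Lam Brw fun w => Lam NatT fun n => Lam BoolT fun b =>
      BoolE (fun _ => Brw) (iota ⬝ n) (iter w ⬝ n) b) (Brw ⇒ NatT ⇒ BoolT ⇒ Brw) fun g =>
  -- The state `t s n` records whether `tt` occurs among the values of `s` before `n`. It starts at
  -- `ff`, and `step` lets it stay `tt` once reached; it selects between `iota n` and `iter w n`.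
  Let (Lam S fun s => Lam NatT fun n => Lam BoolT fun b =>
      BoolE (fun _ => BoolT) (s ⬝ n) TT b) (S ⇒ NatT ⇒ BoolT ⇒ BoolT) fun step =>
  Let (Lam S fun s => K (.natElim 0) ⬝ (Lam NatT fun _ => BoolT) ⬝ FF ⬝ (step ⬝ s)) (S ⇒ NatT ⇒ BoolT)
    fun t =>
  Let (Lam Brw fun w => Lam S fun s => Lam NatT fun n => g ⬝ w ⬝ n ⬝ (t ⬝ s ⬝ n)) (Brw ⇒ S ⇒ NatT ⇒ Brw)
    fun f =>
  -- While the state is constant, both branches increase by one successor. At the jump, `succ (iota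
  -- k) ≤ succ (iter w k)` because `zero ≤ w`.
  Let (Lam Brw fun w => Lam S fun s => Lam NatT fun k => BoolE
      (fun b => Le (BSucc (g ⬝ w ⬝ k ⬝ b)) (g ⬝ w ⬝ NSucc k ⬝ (step ⬝ s ⬝ k ⬝ b)))
      (BoolE (fun c => Le (BSucc (iota ⬝ k)) (g ⬝ w ⬝ NSucc k ⬝ c))
        (leRefl ⬝ BSucc (iota ⬝ k))
        (K .leSuccMono ⬝ (iota ⬝ k) ⬝ (iter w ⬝ k) ⬝ (iotaLe ⬝ w ⬝ k)) (s ⬝ k))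
      (leRefl ⬝ BSucc (iter w ⬝ k)) (t ⬝ s ⬝ k))
    (PiT Brw fun w => PiT S fun s => PiT NatT fun k =>
      Lt (g ⬝ w ⬝ k ⬝ (t ⬝ s ⬝ k)) (g ⬝ w ⬝ NSucc k ⬝ (step ⬝ s ⬝ k ⬝ (t ⬝ s ⬝ k)))) fun inc' =>
  Let inc' (PiT Brw fun w => PiT S fun s => Increasing (f ⬝ w ⬝ s)) fun inc =>
  Let (Lam Brw fun w => Lam NatT fun k => Lam BoolT fun b => BoolE
      (fun b => isT b ⇒ Le (iter w ⬝ k) (g ⬝ w ⬝ k ⬝ b))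
      (Lam (isT FF) fun e => emptyRec ⬝ Le (iter w ⬝ k) (g ⬝ w ⬝ k ⬝ FF) ⬝ (ffNeTt ⬝ e))
      (Lam (isT TT) fun _ => leRefl ⬝ (iter w ⬝ k)) b)
    (PiT Brw fun w => PiT NatT fun k => PiT BoolT fun b => isT b ⇒ Le (iter w ⬝ k) (g ⬝ w ⬝ k ⬝ b))
    fun leG =>
  Let (Lam Brw fun w => Lam NatT fun n => Lam BoolT fun b =>
      BoolE (fun b => Le (g ⬝ w ⬝ n ⬝ b) (iter w ⬝ n)) (iotaLe ⬝ w ⬝ n) (leRefl ⬝ (iter w ⬝ n)) b)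
    (PiT Brw fun w => PiT NatT fun n => PiT BoolT fun b => Le (g ⬝ w ⬝ n ⬝ b) (iter w ⬝ n)) fun gLe =>
  Let (Lam S fun s => Lam NatT fun n => Lam BoolT fun b =>
      BoolE (fun b => isT (s ⬝ n) ⇒ isT (step ⬝ s ⬝ n ⬝ b)) (Lam (isT (s ⬝ n)) fun e => e)
        (Lam (isT (s ⬝ n)) fun _ => Refl 0 BoolT TT) b)
    (PiT S fun s => PiT NatT fun n => PiT BoolT fun b => isT (s ⬝ n) ⇒ isT (step ⬝ s ⬝ n ⬝ b)) fun start =>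
  Let (Lam S fun s => Lam NatT fun n => Lam BoolT fun b =>
      BoolE (fun b => isT b ⇒ isT (step ⬝ s ⬝ n ⬝ b))
        (Lam (isT FF) fun e => emptyRec ⬝ isT (s ⬝ n) ⬝ (ffNeTt ⬝ e))
        (Lam (isT TT) fun e => e) b)
    (PiT S fun s => PiT NatT fun n => PiT BoolT fun b => isT b ⇒ isT (step ⬝ s ⬝ n ⬝ b)) fun stay =>
  Let (Lam S fun s => NatInd (fun n => isT (t ⬝ s ⬝ n) ⇒ E s)
      (Lam (isT FF) fun e => emptyRec ⬝ E s ⬝ (ffNeTt ⬝ e))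
      (fun n h => BoolE (fun b => (isT b ⇒ E s) ⇒ isT (step ⬝ s ⬝ n ⬝ b) ⇒ E s)
        (Lam (isT FF ⇒ E s) fun _ => Lam (isT (s ⬝ n)) fun e =>
          ExI exIntro NatT (fun k => isT (s ⬝ k)) n e)
        (Lam (isT TT ⇒ E s) fun h => Lam (isT TT) fun e => h ⬝ e) (t ⬝ s ⬝ n) ⬝ h))
    (PiT S fun s => PiT NatT fun n => isT (t ⬝ s ⬝ n) ⇒ E s) fun found =>
  Let (Lam Brw fun w => Lam S fun s => Lam NatT fun n => Lam BoolT fun b =>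
      let C : Sch → Sch := fun b => SumT 0 (Le (g ⬝ w ⬝ n ⬝ b) (iota ⬝ n)) (E s)
      BoolE (fun b => (isT b ⇒ E s) ⇒ C b)
        (Lam (isT FF ⇒ E s) fun _ =>
          K (.inl 0) ⬝ Le (iota ⬝ n) (iota ⬝ n) ⬝ E s ⬝ (leRefl ⬝ (iota ⬝ n)))
        (Lam (isT TT ⇒ E s) fun h =>
          K (.inr 0) ⬝ Le (g ⬝ w ⬝ n ⬝ TT) (iota ⬝ n) ⬝ E s ⬝ (h ⬝ Refl 0 BoolT TT)) b)
    (PiT Brw fun w => PiT S fun s => PiT NatT fun n => PiT BoolT fun b => (isT b ⇒ E s) ⇒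
      SumT 0 (Le (g ⬝ w ⬝ n ⬝ b) (iota ⬝ n)) (E s)) fun split =>
  let Q : Sch → Sch → Sch → Sch → Sch := fun w s m k =>
    ProdT 0 (isT (t ⬝ s ⬝ k)) (Le (iter w ⬝ m) (iter w ⬝ k))
  let mk : Sch → Sch → Sch → Sch → Sch → Sch → Sch := fun w s m k e l =>
    Pair 0 NatT (Q w s m) k (Pair 0 (isT (t ⬝ s ⬝ k)) (fun _ => Le (iter w ⬝ m) (iter w ⬝ k)) e l)
  let fst : Sch → Sch → Sch → Sch → Sch := fun w s m x => Fst 0 NatT (Q w s m) x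
  let snd₁ : Sch → Sch → Sch → Sch → Sch := fun w s m x =>
    Fst 0 (isT (t ⬝ s ⬝ fst w s m x)) (fun _ => Le (iter w ⬝ m) (iter w ⬝ fst w s m x))
      (Snd 0 NatT (Q w s m) x)
  let snd₂ : Sch → Sch → Sch → Sch → Sch := fun w s m x =>
    Snd 0 (isT (t ⬝ s ⬝ fst w s m x)) (fun _ => Le (iter w ⬝ m) (iter w ⬝ fst w s m x))
      (Snd 0 NatT (Q w s m) x)
  -- Once the state is `tt` at `n`, every `iter w m` lies below some `iter w k` at a `k` where the
  -- state is `tt` as well; `k` starts at `n` and grows along with `m`.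
  Let (Lam Brw fun w => Lam S fun s => Lam NatT fun n => Lam (isT (t ⬝ s ⬝ n)) fun e =>
      NatInd (fun m => Sig 0 NatT (Q w s m)) (mk w s NZero n e (leIter ⬝ w ⬝ n))
        fun m x => mk w s (NSucc m) (NSucc (fst w s m x))
          (stay ⬝ s ⬝ fst w s m x ⬝ (t ⬝ s ⬝ fst w s m x) ⬝ snd₁ w s m x)
          (K .leSuccMono ⬝ (iter w ⬝ m) ⬝ (iter w ⬝ fst w s m x) ⬝ snd₂ w s m x))
    (PiT Brw fun w => PiT S fun s => PiT NatT fun n => PiT (isT (t ⬝ s ⬝ n)) fun _ => PiT NatT fun m =>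
      Sig 0 NatT (Q w s m)) fun above =>
  -- A value `s n = tt` affects the state only from `n + 1` on, hence `NSucc n`.
  Let (Lam Brw fun w => Lam S fun s => Lam NatT fun n => Lam (isT (s ⬝ n)) fun e => Lam NatT fun m =>
      LetIn (Sig 0 NatT (Q w s m))
        (above ⬝ w ⬝ s ⬝ NSucc n ⬝ (start ⬝ s ⬝ n ⬝ (t ⬝ s ⬝ n) ⬝ e) ⬝ m) fun x =>
      LeTrans (iter w ⬝ m) (iter w ⬝ fst w s m x) (Limit (f ⬝ w ⬝ s) (inc ⬝ w ⬝ s)) (snd₂ w s m x)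
        (LeTrans (iter w ⬝ fst w s m x) (f ⬝ w ⬝ s ⬝ fst w s m x) (Limit (f ⬝ w ⬝ s) (inc ⬝ w ⬝ s))
          (leG ⬝ w ⬝ fst w s m x ⬝ (t ⬝ s ⬝ fst w s m x) ⬝ snd₁ w s m x)
          (leLimit ⬝ (f ⬝ w ⬝ s) ⬝ (inc ⬝ w ⬝ s) ⬝ fst w s m x)))
    (PiT Brw fun w => PiT S fun s => PiT NatT fun n => PiT (isT (s ⬝ n)) fun _ => PiT NatT fun m =>
      Le (iter w ⬝ m) (Limit (f ⬝ w ⬝ s) (inc ⬝ w ⬝ s))) fun unbounded =>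
  Prove
    (Lam Brw fun w => Lam S fun s => Lam (U 0) fun C =>
      Lam (PiT (NatT ⇒ Brw) fun f => PiT (Increasing f) fun p =>
        (PiT NatT fun n => Le (f ⬝ n) (iter w ⬝ n)) ⇒
        (PiT NatT fun n => IdT 0 BoolT (s ⬝ n) TT ⇒ PiT NatT fun m => Le (iter w ⬝ m) (Limit f p)) ⇒
        (PiT NatT fun n => SumT 0 (Le (f ⬝ n) (iota ⬝ n))
          (Ex 0 NatT fun k => IdT 0 BoolT (s ⬝ k) TT)) ⇒ C) fun k =>
      k ⬝ (f ⬝ w ⬝ s) ⬝ (inc ⬝ w ⬝ s) ⬝ (Lam NatT fun n => gLe ⬝ w ⬝ n ⬝ (t ⬝ s ⬝ n)) ⬝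
        (unbounded ⬝ w ⬝ s) ⬝ (Lam NatT fun n => split ⬝ w ⬝ s ⬝ n ⬝ (t ⬝ s ⬝ n) ⬝ (found ⬝ s ⬝ n)))
    jumpT
theorem jump : Inhabited jumpT := .of_check jumpS (by decide +kernel)

/-- `ω < x` is decidable only if the limited principle of omniscience holds. -/
def lpoOfDecOmegaLtT : Sch :=
  PiT (Increasing iota) fun p => (PiT Brw fun x => Dec (Lt (Limit iota p) x)) ⇒ LPO
-- If `ω < limit f`, then `ω < f n` for some `n`, and `f n ≤ n ≤ ω` is impossible, so `tt` has
-- occurred. If not, no value can be `tt`, as then `limit f` would lie above `succ ω`. The witness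
-- `p` stays a variable, so the term for reflexivity is not unfolded.
def lpoOfDecOmegaLtS : Script :=
  Use jump fun jump => Use sumRec fun sumRec => Use emptyRec fun emptyRec => Use exElim fun exElim =>
  Use boolCases fun boolCases => Use exists_lt_of_lt_limit fun sl => Use lt_irrefl fun irrefl =>
  Use le_limit fun leLimit => Prove
    (Lam (Increasing iota) fun p =>
      let ω := Limit iota p
      Lam (PiT Brw fun x => Dec (Lt ω x)) fun d => Lam (NatT ⇒ BoolT) fun s =>
      let E := Ex 0 NatT fun n => IdT 0 BoolT (s ⬝ n) TT
      let N := PiT NatT fun n => IdT 0 BoolT (s ⬝ n) FF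
      JumpE jump ω s (SumT 0 N E) fun f q _ h₂ h₃ =>
        DecE sumRec (Lt ω (Limit f q)) (SumT 0 N E)
          (fun l => K (.inr 0) ⬝ N ⬝ E ⬝
            ExE exElim NatT (fun n => Lt ω (f ⬝ n)) E (ExProp NatT fun n => IdT 0 BoolT (s ⬝ n) TT)
              (fun n l => SumE sumRec (Le (f ⬝ n) (iota ⬝ n)) E E
                (fun l' => emptyRec ⬝ E ⬝ (irrefl ⬝ ω ⬝ LeTrans (BSucc ω) (f ⬝ n) ω l
                  (LeTrans (f ⬝ n) (iota ⬝ n) ω l' (leLimit ⬝ iota ⬝ p ⬝ n))))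
                (fun e => e) (h₃ ⬝ n))
              (sl ⬝ f ⬝ q ⬝ ω ⬝ l))
          (fun m => K (.inl 0) ⬝ N ⬝ E ⬝ Lam NatT fun n =>
            boolCases ⬝ (s ⬝ n) ⬝ IdT 0 BoolT (s ⬝ n) FF ⬝ (Lam (IdT 0 BoolT (s ⬝ n) FF) fun e => e) ⬝
              Lam (IdT 0 BoolT (s ⬝ n) TT) fun e => emptyRec ⬝ IdT 0 BoolT (s ⬝ n) FF ⬝
                -- The bound with index one is `succ ω`, so it is the strict inequality.
                (m ⬝ (h₂ ⬝ n ⬝ e ⬝ NSucc NZero)))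
          (d ⬝ Limit f q)) lpoOfDecOmegaLtT
theorem lpo_of_dec_omega_lt : Inhabited lpoOfDecOmegaLtT := .of_check lpoOfDecOmegaLtS (by decide +kernel)

end HoTT

namespace HoTT

open Judgement Tm

/-! ### Reflexivity and addition, with their proof terms -/

/-- `setOfProp` with a name for `setOfConstant`. -/
def setOfPropOf (setOfConstant : Sch) (i : ℕ) (A h : Sch) : Sch :=
  setOfConstant ⬝ A ⬝
    (Lam A fun x => Lam A fun y => Lam (IdT i A x y) fun _ => h ⬝ x ⬝ y) ⬝
    (Lam A fun x => Lam A fun y => Lam (IdT i A x y) fun _ => Lam (IdT i A x y) fun _ =>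
      Refl i (IdT i A x y) (h ⬝ x ⬝ y))

/-- The arguments of the eliminator in `brwIndProp`, with names for the motives, for the proofs that
they are sets and propositions, and for the methods for `succ` and `limit`. -/
def brwIndPropOf (A B hA hB ms ml : Sch) (hP : Sch → Sch) (z : Sch) : Sch :=
  KApp (.brwElim 0) [A, B, hA, hB, z, ms, ml,
    LamSeq A B ms fun f p F P => LamSeq A B ms fun g q G Q =>
      Lam (Simulated f g) fun s => Lam (Simulated g f) fun t =>
      Lam (SimulatedOver 0 B f F g G) fun _ => Lam (SimulatedOver 0 B g G f F) fun _ =>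
      hP (Limit g q) ⬝
        (Transport 0 0 Brw (fun x => A ⬝ x) (Limit f p) (Limit g q)
          (K .bisim ⬝ f ⬝ p ⬝ g ⬝ q ⬝ s ⬝ t) (ml ⬝ f ⬝ p ⬝ F ⬝ P)) ⬝
        (ml ⬝ g ⬝ q ⬝ G ⬝ Q),
    Lam Brw fun x => Lam (A ⬝ x) fun _ => Star,
    Lam Brw fun x => Lam Brw fun y => Lam Brw fun z =>
      Lam (A ⬝ x) fun _ => Lam (A ⬝ y) fun _ => Lam (A ⬝ z) fun _ =>
      Lam (Le x y) fun _ => Lam (Le y z) fun _ => Lam UnitT fun _ => Lam UnitT fun _ => Star,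
    Lam Brw fun x => Lam Brw fun y => Lam (A ⬝ x) fun _ => Lam (A ⬝ y) fun _ =>
      Lam (Le x y) fun _ => Lam UnitT fun _ => Star,
    LamSeq A B ms fun f _ _ _ => Lam Brw fun x => Lam (A ⬝ x) fun _ => Lam NatT fun k =>
      Lam (Le x (f ⬝ k)) fun _ => Lam UnitT fun _ => Star,
    LamSeq A B ms fun f _ _ _ => Lam Brw fun x => Lam (A ⬝ x) fun _ =>
      Lam (PiT NatT fun k => Le (f ⬝ k) x) fun _ => Lam (NatT ⇒ UnitT) fun _ => Star]

/-- Define the term `brwIndProp P hP z s l`. -/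
def BrwIndProp (P : Sch → Sch) (hP : Sch → Sch) (z : Sch) (s : Sch → Sch → Sch)
    (l : Sch → Sch → Sch → Sch) : Script :=
  Known hasType_setOfConstant₀ fun soc => Known hasType_unitProp fun unitProp =>
  Let (Lam Brw P) (Brw ⇒ U 0) fun A =>
  Let (Lam Brw fun x => Lam Brw fun y => Lam (A ⬝ x) fun _ => Lam (A ⬝ y) fun _ =>
      Lam (Le x y) fun _ => UnitT)
    (PiT Brw fun x => PiT Brw fun y => PiT (A ⬝ x) fun _ => PiT (A ⬝ y) fun _ =>
      PiT (Le x y) fun _ => U 0) fun B =>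
  Let (Lam Brw fun x => setOfPropOf soc 0 (P x) (hP x)) (PiT Brw fun x => isSet 0 (A ⬝ x)) fun hA =>
  Let (Lam Brw fun x => Lam Brw fun y => Lam (A ⬝ x) fun _ => Lam (A ⬝ y) fun _ =>
      Lam (Le x y) fun _ => unitProp)
    (PiT Brw fun x => PiT Brw fun y => PiT (A ⬝ x) fun a => PiT (A ⬝ y) fun b => PiT (Le x y) fun l =>
      isProp 0 (B ⬝ x ⬝ y ⬝ a ⬝ b ⬝ l)) fun hB =>
  Let (Lam Brw fun x => Lam (A ⬝ x) fun a => s x a) (PiT Brw fun x => PiT (A ⬝ x) fun _ => A ⬝ BSucc x)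
    fun ms =>
  Let (LamSeq A B ms fun f p F _ => l f p F) (PiSeq A B ms fun f p _ _ => A ⬝ Limit f p) fun ml =>
  Prove (brwIndPropOf A B hA hB ms ml hP z) (PiT Brw P)

/-- The term `leRefl` occurs in `ω`, so it is not enough that reflexivity is provable; this
particular term has to be well-typed. -/
def leReflTermS : Script :=
  BrwIndProp (fun x => Le x x) (fun x => K .leProp ⬝ x ⬝ x) (K .leZero ⬝ BZero)
    (fun x a => K .leSuccMono ⬝ x ⬝ x ⬝ a)
    (fun f p F => K .leLimiting ⬝ f ⬝ p ⬝ Limit f p ⬝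
      Lam NatT fun k => K .leCocone ⬝ f ⬝ p ⬝ (f ⬝ k) ⬝ k ⬝ (F ⬝ k))

theorem hasType_leRefl : HasType leRefl leReflT := .of_check leReflTermS (by decide +kernel)

/-- In `leSucc` the proof of reflexivity is the argument of a redex. The body is therefore checked
over a variable for it. -/
def leSuccTermS : Script :=
  Assume leReflT fun r =>
  BrwIndProp (fun x => Le x (BSucc x)) (fun x => K .leProp ⬝ x ⬝ BSucc x) (K .leZero ⬝ BSucc BZero)
    (fun x a => K .leSuccMono ⬝ x ⬝ BSucc x ⬝ a)
    (fun f p F => K .leLimiting ⬝ f ⬝ p ⬝ BSucc (Limit f p) ⬝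
      Lam NatT fun k => K .leTrans ⬝ (f ⬝ k) ⬝ BSucc (f ⬝ k) ⬝ BSucc (Limit f p) ⬝ (F ⬝ k) ⬝
        (K .leSuccMono ⬝ (f ⬝ k) ⬝ Limit f p ⬝
          (K .leCocone ⬝ f ⬝ p ⬝ (f ⬝ k) ⬝ k ⬝ (r ⬝ (f ⬝ k)))))

/-- The term under the redex in `leSucc`. -/
def leSuccBody : Tm :=
  match leSucc.close with
  | .app (.lam _ t) _ => t
  | t => t
theorem strict_leSuccBody :
    Strict (binders leSuccBody leSuccT.close) [leReflT.close] leSuccBody leSuccT.close :=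
  strict_of_checkTm leSuccTermS (by decide +kernel)

/-- Define the function `y ↦ x + y` in a context that declares `x`. -/
def addRight (k : Sch → Sch → (Sch → Sch) → (Sch → Sch) → (Sch → Sch → Sch → Sch) → Script) :
    Script :=
  Assume leReflT fun lr => Assume leSuccT fun ls => Assume Brw fun x =>
  Known hasType_setOfConstant₀ fun soc =>
  Let (Lam Brw fun z => Le x z) (Brw ⇒ U 0) fun R =>
  let val : Sch → Sch := fun a => K (.fst 0) ⬝ Brw ⬝ R ⬝ a
  let bound : Sch → Sch := fun a => K (.snd 0) ⬝ Brw ⬝ R ⬝ a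
  let mkAbove : Sch → Sch → Sch := fun z l => K (.pair 0) ⬝ Brw ⬝ R ⬝ z ⬝ l
  Let (K (.sig 0) ⬝ Brw ⬝ R) (U 0) fun S =>
  let aboveEq : Sch → Sch → Sch → Sch → Sch → Sch := fun z l z' l' e =>
    PathInd 0 0 Brw z
      (fun w _ => PiT (Le x w) fun m => IdT 0 S (mkAbove z l) (mkAbove w m))
      (Lam (Le x z) fun m =>
        Ap 0 (Le x z) S (fun n => mkAbove z n) l m (K .leProp ⬝ x ⬝ z ⬝ l ⬝ m))
      z' e ⬝ l'
  let ap : Sch → Sch → Sch → Sch := fun a b p => Ap 0 S Brw val a b p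
  let φ : Sch → Sch → Sch → Sch := fun a b e => aboveEq (val a) (bound a) (val b) (bound b) e
  Let (Lam Brw fun _ => S) (Brw ⇒ U 0) fun A =>
  Let (Lam Brw fun y => Lam Brw fun y' => Lam (A ⬝ y) fun a => Lam (A ⬝ y') fun b =>
      Lam (Le y y') fun _ => Le (val a) (val b))
    (PiT Brw fun y => PiT Brw fun y' => PiT (A ⬝ y) fun _ => PiT (A ⬝ y') fun _ =>
      PiT (Le y y') fun _ => U 0) fun B =>
  Let (Lam Brw fun _ => soc ⬝ S ⬝
      (Lam S fun a => Lam S fun b => Lam (IdT 0 S a b) fun p => φ a b (ap a b p)) ⬝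
      (Lam S fun a => Lam S fun b => Lam (IdT 0 S a b) fun p => Lam (IdT 0 S a b) fun q =>
        Ap 0 (IdT 0 Brw (val a) (val b)) (IdT 0 S a b) (φ a b) (ap a b p) (ap a b q)
          (K .brwSet ⬝ val a ⬝ val b ⬝ ap a b p ⬝ ap a b q)))
    (PiT Brw fun y => isSet 0 (A ⬝ y)) fun hA =>
  Let (Lam Brw fun y => Lam Brw fun y' => Lam (A ⬝ y) fun a => Lam (A ⬝ y') fun b =>
      Lam (Le y y') fun _ => K .leProp ⬝ val a ⬝ val b)
    (PiT Brw fun x => PiT Brw fun y => PiT (A ⬝ x) fun a => PiT (A ⬝ y) fun b => PiT (Le x y) fun l =>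
      isProp 0 (B ⬝ x ⬝ y ⬝ a ⬝ b ⬝ l)) fun hB =>
  Let (mkAbove x (lr ⬝ x)) (A ⬝ BZero) fun mz =>
  Let (Lam Brw fun y => Lam (A ⬝ y) fun a =>
      mkAbove (BSucc (val a))
        (K .leTrans ⬝ x ⬝ val a ⬝ BSucc (val a) ⬝ bound a ⬝ (ls ⬝ val a)))
    (PiT Brw fun y => PiT (A ⬝ y) fun _ => A ⬝ BSucc y) fun ms =>
  let seq : Sch → Sch := fun F => Lam NatT fun k => val (F ⬝ k)
  let lim : Sch → Sch → Sch := fun F P => Limit (seq F) P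
  let limBound : Sch → Sch → Sch := fun F P =>
    K .leCocone ⬝ seq F ⬝ P ⬝ x ⬝ NZero ⬝ bound (F ⬝ NZero)
  Let (LamSeq A B ms fun _ _ F P => mkAbove (lim F P) (limBound F P))
    (PiSeq A B ms fun f p _ _ => A ⬝ Limit f p) fun ml =>
  let sim : Sch → Sch → Sch → Sch → Sch → Sch := fun f F g G H =>
    Lam NatT fun k =>
      let D : Sch → Sch := fun n => Sig 0 (Le (f ⬝ k) (g ⬝ n)) fun l =>
        B ⬝ (f ⬝ k) ⬝ (g ⬝ n) ⬝ (F ⬝ k) ⬝ (G ⬝ n) ⬝ l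
      let E : Sch → Sch := fun n => Le (seq F ⬝ k) (seq G ⬝ n)
      K (.truncElim 0 0) ⬝ Sig 0 NatT D ⬝ (Lam (Ex 0 NatT D) fun _ => Ex 0 NatT E) ⬝
        (Lam (Ex 0 NatT D) fun _ => K (.squash 0) ⬝ Sig 0 NatT E) ⬝
        (Lam (Sig 0 NatT D) fun w => K (.tr 0) ⬝ Sig 0 NatT E ⬝
          Pair 0 NatT E (Fst 0 NatT D w)
            (Snd 0 (Le (f ⬝ k) (g ⬝ Fst 0 NatT D w))
              (fun l => B ⬝ (f ⬝ k) ⬝ (g ⬝ Fst 0 NatT D w) ⬝ (F ⬝ k) ⬝ (G ⬝ Fst 0 NatT D w) ⬝ l)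
              (Snd 0 NatT D w))) ⬝
        (H ⬝ k)
  Let (LamSeq A B ms fun f p F P => LamSeq A B ms fun g q G Q =>
      Lam (Simulated f g) fun s => Lam (Simulated g f) fun t =>
      Lam (SimulatedOver 0 B f F g G) fun H => Lam (SimulatedOver 0 B g G f F) fun H' =>
      PathInd 0 0 Brw (Limit f p)
        (fun z e => IdT 0 S
          (Transport 0 0 Brw (fun w => A ⬝ w) (Limit f p) z e (ml ⬝ f ⬝ p ⬝ F ⬝ P))
          (ml ⬝ g ⬝ q ⬝ G ⬝ Q))
        (aboveEq (lim F P) (limBound F P) (lim G Q) (limBound G Q)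
          (K .bisim ⬝ seq F ⬝ P ⬝ seq G ⬝ Q ⬝ sim f F g G H ⬝ sim g G f F H'))
        (Limit g q) (K .bisim ⬝ f ⬝ p ⬝ g ⬝ q ⬝ s ⬝ t))
    (BisimMethod 0 A B ms ml) fun mb =>
  Let (Lam Brw fun y => Lam (A ⬝ y) fun a => bound a) (LeZeroMethod A B mz) fun m₁ =>
  -- Strict checking compares the types of leading binders literally. The hypotheses are thus
  -- written as inequalities of values, as in `addition`, and not as instances of `B`.
  Let (Lam Brw fun y => Lam Brw fun y' => Lam Brw fun z =>
      Lam (A ⬝ y) fun a => Lam (A ⬝ y') fun b => Lam (A ⬝ z) fun c =>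
      Lam (Le y y') fun _ => Lam (Le y' z) fun _ =>
      Lam (Le (val a) (val b)) fun l => Lam (Le (val b) (val c)) fun l' =>
      K .leTrans ⬝ val a ⬝ val b ⬝ val c ⬝ l ⬝ l')
    (PiT Brw fun x' => PiT Brw fun y => PiT Brw fun z =>
      PiT (A ⬝ x') fun a => PiT (A ⬝ y) fun b => PiT (A ⬝ z) fun c =>
      PiT (Le x' y) fun l => PiT (Le y z) fun l' =>
      Le (val a) (val b) ⇒ Le (val b) (val c) ⇒
      (B ⬝ x' ⬝ z ⬝ a ⬝ c ⬝ (K .leTrans ⬝ x' ⬝ y ⬝ z ⬝ l ⬝ l'))) fun m₂ =>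
  Let (Lam Brw fun y => Lam Brw fun y' => Lam (A ⬝ y) fun a => Lam (A ⬝ y') fun b =>
      Lam (Le y y') fun _ => Lam (Le (val a) (val b)) fun l =>
      K .leSuccMono ⬝ val a ⬝ val b ⬝ l)
    (PiT Brw fun x' => PiT Brw fun y => PiT (A ⬝ x') fun a => PiT (A ⬝ y) fun b =>
      PiT (Le x' y) fun l => Le (val a) (val b) ⇒
      (B ⬝ BSucc x' ⬝ BSucc y ⬝ (ms ⬝ x' ⬝ a) ⬝ (ms ⬝ y ⬝ b) ⬝ (K .leSuccMono ⬝ x' ⬝ y ⬝ l))) fun m₃ =>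
  Let (LamSeq A B ms fun f _ F P => Lam Brw fun y => Lam (A ⬝ y) fun a => Lam NatT fun k =>
      Lam (Le y (f ⬝ k)) fun _ => Lam (Le (val a) (val (F ⬝ k))) fun l =>
      K .leCocone ⬝ seq F ⬝ P ⬝ val a ⬝ k ⬝ l)
    (PiSeq A B ms fun f p F P => PiT Brw fun y => PiT (A ⬝ y) fun a => PiT NatT fun k =>
      PiT (Le y (f ⬝ k)) fun l => Le (val a) (val (F ⬝ k)) ⇒
      (B ⬝ y ⬝ Limit f p ⬝ a ⬝ (ml ⬝ f ⬝ p ⬝ F ⬝ P) ⬝ (K .leCocone ⬝ f ⬝ p ⬝ y ⬝ k ⬝ l))) fun m₄ =>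
  Let (LamSeq A B ms fun f _ F P => Lam Brw fun y => Lam (A ⬝ y) fun a =>
      Lam (PiT NatT fun k => Le (f ⬝ k) y) fun _ =>
      Lam (PiT NatT fun k => Le (val (F ⬝ k)) (val a)) fun l =>
      K .leLimiting ⬝ seq F ⬝ P ⬝ val a ⬝ l)
    (PiSeq A B ms fun f p F P => PiT Brw fun y => PiT (A ⬝ y) fun a =>
      PiT (PiT NatT fun k => Le (f ⬝ k) y) fun l =>
      (PiT NatT fun k => Le (val (F ⬝ k)) (val a)) ⇒
      (B ⬝ Limit f p ⬝ y ⬝ (ml ⬝ f ⬝ p ⬝ F ⬝ P) ⬝ a ⬝ (K .leLimiting ⬝ f ⬝ p ⬝ y ⬝ l))) fun m₅ =>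
  let ps : List Sch := [A, B, hA, hB, mz, ms, ml, mb, m₁, m₂, m₃, m₄, m₅]
  k lr x val (fun y => KApp (.brwElim 0) (ps ++ [y])) fun y y' l => KApp (.leElim 0) (ps ++ [y, y', l])

/-- The term `λ y. x + y` in the context of `addRight`. -/
def addRightTm : Tm :=
  match addition.close with
  | .app (.lam _ (.app (.lam _ (.lam _ t)) _)) _ => t
  | t => t

/-- Variable 0 is the summand `x`; the others stand for the two arguments of the redexes in
`addition`. -/
def addCtx : Ctx := [Brw.close, leSuccT.close, leReflT.close]

def addRightS : Script := addRight fun _ _ val rec _ =>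
  Prove (Lam Brw fun y => val (rec y)) (Brw ⇒ Brw)

/-- `x + ω` is the least upper bound of all `x + n`, for the function `add = λ y. x + y`. -/
def AddOmega (x add : Sch) : Sch :=
  PiT (Increasing iota) fun p =>
    ProdT 0 (PiT NatT fun k => Le (iter x ⬝ k) (add ⬝ Limit iota p))
      (PiT Brw fun z => (PiT NatT fun k => Le (iter x ⬝ k) z) ⇒ Le (add ⬝ Limit iota p) z)

/-- `AddOmega` follows from the properties of addition. -/
def AddOmegaOf : Sch :=
  PiT Brw fun x => PiT (Brw ⇒ Brw) fun add =>
    PiT (Le x (add ⬝ BZero)) fun _ => PiT (Le (add ⬝ BZero) x) fun _ =>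
    PiT (PiT Brw fun y => Le (BSucc (add ⬝ y)) (add ⬝ BSucc y)) fun _ =>
    PiT (PiT Brw fun y => Le (add ⬝ BSucc y) (BSucc (add ⬝ y))) fun _ =>
    PiT (PiT (NatT ⇒ Brw) fun f => PiT (Increasing f) fun p => PiT NatT fun k =>
      Le (add ⬝ (f ⬝ k)) (add ⬝ Limit f p)) fun _ =>
    PiT (PiT (NatT ⇒ Brw) fun f => PiT (Increasing f) fun p => PiT Brw fun z =>
      (PiT NatT fun k => Le (add ⬝ (f ⬝ k)) z) ⇒ Le (add ⬝ Limit f p) z) fun _ =>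
    AddOmega x add

/-- By induction, `x + n` and `succⁿ x` bound each other; the two limit properties then transfer the
least upper bound. With `add` a variable, the checker never meets the eliminator behind addition. -/
def addOmegaOf : Sch :=
  Lam Brw fun x => Lam (Brw ⇒ Brw) fun add =>
    Lam (Le x (add ⬝ BZero)) fun z => Lam (Le (add ⬝ BZero) x) fun z' =>
    Lam (PiT Brw fun y => Le (BSucc (add ⬝ y)) (add ⬝ BSucc y)) fun s =>
    Lam (PiT Brw fun y => Le (add ⬝ BSucc y) (BSucc (add ⬝ y))) fun s' =>
    Lam (PiT (NatT ⇒ Brw) fun f => PiT (Increasing f) fun p => PiT NatT fun k =>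
      Le (add ⬝ (f ⬝ k)) (add ⬝ Limit f p)) fun upper =>
    Lam (PiT (NatT ⇒ Brw) fun f => PiT (Increasing f) fun p => PiT Brw fun z =>
      (PiT NatT fun k => Le (add ⬝ (f ⬝ k)) z) ⇒ Le (add ⬝ Limit f p) z) fun least =>
    Lam (Increasing iota) fun p => Pair 0
      (PiT NatT fun k => Le (iter x ⬝ k) (add ⬝ Limit iota p))
      (fun _ => PiT Brw fun z => (PiT NatT fun k => Le (iter x ⬝ k) z) ⇒ Le (add ⬝ Limit iota p) z)
      (Lam NatT fun k => LeTrans (iter x ⬝ k) (add ⬝ (iota ⬝ k)) (add ⬝ Limit iota p)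
        (NatInd (fun n => Le (iter x ⬝ n) (add ⬝ (iota ⬝ n))) z
          (fun n h => LeTrans (BSucc (iter x ⬝ n)) (BSucc (add ⬝ (iota ⬝ n))) (add ⬝ BSucc (iota ⬝ n))
            (K .leSuccMono ⬝ (iter x ⬝ n) ⬝ (add ⬝ (iota ⬝ n)) ⬝ h) (s ⬝ (iota ⬝ n))) ⬝ k)
        (upper ⬝ iota ⬝ p ⬝ k))
      (Lam Brw fun w => Lam (PiT NatT fun k => Le (iter x ⬝ k) w) fun h =>
        least ⬝ iota ⬝ p ⬝ w ⬝ Lam NatT fun k => LeTrans (add ⬝ (iota ⬝ k)) (iter x ⬝ k) w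
          (NatInd (fun n => Le (add ⬝ (iota ⬝ n)) (iter x ⬝ n)) z'
            (fun n h => LeTrans (add ⬝ BSucc (iota ⬝ n)) (BSucc (add ⬝ (iota ⬝ n)))
              (BSucc (iter x ⬝ n)) (s' ⬝ (iota ⬝ n))
              (K .leSuccMono ⬝ (add ⬝ (iota ⬝ n)) ⬝ (iter x ⬝ n) ⬝ h)) ⬝ k)
          (h ⬝ k))

theorem hasType_addOmegaOf : HasType addOmegaOf AddOmegaOf :=
  .of_check (Prove addOmegaOf AddOmegaOf) (by decide +kernel)

/-- `AddOmega x add`, in a context that declares `x` and `add`. -/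
def addOmegaTm : Tm := (AddOmega (bvar 0) (bvar 1)).toTm 2

/-- The recursion equations for `zero` and `succ` hold judgementally, so reflexivity proves the
corresponding inequalities. Monotonicity in the second summand is the eliminator for the order. -/
def addOmegaS : Script := addRight fun lr x val rec recLe =>
  Known hasType_addOmegaOf fun addOmegaOf =>
  let addTm : Sch := Lam Brw fun y => val (rec y)
  let F : Sch → Sch := fun f => Lam NatT fun k => rec (f ⬝ k)
  let seq : Sch → Sch := fun f => Lam NatT fun k => val (F f ⬝ k)
  -- This is the witness that the computation rule at `limit` produces, so `add (limit f)` reduces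
  -- to the limit with exactly this witness.
  let inc : Sch → Sch → Sch := fun f p =>
    Lam NatT fun k => recLe (BSucc (f ⬝ k)) (f ⬝ NSucc k) (p ⬝ k)
  Let (Lam Brw fun y => Lam Brw fun y' => Lam (Le y y') fun l => recLe y y' l)
    (PiT Brw fun y => PiT Brw fun y' => PiT (Le y y') fun _ => Le (addTm ⬝ y) (addTm ⬝ y')) fun mono' =>
  Let addTm (Brw ⇒ Brw) fun add =>
  Let mono' (PiT Brw fun y => PiT Brw fun y' => PiT (Le y y') fun _ => Le (add ⬝ y) (add ⬝ y')) fun mono =>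
  Let (Lam (NatT ⇒ Brw) fun f => Lam (Increasing f) fun p => Lam Brw fun z =>
      Lam (PiT NatT fun k => Le (add ⬝ (f ⬝ k)) z) fun h => K .leLimiting ⬝ seq f ⬝ inc f p ⬝ z ⬝ h)
    (PiT (NatT ⇒ Brw) fun f => PiT (Increasing f) fun p => PiT Brw fun z =>
      PiT (PiT NatT fun k => Le (add ⬝ (f ⬝ k)) z) fun _ => Le (add ⬝ Limit f p) z) fun least =>
  Prove
    (addOmegaOf ⬝ x ⬝ add ⬝ (lr ⬝ x) ⬝ (lr ⬝ x) ⬝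
      (Lam Brw fun y => lr ⬝ BSucc (add ⬝ y)) ⬝ (Lam Brw fun y => lr ⬝ BSucc (add ⬝ y)) ⬝
      (Lam (NatT ⇒ Brw) fun f => Lam (Increasing f) fun p => Lam NatT fun k =>
        mono ⬝ (f ⬝ k) ⬝ Limit f p ⬝ (K .leCocone ⬝ f ⬝ p ⬝ (f ⬝ k) ⬝ k ⬝ (lr ⬝ (f ⬝ k)))) ⬝ least)
    (AddOmega x add)

theorem addRight_derivable : Derivable addCtx (ty addRightTm (Brw ⇒ Brw).close) :=
  (strict_of_checkTm addRightS (by decide +kernel)).derivable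

theorem addOmega_derivable : ∃ t, Derivable addCtx (ty t (inst addOmegaTm addRightTm)) :=
  exists_of_checkIn addOmegaS (by decide +kernel)

end HoTT

/-! ### Passing from open terms to the closed term for addition -/

namespace HoTT

open Judgement Tm

theorem IsSubst.of_nil (Γ : Ctx) (σ : ℕ → Tm) : IsSubst [] Γ σ := fun n A h => by simp at h

theorem Derivable.weaken_nil {t A : Tm} (h : Derivable [] (ty t A)) (Γ : Ctx) : Derivable Γ (ty t A) := by
  have := h.subst (IsSubst.of_nil Γ Tm.var)
  rwa [Judgement.subst, subst_id, subst_id] at this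

/-- One β-step under an accumulated substitution; iterating it removes the nested redexes of
`addition` one by one. -/
theorem Derivable.beta_subst {Γ Δ : Ctx} {σ : ℕ → Tm} {A B t a : Tm} {i : ℕ} (hσ : IsSubst Γ Δ σ)
    (hA : Derivable Γ (ty A (Tm.univ i))) (ht : Derivable (A :: Γ) (ty t B))
    (ha : Derivable Δ (ty a (A.subst σ))) :
    Derivable Δ (eq (Tm.app ((Tm.lam A t).subst σ) a) (t.subst (cons a σ)) (B.subst (cons a σ))) := by
  have := Derivable.beta (hA.subst hσ) (ht.subst (hσ.up A)) ha
  rwa [inst_subst_upSub, inst_subst_upSub] at this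

/-- Equal arguments give equal instances of a type, because both instances are β-reducts of the same
abstraction. -/
theorem Derivable.inst_congr {Γ : Ctx} {A B a a' : Tm} {i j : ℕ} (hA : Derivable Γ (ty A (Tm.univ i)))
    (hB : Derivable (A :: Γ) (ty B (Tm.univ j))) (ha : Derivable Γ (ty a A))
    (ha' : Derivable Γ (ty a' A)) (h : Derivable Γ (eq a a' A)) :
    Derivable Γ (eq (inst B a) (inst B a') (Tm.univ j)) := by
  have e₁ := Derivable.beta hA hB ha
  have e₂ := Derivable.beta hA hB ha'
  have e := Derivable.eqApp (.eqRefl (.lam hA hB)) h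
  exact .eqTrans (.eqSymm e₁) (.eqTrans e e₂)

theorem close_leSucc : leSucc.close = app (lam leReflT.close leSuccBody) leRefl.close :=
  beq_iff.1 (by decide +kernel)

theorem close_addition : addition.close = app (lam leReflT.close
    (app (lam leSuccT.close (lam Brw.close addRightTm)) leSucc.close)) leRefl.close :=
  beq_iff.1 (by decide +kernel)

theorem closed_leSucc : closedAt 0 leSucc.close = true := by decide +kernel

/-- The type of binary functions on Brouwer trees. -/
def BinOp : Sch := Brw ⇒ Brw ⇒ Brw

theorem leReflT_derivable (Γ : Ctx) : Derivable Γ (ty leReflT.close (univ 0)) :=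
  (strict_of_checkTm (Γ := []) (t := leReflT.close) (A := univ 0) (Prove leReflT (U 0))
    (by decide +kernel)).derivable.weaken_nil Γ

theorem leSuccT_derivable (Γ : Ctx) : Derivable Γ (ty leSuccT.close (univ 0)) :=
  (strict_of_checkTm (Γ := []) (t := leSuccT.close) (A := univ 0) (Prove leSuccT (U 0))
    (by decide +kernel)).derivable.weaken_nil Γ

theorem leRefl_derivable (Γ : Ctx) : Derivable Γ (ty leRefl.close leReflT.close) :=
  hasType_leRefl.strict.derivable.weaken_nil Γ

theorem leSucc_derivable (Γ : Ctx) : Derivable Γ (ty leSucc.close leSuccT.close) := by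
  refine Derivable.weaken_nil ?_ Γ
  rw [close_leSucc]
  exact .app (.lam (leReflT_derivable _) strict_leSuccBody.derivable) (leRefl_derivable _)

theorem addRight_lam_derivable :
    Derivable [leSuccT.close, leReflT.close] (ty (lam Brw.close addRightTm) BinOp.close) :=
  .lam (.con .brw) addRight_derivable

theorem addition_derivable : Derivable [] (ty addition.close BinOp.close) := by
  rw [close_addition]
  exact .app (.lam (leReflT_derivable _) (.app (.lam (leSuccT_derivable _) addRight_lam_derivable)
    (leSucc_derivable _))) (leRefl_derivable _)

/-- The substitution that replaces the variables for `leSucc` and `leRefl` by these terms. -/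
def addSubst : ℕ → Tm := cons leSucc.close (cons leRefl.close var)

theorem isSubst_addSubst : IsSubst addCtx [Brw.close] (cons (var 0) addSubst) :=
  .cons (.cons (.cons (.of_nil _ _) (leRefl_derivable _)) (leSucc_derivable _))
    (.var (Γ := [Brw.close]) (n := 0) rfl)

/-- Three β-steps, for the proofs of `x ≤ x` and `x ≤ succ x` and for `x`, lead from `addition` to
the body for which the universal property was checked. -/
theorem addition_app_eq : Derivable [Brw.close] (eq (app addition.close (var 0))
    (addRightTm.subst (cons (var 0) addSubst)) (Brw ⇒ Brw).close) := by
  have h₀ : Derivable [Brw.close] (ty (var 0) Brw.close) := .var (Γ := [Brw.close]) (n := 0) rfl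
  have e₁ := Derivable.beta_subst (σ := var) (.of_nil [Brw.close] _) (leReflT_derivable _)
    (.app (.lam (leSuccT_derivable _) addRight_lam_derivable) (leSucc_derivable _))
    (leRefl_derivable _)
  have e₂ := Derivable.beta_subst
    (IsSubst.cons (.of_nil [Brw.close] var) (leRefl_derivable [Brw.close])) (leSuccT_derivable _)
    addRight_lam_derivable (leSucc_derivable _)
  have e₃ := Derivable.beta_subst
    (IsSubst.cons (IsSubst.cons (.of_nil [Brw.close] var) (leRefl_derivable [Brw.close]))
      (leSucc_derivable _)) (.con .brw) addRight_derivable h₀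
  rw [subst_id, Tm.subst, subst_of_closed closed_leSucc, ← close_addition] at e₁
  exact .eqTrans (.eqApp (.eqTrans e₁ e₂) (.eqRefl h₀)) e₃

theorem addOmegaTm_derivable :
    Derivable [(Brw ⇒ Brw).close, Brw.close] (ty addOmegaTm (univ 0)) :=
  (strict_of_checkTm (Assume Brw fun x => Assume (Brw ⇒ Brw) fun add => Prove (AddOmega x add) (U 0))
    (by decide +kernel)).derivable

/-- `AddOmega` for addition. -/
def AdditionOmega (add : Sch) : Sch := PiT Brw fun x => AddOmega x (add ⬝ x)

/-- The property is first obtained for the reduct of `addition ⬝ x` and then moved back along the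
judgemental equality. -/
theorem addition_omega : ∃ t, Derivable [] (ty t (AdditionOmega addition).close) := by
  obtain ⟨t, ht⟩ := addOmega_derivable
  have h := ht.subst isSubst_addSubst
  -- The two free variables of `addOmegaTm` stand for `add` and `x`, and the lifted substitution
  -- fixes both.
  rw [Judgement.subst, subst_inst, subst_of_closedAt addOmegaTm 2 _ (by decide +kernel) (by
    intro n hn
    interval_cases n <;> rfl)] at h
  have h₀ : Derivable [Brw.close] (ty (var 0) Brw.close) := .var (Γ := [Brw.close]) (n := 0) rfl
  have h₁ : Derivable [Brw.close] (ty (app addition.close (var 0)) (Brw ⇒ Brw).close) :=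
    .app (addition_derivable.weaken_nil _) h₀
  have e := Derivable.inst_congr (i := 0) (.pi (.con .brw) (.con .brw)) addOmegaTm_derivable h₁
    (addRight_derivable.subst isSubst_addSubst) addition_app_eq
  have h₂ := Derivable.lam (i := 0) (.con .brw) (Derivable.conv h (.eqSymm e))
  have e' : pi (con .brw) (inst addOmegaTm (app addition.close (var 0))) =
      (AdditionOmega addition).close := by
    rw [inst_eq_msubst]
    exact beq_iff.1 (by decide +kernel)
  rw [e'] at h₂
  exact ⟨_, h₂⟩

/-! ### The principle of omniscience from decidable equality with `ω · 2` -/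

/-- The clauses of multiplication unfold `ω · 2` to `(zero + ω) + ω`, so the argument works with
`zero + ω` and need not identify it with `ω`. Only the universal property of `add` is assumed. -/
def lpoOfDecEqT : Sch :=
  PiT BinOp fun add => AdditionOmega add ⇒ PiT (Increasing iota) fun p =>
    (PiT Brw fun x => Dec (IdT 0 Brw x
      (add ⬝ (add ⬝ BZero ⬝ Limit iota p) ⬝ Limit iota p))) ⇒ LPO
def lpoOfDecEqS : Script :=
  Use jump fun jump => Use sumRec fun sumRec => Use emptyRec fun emptyRec => Use exElim fun exElim =>
  Use boolCases fun boolCases => Use exists_lt_of_lt_limit fun sl => Use lt_irrefl fun irrefl =>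
  Use le_of_eq fun leOfEq => Use symm fun symm => Use antisymm fun antisymm => Prove
    (Lam BinOp fun add => Lam (AdditionOmega add) fun H => Lam (Increasing iota) fun p =>
      let ω := Limit iota p
      let w := add ⬝ BZero ⬝ ω
      let ω₂ := add ⬝ w ⬝ ω
      let A : Sch → Sch := fun x => PiT NatT fun k => Le (iter x ⬝ k) (add ⬝ x ⬝ ω)
      let B : Sch → Sch := fun x =>
        PiT Brw fun z => (PiT NatT fun k => Le (iter x ⬝ k) z) ⇒ Le (add ⬝ x ⬝ ω) z
      Lam (PiT Brw fun x => Dec (IdT 0 Brw x ω₂)) fun d => Lam (NatT ⇒ BoolT) fun s =>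
      -- `iter` from `zero` is `iota` itself, so this bounds all finite trees by `w = zero + ω`.
      LetIn (A BZero) (Fst 0 (A BZero) (fun _ => B BZero) (H ⬝ BZero ⬝ p)) fun iotaLe =>
      LetIn (A w) (Fst 0 (A w) (fun _ => B w) (H ⬝ w ⬝ p)) fun iterLe =>
      let E := Ex 0 NatT fun n => IdT 0 BoolT (s ⬝ n) TT
      let N := PiT NatT fun n => IdT 0 BoolT (s ⬝ n) FF
      JumpE jump w s (SumT 0 N E) fun f q h₁ h₂ h₃ =>
        let x := Limit f q
        DecE sumRec (IdT 0 Brw x ω₂) (SumT 0 N E)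
          (fun e => K (.inr 0) ⬝ N ⬝ E ⬝
            ExE exElim NatT (fun n => Lt w (f ⬝ n)) E (ExProp NatT fun n => IdT 0 BoolT (s ⬝ n) TT)
              (fun n l => SumE sumRec (Le (f ⬝ n) (iota ⬝ n)) E E
                (fun l' => emptyRec ⬝ E ⬝ (irrefl ⬝ w ⬝ LeTrans (BSucc w) (f ⬝ n) w l
                  (LeTrans (f ⬝ n) (iota ⬝ n) w l' (iotaLe ⬝ n))))
                (fun e => e) (h₃ ⬝ n))
              -- `succ w` is the iterate with index one and lies below `ω₂ = x`; hence `w < limit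
              -- f`, and inversion finds an index at which `f` has jumped.
              (sl ⬝ f ⬝ q ⬝ w ⬝ LeTrans (BSucc w) ω₂ x (iterLe ⬝ NSucc NZero)
                (leOfEq ⬝ ω₂ ⬝ x ⬝ (symm ⬝ Brw ⬝ x ⬝ ω₂ ⬝ e))))
          (fun m => K (.inl 0) ⬝ N ⬝ E ⬝ Lam NatT fun n =>
            boolCases ⬝ (s ⬝ n) ⬝ IdT 0 BoolT (s ⬝ n) FF ⬝ (Lam (IdT 0 BoolT (s ⬝ n) FF) fun e => e) ⬝
              Lam (IdT 0 BoolT (s ⬝ n) TT) fun e => emptyRec ⬝ IdT 0 BoolT (s ⬝ n) FF ⬝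
                -- The terms of `f` never exceed the iterates of `w`, so `x ≤ ω₂` always holds. A
                -- value `tt` puts all iterates below `x`, whence `ω₂ ≤ x` by leastness.
                (m ⬝ (antisymm ⬝ x ⬝ ω₂ ⬝
                  (K .leLimiting ⬝ f ⬝ q ⬝ ω₂ ⬝ Lam NatT fun k =>
                    LeTrans (f ⬝ k) (iter w ⬝ k) ω₂ (h₁ ⬝ k) (iterLe ⬝ k)) ⬝
                  (Snd 0 (A w) (fun _ => B w) (H ⬝ w ⬝ p) ⬝ x ⬝ (h₂ ⬝ n ⬝ e)))))
          (d ⬝ x)) lpoOfDecEqT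
theorem lpo_of_decEq : Inhabited lpoOfDecEqT := .of_check lpoOfDecEqS (by decide +kernel)

/-! ### The equivalences -/

def DecLt : Sch := PiT Brw fun x => PiT Brw fun y => Dec (Lt x y)

def DecOmegaLt (w : Sch) : Sch := PiT Brw fun x => Dec (Lt w x)

def DecEqTo (w : Sch) : Sch := PiT Brw fun x => Dec (IdT 0 Brw x w)

theorem decLt_of_decLe : Inhabited (DecLe ⇒ DecLt) :=
  .of_check (Prove (Lam DecLe fun d => Lam Brw fun x => Lam Brw fun y => d ⬝ BSucc x ⬝ y)
    (DecLe ⇒ DecLt)) (by decide +kernel)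

/-- Proved for a variable `w`, so that the term for `ω` enters only by substitution. -/
theorem decOmegaLt_of_decLt : Inhabited (PiT Brw fun w => DecLt ⇒ DecOmegaLt w) :=
  .of_check (Prove (Lam Brw fun w => Lam DecLt fun d => Lam Brw fun x => d ⬝ w ⬝ x)
    (PiT Brw fun w => DecLt ⇒ DecOmegaLt w)) (by decide +kernel)

theorem decEqTo_of_decEq : Inhabited (PiT Brw fun w => DecEqBrw ⇒ DecEqTo w) :=
  .of_check (Prove (Lam Brw fun w => Lam DecEqBrw fun d => Lam Brw fun x => d ⬝ x ⬝ w)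
    (PiT Brw fun w => DecEqBrw ⇒ DecEqTo w)) (by decide +kernel)

/-- `iotaIncreasing`, in a context that declares a variable for `leRefl`. -/
def iotaIncreasingOf (leRefl : Sch) : Sch := Lam NatT fun k => leRefl ⬝ BSucc (iota ⬝ k)

/-- Over a variable for reflexivity, `succ (ι k) ≤ ι (k + 1)` is reflexivity by computation of `ι`;
the actual proof of reflexivity is substituted afterwards. -/
theorem iotaIncreasing_derivable : Derivable [] (ty iotaIncreasing.close (Increasing iota).close) := by
  have h := (strict_of_checkTm (Γ := [leReflT.close]) (t := (iotaIncreasingOf (bvar 0)).toTm 1)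
    (A := (Increasing iota).close) (Assume leReflT fun r =>
      Prove (iotaIncreasingOf r) (Increasing iota)) (by decide +kernel)).derivable
  have h' := h.subst (IsSubst.single (leRefl_derivable []))
  have e : inst ((iotaIncreasingOf (bvar 0)).toTm 1) leRefl.close = iotaIncreasing.close := by
    rw [inst_eq_msubst]
    exact beq_iff.1 (by decide +kernel)
  rw [Judgement.subst, subst_of_closed (t := (Increasing iota).close) (by decide +kernel)] at h'
  rwa [← e]

theorem omega_derivable : Derivable [] (ty omega.close Brw.close) := by
  have h : Derivable [] (ty (K .limit ⬝ iota).close (pi (Increasing iota).close Brw.close)) :=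
    (strict_of_checkTm (Prove (K .limit ⬝ iota) (Increasing iota ⇒ Brw)) (by decide +kernel)).derivable
  exact .app h iotaIncreasing_derivable

theorem omegaTimesTwo_derivable : Derivable [] (ty (timesNat omega 2).close Brw.close) :=
  .app (.app addition_derivable (.app (.app addition_derivable (.con .bzero)) omega_derivable))
    omega_derivable

/-- Application of a closed function to a closed argument, where `b` is the instantiated type. -/
theorem derivable_app {t A B a T : Tm} (h : Derivable [] (ty t (pi A B))) (ha : Derivable [] (ty a A))
    (e : beq (msubst [a] 0 B) T = true) : Derivable [] (ty (app t a) T) := by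
  rw [← beq_iff.1 e, ← inst_eq_msubst]
  exact .app h ha

/-- Application of a closed function of non-dependent type. -/
theorem derivable_app_arr {t A B a T : Tm} (h : Derivable [] (ty t (pi A B)))
    (ha : Derivable [] (ty a A)) (e : beq (shift 1 0 T) B = true) : Derivable [] (ty (app t a) T) := by
  have := Derivable.app h ha
  rwa [← beq_iff.1 e, ← lift_eq_shift, inst_lift] at this

/-! ### Composition of implications and instances for the closed terms -/

theorem Implies.of_inhabited {P Q : Sch} (h : Inhabited (P ⇒ Q)) : Implies P Q := h.inh

/-- Composition of functions. A scheme may in principle read the number of binders around it; the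
two boolean hypotheses ensure that `Q` and `R` under one binder are the weakenings of their closed
forms. -/
theorem Implies.trans {P Q R : Sch} {i : ℕ} (hP : Derivable [] (ty P.close (Tm.univ i)))
    (hQ : beq (shift 1 0 Q.close) (Q.toTm 1) = true) (hR : beq (shift 1 0 R.close) (R.toTm 1) = true)
    (h₁ : Implies P Q) (h₂ : Implies Q R) : Implies P R := by
  obtain ⟨f, hf⟩ := h₁
  obtain ⟨g, hg⟩ := h₂
  have hf' : Derivable [] (ty f (Tm.pi P.close (lift Q.close))) := by
    rw [lift_eq_shift, beq_iff.1 hQ]; exact hf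
  have hg' : Derivable [] (ty g (Tm.pi Q.close (lift R.close))) := by
    rw [lift_eq_shift, beq_iff.1 hR]; exact hg
  have e (t : Tm) : rename (upRen Nat.succ) (lift t) = lift (lift t) := by
    rw [lift, lift, rename_rename, rename_rename]; rfl
  have h₃ := Derivable.app (hf'.weaken P.close) (.var (Γ := [P.close]) (n := 0) rfl)
  rw [e, inst_lift] at h₃
  have h₄ := Derivable.app (hg'.weaken P.close) h₃
  rw [e, inst_lift] at h₄
  have h₅ := Derivable.lam hP h₄
  rw [lift_eq_shift R.close, beq_iff.1 hR] at h₅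
  exact ⟨_, h₅⟩

theorem derivable_inst {A B T : Tm} {a : Tm} {i : ℕ} (h : Derivable [A] (ty B (Tm.univ i)))
    (ha : Derivable [] (ty a A)) (e : beq (msubst [a] 0 B) T = true) :
    Derivable [] (ty T (Tm.univ i)) := by
  rw [← beq_iff.1 e, ← inst_eq_msubst]
  exact h.subst (IsSubst.single ha)

theorem lpo_derivable : Derivable [] (ty LPO.close (univ 0)) :=
  (strict_of_checkTm (Prove LPO (U 0)) (by decide +kernel)).derivable

theorem decLe_derivable : Derivable [] (ty DecLe.close (univ 0)) :=
  (strict_of_checkTm (Prove DecLe (U 0)) (by decide +kernel)).derivable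

theorem decLt_derivable : Derivable [] (ty DecLt.close (univ 0)) :=
  (strict_of_checkTm (Prove DecLt (U 0)) (by decide +kernel)).derivable

theorem decEqBrw_derivable : Derivable [] (ty DecEqBrw.close (univ 0)) :=
  (strict_of_checkTm (Prove DecEqBrw (U 0)) (by decide +kernel)).derivable

theorem decOmegaLt_derivable : Derivable [] (ty (DecOmegaLt omega).close (univ 0)) :=
  derivable_inst (strict_of_checkTm (Γ := [Brw.close]) (t := (DecOmegaLt (bvar 0)).toTm 1)
    (A := univ 0) (Assume Brw fun w => Prove (DecOmegaLt w) (U 0)) (by decide +kernel)).derivable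
    omega_derivable (by decide +kernel)

theorem decEqTo_derivable : Derivable [] (ty (DecEqTo (timesNat omega 2)).close (univ 0)) :=
  derivable_inst (strict_of_checkTm (Γ := [Brw.close]) (t := (DecEqTo (bvar 0)).toTm 1)
    (A := univ 0) (Assume Brw fun w => Prove (DecEqTo w) (U 0)) (by decide +kernel)).derivable
    omegaTimesTwo_derivable (by decide +kernel)

theorem implies_decOmegaLt : Implies DecLt (DecOmegaLt omega) := by
  obtain ⟨t, ht⟩ := decOmegaLt_of_decLt.inh
  exact ⟨_, derivable_app ht omega_derivable (by decide +kernel)⟩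

theorem implies_decEqTo : Implies DecEqBrw (DecEqTo (timesNat omega 2)) := by
  obtain ⟨t, ht⟩ := decEqTo_of_decEq.inh
  exact ⟨_, derivable_app ht omegaTimesTwo_derivable (by decide +kernel)⟩

theorem implies_lpo_of_decOmegaLt : Implies (DecOmegaLt omega) LPO := by
  obtain ⟨t, ht⟩ := lpo_of_dec_omega_lt.inh
  exact ⟨_, derivable_app ht iotaIncreasing_derivable (by decide +kernel)⟩

/-- The abstract statement is applied to addition, its universal property and the witness in `ω`.
The instantiated types are compared by evaluation only, without type checking the large terms again.
-/
theorem implies_lpo_of_decEqTo : Implies (DecEqTo (timesNat omega 2)) LPO := by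
  obtain ⟨t, ht⟩ := lpo_of_decEq.inh
  obtain ⟨u, hu⟩ := addition_omega
  have h₁ := derivable_app (T := ((AdditionOmega addition) ⇒ PiT (Increasing iota) fun p =>
    (PiT Brw fun x => Dec (IdT 0 Brw x
      (addition ⬝ (addition ⬝ BZero ⬝ Limit iota p) ⬝ Limit iota p))) ⇒ LPO).close)
    ht addition_derivable (by decide +kernel)
  have h₂ := derivable_app_arr (T := (PiT (Increasing iota) fun p =>
    (PiT Brw fun x => Dec (IdT 0 Brw x
      (addition ⬝ (addition ⬝ BZero ⬝ Limit iota p) ⬝ Limit iota p))) ⇒ LPO).close)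
    h₁ hu (by decide +kernel)
  exact ⟨_, derivable_app h₂ iotaIncreasing_derivable (by decide +kernel)⟩

end HoTT

/-! ### The equivalence of the six statements -/

open HoTT in
theorem theorem48 :
    AllEquivalent
      [ LPO,
        PiT Brw fun x => PiT Brw fun y => Dec (Le x y),
        PiT Brw fun x => PiT Brw fun y => Dec (Lt x y),
        PiT Brw fun x => Dec (Lt omega x),
        PiT Brw fun x => PiT Brw fun y => Dec (IdT 0 Brw x y),
        PiT Brw fun x => Dec (IdT 0 Brw x (timesNat omega 2)) ] := by
  change AllEquivalent
    [LPO, DecLe, DecLt, DecOmegaLt omega, DecEqBrw, DecEqTo (timesNat omega 2)]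
  have lpo_decLe : Implies LPO DecLe := .of_inhabited decLe_of_lpo
  have decLe_decLt : Implies DecLe DecLt := .of_inhabited decLt_of_decLe
  have decLe_decEq : Implies DecLe DecEqBrw := .of_inhabited decEq_of_decLe
  have c₁ : Tm.beq (Tm.shift 1 0 LPO.close) (LPO.toTm 1) = true := by decide +kernel
  have c₂ : Tm.beq (Tm.shift 1 0 DecLe.close) (DecLe.toTm 1) = true := by decide +kernel
  have c₃ : Tm.beq (Tm.shift 1 0 DecLt.close) (DecLt.toTm 1) = true := by decide +kernel
  have c₄ : Tm.beq (Tm.shift 1 0 (DecOmegaLt omega).close) ((DecOmegaLt omega).toTm 1) = true := by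
    decide +kernel
  have c₅ : Tm.beq (Tm.shift 1 0 DecEqBrw.close) (DecEqBrw.toTm 1) = true := by decide +kernel
  have c₆ : Tm.beq (Tm.shift 1 0 (DecEqTo (timesNat omega 2)).close)
      ((DecEqTo (timesNat omega 2)).toTm 1) = true := by decide +kernel
  have lpo_decLt := lpo_decLe.trans lpo_derivable c₂ c₃ decLe_decLt
  have lpo_decEq := lpo_decLe.trans lpo_derivable c₂ c₅ decLe_decEq
  have decLt_lpo := implies_decOmegaLt.trans decLt_derivable c₄ c₁ implies_lpo_of_decOmegaLt
  have decEq_lpo := implies_decEqTo.trans decEqBrw_derivable c₆ c₁ implies_lpo_of_decEqTo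
  have decLe_lpo := decLe_decLt.trans decLe_derivable c₃ c₁ decLt_lpo
  -- LPO implies each of the six types, so a type that implies LPO implies all of them.
  have key : ∀ P, Derivable [] (.ty P.close (.univ 0)) → Implies P LPO →
      ∀ Q ∈ [LPO, DecLe, DecLt, DecOmegaLt omega, DecEqBrw, DecEqTo (timesNat omega 2)],
        Implies P Q := by
    intro P hP h Q hQ
    simp only [List.mem_cons, List.not_mem_nil, or_false] at hQ
    rcases hQ with rfl | rfl | rfl | rfl | rfl | rfl
    · exact h
    · exact h.trans hP c₁ c₂ lpo_decLe
    · exact h.trans hP c₁ c₃ lpo_decLt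
    · exact h.trans hP c₁ c₄ (lpo_decLt.trans lpo_derivable c₃ c₄ implies_decOmegaLt)
    · exact h.trans hP c₁ c₅ lpo_decEq
    · exact h.trans hP c₁ c₆ (lpo_decEq.trans lpo_derivable c₅ c₆ implies_decEqTo)
  intro P hP
  simp only [List.mem_cons, List.not_mem_nil, or_false] at hP
  rcases hP with rfl | rfl | rfl | rfl | rfl | rfl
  · exact key _ lpo_derivable (lpo_decLe.trans lpo_derivable c₂ c₁ decLe_lpo)
  · exact key _ decLe_derivable decLe_lpo
  · exact key _ decLt_derivable decLt_lpo
  · exact key _ decOmegaLt_derivable implies_lpo_of_decOmegaLt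
  · exact key _ decEqBrw_derivable decEq_lpo
  · exact key _ decEqTo_derivable implies_lpo_of_decEqTo
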